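/- Let $p$ be a prime, $\overline{\mathbb{Q}}_p$ an algebraic closure of $\mathbb{Q}_p$, and $\mathbb{Q}_p\subseteq E\subseteq F\subseteq\overline{\mathbb{Q}}_p$ with $F/\mathbb{Q}_p$ finite; let $\mathcal{O}_E\subseteq\mathcal{O}_F$ be the rings of integers, $\pi_E$ a uniformizer of $E$ and $q'=|\mathcal{O}_E/\pi_E|$. Let $f\in\mathcal{O}_E[[X]]$ satisfy $f\equiv\pi_E X \bmod X^2$ and $f\equiv X^{q'}\bmod \pi_E$. For $a\in\mathcal{O}_E$ let $[a](X)\in\mathcal{O}_E[[X]]$ be the unique power series with $[a](X)\equiv aX\bmod X^2$ and $f([a](X))=[a](f(X))$, and let $L(X,Y)\in\mathcal{O}_E[[X,Y]]$ be the Lubin–Tate formal group law of $f$, i.e. the unique power series with $L(X,Y)\equiv X+Y$ modulo terms of degree $\ge 2$ and $f(L(X,Y))=L(f(X),f(Y))$. Denote the resulting formal group by $\mathcal{F}_{LT}$ and let $$\mathcal{F}_{LT}[\pi_E^\infty]=\{\zeta\in\overline{\mathbb{Q}}_p : |\zeta|_p<1,\ [\pi_E^k](\zeta)=0 \text{ for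 some } k\ge 0\}.$$ Let $n\ge 0$. For $s\subseteq\{1,\dots,n\}$ and $\zeta_i\in\mathcal{F}_{LT}[\pi_E^\infty]$ ($i\in s$), the intersection of the hyperplanes $X_i=\zeta_i$ ($i\in s$) is the closed subscheme of $\mathrm{Spec}(\mathcal{O}_F[[X_1,\dots,X_n]])$ whose ideal is the contraction to $\mathcal{O}_F[[X_1,\dots,X_n]]$ of the ideal $(X_i-\zeta_i : i\in s)$ of $\mathcal{O}_K[[X_1,\dots,X_n]]$, where $K=F(\zeta_i : i\in s)$. An $\mathcal{F}_{LT}$-multiplicative change of variables on $\mathcal{O}_F[[X_1,\dots,X_n]]$ is a finite composition of swaps $X_i\leftrightarrow X_j$ and of substitutions $$X_i\mapsto L(\cdots L(L(X_i,[B_{i,i-1}](X_{i-1})),[B_{i,i-2}](X_{i-2})),\dots,[B_{i,1}](X_1)),\qquad 1\le i\le n,$$ with $B_{i,j}\in\mathcal{O}_E$. An $\mathcal{F}_{LT}$-special subscheme of $\mathrm{Spec}(\mathcal{O}_F[[X_1,\dots,X_n]])$ is a closed subscheme that after an $\mathcal{F}_{LT}$-multiplicative change of variables becomes a finite union of intersections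 of hyperplanes $X_i=\zeta_i$ with $\zeta_i\in\mathcal{F}_{LT}[\pi_E^\infty]$. Let $I$ be an ideal of $\mathcal{O}_F[[X_1,\dots,X_n]]$ and $A=\mathcal{O}_F[[X_1,\dots,X_n]]/I$. The $\mathcal{F}_{LT}$-special points on $\mathrm{Spec}(A)$ are the primes of $A$ whose preimage in $\mathcal{O}_F[[X_1,\dots,X_n]]$ is the ideal of the intersection of the hyperplanes $X_1=\zeta_1,\dots,X_n=\zeta_n$ for some $\zeta_1,\dots,\zeta_n\in\mathcal{F}_{LT}[\pi_E^\infty]$. Theorem. Every irreducible component of the Zariski closure in $\mathrm{Spec}(A)$ of the set of $\mathcal{F}_{LT}$-special points on $\mathrm{Spec}(A)$, with its reduced structure, is an $\mathcal{F}_{LT}$-special subscheme of $\mathrm{Spec}(\mathcal{O}_F[[X_1,\dots,X_n]])$. -/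

import Mathlib

noncomputable section
namespace LubinTate
open MvPowerSeries

/-- `ϖ` is a uniformizer: it is non-zero and generates the ideal of non-units. (For the ring of
integers of a finite extension of `ℚ_p`, the non-units form the maximal ideal.) -/
structure IsUniformizer {R : Type*} [CommRing R] (ϖ : R) : Prop where
  ne_zero : ϖ ≠ 0
  isUnit_iff : ∀ x : R, IsUnit x ↔ ¬ ϖ ∣ x

/-- `f` is a Lubin-Tate series for `ϖ`: `f ≡ ϖ X mod X²` and `f ≡ X ^ q mod ϖ`, where `q` is the
number of elements of the residue ring `R / ϖ`. -/
structure IsLubinTateSeries {R : Type*} [CommRing R] (ϖ : R) (f : PowerSeries R) : Prop where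
  constantCoeff_eq : PowerSeries.constantCoeff f = 0
  coeff_one_eq : PowerSeries.coeff 1 f = ϖ
  map_eq : PowerSeries.map (Ideal.Quotient.mk (Ideal.span {ϖ})) f =
    PowerSeries.X ^ Nat.card (R ⧸ Ideal.span {ϖ})

/-- `φ ≡ ∑ aᵢ Xᵢ` modulo terms of degree at least two, and `f ∘ φ = φ ∘ (f, …, f)`. -/
structure IsEquivariant {R : Type*} [CommRing R] {σ : Type*} (f : PowerSeries R) (a : σ → R)
    (φ : MvPowerSeries σ R) : Prop where
  constantCoeff_eq : constantCoeff φ = 0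
  coeff_single_eq : ∀ i, coeff (Finsupp.single i 1) φ = a i
  subst_eq : f.subst φ = φ.subst (fun i => f.subst (X i : MvPowerSeries σ R))

section Existence

variable {R : Type*} [CommRing R] {σ : Type*} {ϖ : R} {f : PowerSeries R}

/-- The defect `f ∘ φ - φ ∘ (f, …, f)`. -/
def defect (f : PowerSeries R) (φ : MvPowerSeries σ R) : MvPowerSeries σ R :=
  f.subst φ - φ.subst (fun i => f.subst (X i : MvPowerSeries σ R))

lemma constantCoeff_subst_X (hf : IsLubinTateSeries ϖ f) (i : σ) :
    constantCoeff (f.subst (X i : MvPowerSeries σ R)) = 0 :=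
  PowerSeries.constantCoeff_subst_eq_zero (by simp) _ hf.constantCoeff_eq

lemma hasSubst_subst_X [Finite σ] (hf : IsLubinTateSeries ϖ f) :
    HasSubst (fun i => f.subst (X i : MvPowerSeries σ R)) :=
  hasSubst_of_constantCoeff_zero (constantCoeff_subst_X hf)

lemma coeff_subst_add (hf : IsLubinTateSeries ϖ f) {φ δ : MvPowerSeries σ R}
    (hφ : constantCoeff φ = 0) (hδ : constantCoeff δ = 0) (m : σ →₀ ℕ)
    (hd : (m.degree : ℕ∞) ≤ δ.order) :
    coeff m (f.subst (φ + δ)) = coeff m (f.subst φ) + ϖ * coeff m δ := by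
  have h1 : PowerSeries.HasSubst (φ + δ) := .of_constantCoeff_zero (by simp [hφ, hδ])
  have h2 : PowerSeries.HasSubst φ := .of_constantCoeff_zero hφ
  have h3 : PowerSeries.HasSubst δ := .of_constantCoeff_zero hδ
  have key : ∀ k : ℕ, PowerSeries.coeff k f • coeff m ((φ + δ) ^ k) =
      PowerSeries.coeff k f • coeff m (φ ^ k) + (if k = 1 then ϖ * coeff m δ else 0) := by
    intro k
    match k with
    | 0 => simp
    | 1 => simp [hf.coeff_one_eq, mul_add]
    | k + 2 =>
      have : coeff m ((φ + δ) ^ (k + 2) - φ ^ (k + 2)) = 0 := by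
        rw [← Commute.geom_sum₂_mul (Commute.all _ _)]
        apply coeff_of_lt_order
        refine lt_of_lt_of_le ?_ le_order_mul
        have : (1 : ℕ∞) ≤ (∑ i ∈ Finset.range (k + 2),
            (φ + δ) ^ i * φ ^ (k + 2 - 1 - i)).order := by
          rw [one_le_order_iff_constCoeff_eq_zero]
          simp only [map_sum, map_mul, map_pow, map_add, hφ, hδ]
          apply Finset.sum_eq_zero
          intro i hi
          rcases Nat.eq_zero_or_pos i with rfl | h
          · simp
          · simp [h.ne']
        have h4 : (m.degree : ℕ∞) < 1 + m.degree := by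
          rw [add_comm]; exact_mod_cast Nat.lt_succ_self _
        refine lt_of_lt_of_le h4 (add_le_add this ?_)
        simpa using hd
      rw [map_sub, sub_eq_zero] at this
      simp [this]
  rw [PowerSeries.coeff_subst h1, PowerSeries.coeff_subst h2, finsum_congr key,
    finsum_add_distrib]
  · congr 1
    rw [finsum_eq_single _ 1 (by intro k hk; simp [hk])]
    simp
  · exact PowerSeries.coeff_subst_finite h2 f m
  · exact (Set.finite_singleton 1).subset (by intro k; simp; tauto)

lemma coeff_subst_eq [Finite σ] (hf : IsLubinTateSeries ϖ f) {δ : MvPowerSeries σ R} (m : σ →₀ ℕ)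
    (hd : (m.degree : ℕ∞) ≤ δ.order) :
    coeff m (δ.subst (fun i => f.subst (X i : MvPowerSeries σ R))) =
      ϖ ^ m.degree * coeff m δ := by
  classical
  obtain ⟨g, hg⟩ := PowerSeries.X_dvd_iff.mpr hf.constantCoeff_eq
  have hg0 : PowerSeries.constantCoeff g = ϖ := by
    rw [← hf.coeff_one_eq, hg, ← zero_add 1, PowerSeries.coeff_succ_X_mul]
    simp
  have hX : ∀ i : σ, PowerSeries.HasSubst (X i : MvPowerSeries σ R) := PowerSeries.HasSubst.X
  have hfi : ∀ i : σ, f.subst (X i : MvPowerSeries σ R) =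
      X i * g.subst (X i : MvPowerSeries σ R) := by
    intro i
    rw [hg, PowerSeries.subst_mul (hX i), PowerSeries.subst_X (hX i)]
  have hgi : ∀ i : σ, constantCoeff (g.subst (X i : MvPowerSeries σ R)) = ϖ := by
    intro i
    rw [PowerSeries.constantCoeff_subst (hX i), finsum_eq_single _ 0]
    · simpa using hg0
    · intro k hk; simp [hk]
  have hprod : ∀ e : σ →₀ ℕ, (e.prod fun s k => (f.subst (X s : MvPowerSeries σ R)) ^ k) =
      monomial e 1 * e.prod fun s k => (g.subst (X s : MvPowerSeries σ R)) ^ k := by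
    intro e
    rw [monomial_one_eq]
    simp [hfi, Finsupp.prod, mul_pow, Finset.prod_mul_distrib]
  rw [coeff_subst (hasSubst_subst_X hf), finsum_eq_single _ m]
  · rw [hprod, coeff_monomial_mul]
    simp only [le_refl, if_true, tsub_self, coeff_zero_eq_constantCoeff, one_mul, smul_eq_mul]
    rw [Finsupp.prod, map_prod]
    simp only [map_pow, hgi, Finset.prod_pow_eq_pow_sum]
    rw [mul_comm]; rfl
  · intro e he
    rw [hprod, coeff_monomial_mul]
    split_ifs with hle
    · have : e.degree < m.degree := by
        have h1 : m = e + (m - e) := (add_tsub_cancel_of_le hle).symm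
        have h2 : (m - e) ≠ 0 := by
          intro h0; apply he; rw [h1, h0, add_zero]
        have h3 : 0 < (m - e).degree := by
          rw [Nat.pos_iff_ne_zero]; rwa [Ne, Finsupp.degree_eq_zero_iff]
        have h4 : m.degree = e.degree + (m - e).degree := by
          conv_lhs => rw [h1]
          exact map_add _ _ _
        omega
      rw [coeff_of_lt_order, zero_smul]
      exact lt_of_lt_of_le (by exact_mod_cast this) hd
    · simp

lemma coeff_defect_add [Finite σ] (hf : IsLubinTateSeries ϖ f) {φ δ : MvPowerSeries σ R}
    (hφ : constantCoeff φ = 0) (hδ : constantCoeff δ = 0) (m : σ →₀ ℕ)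
    (hd : (m.degree : ℕ∞) ≤ δ.order) :
    coeff m (defect f (φ + δ)) = coeff m (defect f φ) + (ϖ - ϖ ^ m.degree) * coeff m δ := by
  rw [defect, defect, map_sub, map_sub, coeff_subst_add hf hφ hδ m hd,
    subst_add (hasSubst_subst_X hf), map_add, coeff_subst_eq hf m hd]
  ring

lemma exists_eq_single_of_degree_eq_one {m : σ →₀ ℕ} (h : m.degree = 1) :
    ∃ i, m = Finsupp.single i 1 := by
  have h0 : m ≠ 0 := by
    rintro rfl
    simp at h
  obtain ⟨i, hi⟩ := Finsupp.ne_iff.mp h0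
  have hle : Finsupp.single i 1 ≤ m := by
    rw [Finsupp.single_le_iff]
    exact Nat.one_le_iff_ne_zero.mpr hi
  have h1 := congrArg Finsupp.degree (add_tsub_cancel_of_le hle)
  rw [map_add, h, Finsupp.degree_single] at h1
  have h2 : m - Finsupp.single i 1 = 0 := by
    rw [← Finsupp.degree_eq_zero_iff]
    omega
  exact ⟨i, le_antisymm (tsub_eq_zero_iff_le.mp h2) hle⟩

lemma subst_X_pow_card {k : Type*} [Field k] [Finite k] (φ : MvPowerSeries σ k) :
    φ.subst (fun i => (X i : MvPowerSeries σ k) ^ Nat.card k) = φ ^ Nat.card k := by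
  let _ : Fintype k := Fintype.ofFinite k
  obtain ⟨ℓ, hℓ⟩ := CharP.exists k
  obtain ⟨r, hℓp, hcard⟩ := FiniteField.card k ℓ
  have : Fact ℓ.Prime := ⟨hℓp⟩
  have : ExpChar k ℓ := ExpChar.prime hℓp
  have hfrob : iterateFrobenius k ℓ r = RingHom.id k := by
    ext x
    rw [iterateFrobenius_def, ← hcard, FiniteField.pow_card]; rfl
  have hexp := map_iterateFrobenius_expand ℓ hℓp.ne_zero φ (r : ℕ)
  rw [hfrob, MvPowerSeries.map_id, RingHom.id_apply, expand, coe_substAlgHom] at hexp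
  rw [Nat.card_eq_fintype_card, hcard, hexp]

lemma dvd_coeff_defect [Finite σ] (hϖ : IsUniformizer ϖ) (hf : IsLubinTateSeries ϖ f)
    {φ : MvPowerSeries σ R} (hφ : constantCoeff φ = 0) (m : σ →₀ ℕ) :
    ϖ ∣ coeff m (defect f φ) := by
  have hnu : ¬ IsUnit ϖ := fun h => (hϖ.isUnit_iff ϖ).mp h dvd_rfl
  have hmax : (Ideal.span {ϖ}).IsMaximal := by
    rw [Ideal.isMaximal_iff]
    refine ⟨fun h => hnu (isUnit_of_dvd_one (Ideal.mem_span_singleton.mp h)), ?_⟩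
    intro J x _ hx hxJ
    rw [Ideal.mem_span_singleton] at hx
    have := Ideal.eq_top_of_isUnit_mem J hxJ ((hϖ.isUnit_iff x).mpr hx)
    simp [this]
  let _ : Field (R ⧸ Ideal.span {ϖ}) := Ideal.Quotient.field _
  have hq : Nat.card (R ⧸ Ideal.span {ϖ}) ≠ 0 := by
    intro h0
    have h1 := congrArg (PowerSeries.coeff 0) hf.map_eq
    rw [h0, PowerSeries.coeff_map, PowerSeries.coeff_zero_eq_constantCoeff_apply,
      hf.constantCoeff_eq] at h1
    simp at h1
  have : Finite (R ⧸ Ideal.span {ϖ}) := Nat.finite_of_card_ne_zero hq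
  have hz : MvPowerSeries.map (Ideal.Quotient.mk (Ideal.span {ϖ})) (defect f φ) = 0 := by
    rw [defect, map_sub, sub_eq_zero,
      PowerSeries.map_subst (PowerSeries.HasSubst.of_constantCoeff_zero hφ),
      map_subst (hasSubst_subst_X hf), hf.map_eq]
    have h1 : ∀ i : σ, MvPowerSeries.map (Ideal.Quotient.mk (Ideal.span {ϖ}))
        (f.subst (X i : MvPowerSeries σ R)) =
        (X i : MvPowerSeries σ (R ⧸ Ideal.span {ϖ})) ^ Nat.card (R ⧸ Ideal.span {ϖ}) := by
      intro i
      rw [PowerSeries.map_subst (PowerSeries.HasSubst.X i), hf.map_eq, map_X,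
        PowerSeries.subst_pow (PowerSeries.HasSubst.X i),
        PowerSeries.subst_X (PowerSeries.HasSubst.X i)]
    have h2 : PowerSeries.HasSubst
        (MvPowerSeries.map (Ideal.Quotient.mk (Ideal.span {ϖ})) φ) :=
      PowerSeries.HasSubst.of_constantCoeff_zero (by simp [hφ])
    rw [PowerSeries.subst_pow h2, PowerSeries.subst_X h2, funext h1, subst_X_pow_card]
  have h3 : Ideal.Quotient.mk (Ideal.span {ϖ}) (coeff m (defect f φ)) = 0 := by
    rw [← coeff_map, hz, map_zero]
  rwa [Ideal.Quotient.eq_zero_iff_mem, Ideal.mem_span_singleton] at h3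

lemma isUnit_one_sub_pow (hϖ : IsUniformizer ϖ) {k : ℕ} (hk : k ≠ 0) : IsUnit (1 - ϖ ^ k) := by
  rw [hϖ.isUnit_iff]
  intro h
  have h1 : ϖ ∣ 1 := by
    have := dvd_add h (dvd_pow_self ϖ hk)
    simpa using this
  exact (hϖ.isUnit_iff ϖ).mp (isUnit_of_dvd_one h1) dvd_rfl

lemma exists_step [Finite σ] (hϖ : IsUniformizer ϖ) (hf : IsLubinTateSeries ϖ f) (d : ℕ)
    {φ : MvPowerSeries σ R} (hφ : constantCoeff φ = 0)
    (h : ∀ m : σ →₀ ℕ, m.degree < d + 2 → coeff m (defect f φ) = 0) :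
    ∃ ψ : MvPowerSeries σ R, (∀ m : σ →₀ ℕ, m.degree ≠ d + 2 → coeff m ψ = coeff m φ) ∧
      ∀ m : σ →₀ ℕ, m.degree < d + 3 → coeff m (defect f ψ) = 0 := by
  have hdiv : ∀ m : σ →₀ ℕ, ∃ c : R, coeff m (defect f φ) + (ϖ - ϖ ^ (d + 2)) * c = 0 := by
    intro m
    obtain ⟨b, hb⟩ := dvd_coeff_defect hϖ hf hφ m
    obtain ⟨u, hu⟩ := isUnit_one_sub_pow hϖ (Nat.succ_ne_zero d)
    refine ⟨-(↑u⁻¹ * b), ?_⟩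
    have : ϖ - ϖ ^ (d + 2) = ϖ * u := by rw [hu, Nat.succ_eq_add_one]; ring
    rw [hb, this]
    have h2 : (u : R) * ↑u⁻¹ = 1 := u.mul_inv
    linear_combination (-ϖ * b) * h2
  choose c hc using hdiv
  let δ : MvPowerSeries σ R := fun m => if m.degree = d + 2 then c m else 0
  have hδ : ∀ m, coeff m δ = if m.degree = d + 2 then c m else 0 := fun m => rfl
  have hord : ((d + 2 : ℕ) : ℕ∞) ≤ δ.order := by
    apply nat_le_order
    intro m hm
    rw [hδ, if_neg hm.ne]
  have hδ0 : constantCoeff δ = 0 := by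
    rw [← coeff_zero_eq_constantCoeff_apply, hδ, if_neg]
    simp
  refine ⟨φ + δ, fun m hm => by rw [map_add, hδ, if_neg hm, add_zero], fun m hm => ?_⟩
  rw [coeff_defect_add hf hφ hδ0 m
    (le_trans (by exact_mod_cast Nat.lt_succ_iff.mp hm) hord), hδ]
  split_ifs with hmd
  · rw [hmd]; exact hc m
  · rw [h m (by omega)]; simp

/-- The lemma of Lubin and Tate: every linear form `∑ aᵢ Xᵢ` is the linear part of exactly one power
series commuting with `f`. -/
theorem existsUnique_isEquivariant [Finite σ] [IsDomain R] (hϖ : IsUniformizer ϖ)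
    (hf : IsLubinTateSeries ϖ f) (a : σ → R) :
    ∃! φ : MvPowerSeries σ R, IsEquivariant f a φ := by
  classical
  -- the linear part
  let φ₀ : MvPowerSeries σ R := fun m => if h : ∃ i, m = Finsupp.single i 1 then a h.choose else 0
  have hφ₀ : ∀ m : σ →₀ ℕ, m.degree ≠ 1 → coeff m φ₀ = 0 := by
    intro m hm
    refine dif_neg ?_
    rintro ⟨i, rfl⟩
    exact hm (by simp)
  have hφ₀' : ∀ i, coeff (Finsupp.single i 1) φ₀ = a i := by
    intro i
    have h : ∃ j, Finsupp.single i 1 = Finsupp.single j (1 : ℕ) := ⟨i, rfl⟩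
    have h1 : coeff (Finsupp.single i 1) φ₀ = a h.choose := dif_pos h
    rw [h1, ← Finsupp.single_left_injective one_ne_zero h.choose_spec]
  have hφ₀c : constantCoeff φ₀ = 0 := by
    rw [← coeff_zero_eq_constantCoeff_apply]
    exact hφ₀ 0 (by simp)
  have hφ₀o : ((1 : ℕ) : ℕ∞) ≤ φ₀.order := by
    apply nat_le_order
    intro m hm
    exact hφ₀ m hm.ne
  have hd0 : ∀ m : σ →₀ ℕ, m.degree < 2 → coeff m (defect f φ₀) = 0 := by
    intro m hm
    have h0 : defect f (0 : MvPowerSeries σ R) = 0 := by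
      rw [defect, PowerSeries.subst_zero_of_constantCoeff_zero hf.constantCoeff_eq,
        ← coe_substAlgHom (hasSubst_subst_X hf), map_zero, sub_zero]
    have h1 := coeff_defect_add hf (map_zero _) hφ₀c m
      (le_trans (by exact_mod_cast Nat.lt_succ_iff.mp hm) hφ₀o)
    rw [zero_add, h0, map_zero, zero_add] at h1
    rw [h1]
    rcases Nat.lt_succ_iff_lt_or_eq.mp hm with h | h
    · rw [hφ₀ m h.ne, mul_zero]
    · rw [h]; simp
  -- the successive approximations
  let P : ℕ → MvPowerSeries σ R → Prop := fun d φ => constantCoeff φ = 0 ∧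
    ∀ m : σ →₀ ℕ, m.degree < d + 2 → coeff m (defect f φ) = 0
  have hstep : ∀ d (φ : {φ // P d φ}), ∃ ψ : {ψ // P (d + 1) ψ},
      ∀ m : σ →₀ ℕ, m.degree ≠ d + 2 → coeff m ψ.1 = coeff m φ.1 := by
    rintro d ⟨φ, h1, h2⟩
    obtain ⟨ψ, h3, h4⟩ := exists_step hϖ hf d h1 h2
    refine ⟨⟨ψ, ?_, h4⟩, h3⟩
    rw [← coeff_zero_eq_constantCoeff_apply, h3 0 (by simp), coeff_zero_eq_constantCoeff_apply, h1]
  choose next hnext using hstep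
  let s : (d : ℕ) → {φ // P d φ} := fun d => Nat.rec ⟨φ₀, hφ₀c, hd0⟩ (fun d φ => next d φ) d
  have hs : ∀ d (m : σ →₀ ℕ), m.degree ≠ d + 2 → coeff m (s (d + 1)).1 = coeff m (s d).1 :=
    fun d m hm => hnext d (s d) m hm
  have hs' : ∀ (m : σ →₀ ℕ) d k, m.degree < d + 2 →
      coeff m (s (d + k)).1 = coeff m (s d).1 := by
    intro m d k hm
    induction k with
    | zero => rfl
    | succ k ih => rw [← add_assoc, hs (d + k) m (by omega), ih]
  -- the limit
  let φ : MvPowerSeries σ R := fun m => coeff m (s m.degree).1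
  have hφs : ∀ d (m : σ →₀ ℕ), m.degree < d + 1 → coeff m φ = coeff m (s d).1 := by
    intro d m hm
    have h1 : coeff m φ = coeff m (s m.degree).1 := rfl
    obtain ⟨k, rfl⟩ := Nat.exists_eq_add_of_le (Nat.lt_succ_iff.mp hm)
    rw [h1, hs' m _ k (by omega)]
  have hφc : constantCoeff φ = 0 := by
    rw [← coeff_zero_eq_constantCoeff_apply, hφs 0 0 (by simp), coeff_zero_eq_constantCoeff_apply]
    exact hφ₀c
  have hdef : defect f φ = 0 := by
    ext m
    have ho : ((m.degree : ℕ) : ℕ∞) ≤ (φ - (s m.degree).1).order := by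
      apply nat_le_order
      intro e he
      rw [map_sub, hφs m.degree e (by omega), sub_self]
    have h1 := coeff_defect_add hf (s m.degree).2.1 (δ := φ - (s m.degree).1)
      (by rw [map_sub, hφc, (s m.degree).2.1, sub_zero]) m ho
    rw [add_sub_cancel, (s m.degree).2.2 m (by omega), map_sub,
      hφs m.degree m (by omega), sub_self, mul_zero, add_zero] at h1
    rw [h1, map_zero]
  have hφ1 : ∀ i, coeff (Finsupp.single i 1) φ = a i := by
    intro i
    have h1 : coeff (Finsupp.single i 1) φ = coeff (Finsupp.single i 1) (s 1).1 :=
      hφs 1 _ (by simp)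
    have h2 : coeff (Finsupp.single i 1) (s 1).1 = coeff (Finsupp.single i 1) (s 0).1 :=
      hs 0 _ (by simp)
    rw [h1, h2]
    exact hφ₀' i
  refine ⟨φ, ⟨hφc, hφ1, sub_eq_zero.mp hdef⟩, ?_⟩
  · intro ψ hψ
    have hψd : defect f ψ = 0 := sub_eq_zero.mpr hψ.subst_eq
    have hall : ∀ d : ℕ, ∀ m : σ →₀ ℕ, m.degree < d → coeff m (ψ - φ) = 0 := by
      intro d
      induction d with
      | zero => intro m hm; omega
      | succ d ih =>
        intro m hm
        rcases Nat.lt_succ_iff_lt_or_eq.mp hm with h | h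
        · exact ih m h
        have h1 := coeff_defect_add hf hφc (δ := ψ - φ)
          (by rw [map_sub, hφc, hψ.constantCoeff_eq, sub_zero]) m
          (nat_le_order fun e he => ih e (h ▸ he))
        rw [add_sub_cancel, hψd, hdef, map_zero, zero_add] at h1
        obtain h2 | h2 | ⟨k, h2⟩ : m.degree = 0 ∨ m.degree = 1 ∨ ∃ k, m.degree = k + 2 := by
          rcases hk : m.degree with _ | _ | k
          · exact Or.inl rfl
          · exact Or.inr (Or.inl rfl)
          · exact Or.inr (Or.inr ⟨k, rfl⟩)
        · rw [(Finsupp.degree_eq_zero_iff m).mp h2, coeff_zero_eq_constantCoeff_apply, map_sub,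
            hφc, hψ.constantCoeff_eq, sub_zero]
        · obtain ⟨i, rfl⟩ := exists_eq_single_of_degree_eq_one h2
          rw [map_sub, hφ1, hψ.coeff_single_eq, sub_self]
        · have h3 : ϖ - ϖ ^ m.degree = ϖ * (1 - ϖ ^ (k + 1)) := by rw [h2]; ring
          have h4 : ϖ - ϖ ^ m.degree ≠ 0 := by
            rw [h3]
            exact mul_ne_zero hϖ.ne_zero (isUnit_one_sub_pow hϖ (Nat.succ_ne_zero k)).ne_zero
          exact (mul_eq_zero.mp h1.symm).resolve_left h4
    rw [← sub_eq_zero]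
    ext m
    rw [hall (m.degree + 1) m (Nat.lt_succ_self _), map_zero]

end Existence

section GroupLaw

variable {R : Type*} [CommRing R] [IsDomain R] {ϖ : R} {f : PowerSeries R}

/-- The unique power series with linear part `∑ aᵢ Xᵢ` commuting with `f`. -/
def equivariantSeries {σ : Type*} [Finite σ] (hϖ : IsUniformizer ϖ) (hf : IsLubinTateSeries ϖ f)
    (a : σ → R) : MvPowerSeries σ R :=
  (existsUnique_isEquivariant hϖ hf a).choose

lemma isEquivariant_equivariantSeries {σ : Type*} [Finite σ] (hϖ : IsUniformizer ϖ)
    (hf : IsLubinTateSeries ϖ f) (a : σ → R) : IsEquivariant f a (equivariantSeries hϖ hf a) :=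
  (existsUnique_isEquivariant hϖ hf a).choose_spec.1

/-- The Lubin-Tate formal group law `L(X, Y)` of `f`: the unique power series
`L ≡ X + Y` modulo degree two with `f (L(X, Y)) = L(f X, f Y)`. -/
def groupLaw (hϖ : IsUniformizer ϖ) (hf : IsLubinTateSeries ϖ f) : MvPowerSeries (Fin 2) R :=
  equivariantSeries hϖ hf (fun _ => 1)

/-- The series `[a](X)`: the unique power series `[a] ≡ a X mod X²` with `f ∘ [a] = [a] ∘ f`. -/
def scalarSeries (hϖ : IsUniformizer ϖ) (hf : IsLubinTateSeries ϖ f) (a : R) : PowerSeries R :=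
  equivariantSeries (σ := Unit) hϖ hf (fun _ => a)

/-- The series `L(⋯ L(L(X_i, [B_{i,i-1}](X_{i-1})), [B_{i,i-2}](X_{i-2})), ⋯, [B_{i,1}](X_1))`
substituted for `X_i` in a unipotent change of variables. Only the entries of `B` below the diagonal
are used. -/
def unipotentSeries {n : ℕ} (hϖ : IsUniformizer ϖ) (hf : IsLubinTateSeries ϖ f)
    (B : Matrix (Fin n) (Fin n) R) (i : Fin n) : MvPowerSeries (Fin n) R :=
  ((List.finRange n).filter (· < i)).foldr
    (fun j φ => (groupLaw hϖ hf).subst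
      ![φ, (scalarSeries hϖ hf (B i j)).subst (X j : MvPowerSeries (Fin n) R)])
    (X i)

lemma constantCoeff_unipotentSeries {n : ℕ} (hϖ : IsUniformizer ϖ) (hf : IsLubinTateSeries ϖ f)
    (B : Matrix (Fin n) (Fin n) R) (i : Fin n) :
    constantCoeff (unipotentSeries hϖ hf B i) = 0 := by
  unfold unipotentSeries
  induction (List.finRange n).filter (· < i) with
  | nil => simp
  | cons j l ih =>
    rw [List.foldr_cons]
    have h : ∀ φ : MvPowerSeries (Fin n) R, constantCoeff φ = 0 → ∀ k, constantCoeff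
        ((![φ, (scalarSeries hϖ hf (B i j)).subst (X j : MvPowerSeries (Fin n) R)] :
          Fin 2 → MvPowerSeries (Fin n) R) k) = 0 := by
      intro φ hφ k
      fin_cases k
      · exact hφ
      · exact PowerSeries.constantCoeff_subst_eq_zero (by simp) _
          (isEquivariant_equivariantSeries hϖ hf _).constantCoeff_eq
    exact constantCoeff_subst_eq_zero (hasSubst_of_constantCoeff_zero (h _ ih)) (h _ ih)
      (isEquivariant_equivariantSeries hϖ hf _).constantCoeff_eq

lemma hasSubst_unipotentSeries {S : Type*} [CommRing S] (ι : R →+* S) {n : ℕ}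
    (hϖ : IsUniformizer ϖ) (hf : IsLubinTateSeries ϖ f) (B : Matrix (Fin n) (Fin n) R) :
    HasSubst (fun i => MvPowerSeries.map ι (unipotentSeries hϖ hf B i)) :=
  hasSubst_of_constantCoeff_zero fun i => by
    rw [constantCoeff_map, constantCoeff_unipotentSeries, map_zero]

lemma hasSubst_swap {S : Type*} [CommRing S] {n : ℕ} (i j : Fin n) :
    HasSubst (fun k => (X (Equiv.swap i j k) : MvPowerSeries (Fin n) S)) :=
  hasSubst_of_constantCoeff_zero fun k => by simp

/-- The multiplicative changes of variables on `S⟦X_1, …, X_n⟧` attached to the Lubin-Tate group over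
`R`, where `S` is an `R`-algebra through `ι`: the substitutions composed of unipotent changes of
variables with coefficients in `R` and of swaps of two variables. -/
inductive IsChangeOfVariables {S : Type*} [CommRing S] (ι : R →+* S) {n : ℕ}
    (hϖ : IsUniformizer ϖ) (hf : IsLubinTateSeries ϖ f) :
    (MvPowerSeries (Fin n) S →+* MvPowerSeries (Fin n) S) → Prop
  | unipotent (B : Matrix (Fin n) (Fin n) R) : IsChangeOfVariables ι hϖ hf
      (substAlgHom (R := S) (hasSubst_unipotentSeries ι hϖ hf B)).toRingHom
  | swap (i j : Fin n) : IsChangeOfVariables ι hϖ hf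
      (substAlgHom (R := S) (hasSubst_swap i j)).toRingHom
  | comp (θ θ' : MvPowerSeries (Fin n) S →+* MvPowerSeries (Fin n) S) :
      IsChangeOfVariables ι hϖ hf θ → IsChangeOfVariables ι hϖ hf θ' →
      IsChangeOfVariables ι hϖ hf (θ.comp θ')

end GroupLaw

section Padic

variable {p : ℕ} [Fact p.Prime]

/-- The ring of integers of a field `K` between `ℚ_p` and its algebraic closure, as the closed unit
ball for the norm extending the `p`-adic norm. -/
def integers (K : IntermediateField ℚ_[p] (PadicAlgCl p)) : Subring (PadicAlgCl p) where
  carrier := {x | x ∈ K ∧ ‖x‖ ≤ 1}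
  mul_mem' := fun {x y} hx hy => ⟨mul_mem hx.1 hy.1, by
    rw [norm_mul]; exact mul_le_one₀ hx.2 (norm_nonneg y) hy.2⟩
  one_mem' := ⟨one_mem K, by rw [norm_one]⟩
  add_mem' := fun {x y} hx hy => ⟨add_mem hx.1 hy.1,
    (PadicAlgCl.isNonarchimedean p x y).trans (max_le hx.2 hy.2)⟩
  zero_mem' := ⟨zero_mem K, by rw [norm_zero]; exact zero_le_one⟩
  neg_mem' := fun {x} hx => ⟨neg_mem hx.1, by rw [norm_neg]; exact hx.2⟩

lemma integers_mono {K K' : IntermediateField ℚ_[p] (PadicAlgCl p)} (h : K ≤ K') :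
    integers K ≤ integers K' :=
  fun _ hx => ⟨h hx.1, hx.2⟩

/-- The torsion points of the Lubin-Tate group over the algebraic closure of `ℚ_p`: the elements `ζ`
of the open unit disc such that `[ϖ ^ k](ζ) = 0` for some `k`. -/
def torsionPoints {E : IntermediateField ℚ_[p] (PadicAlgCl p)} {ϖ : integers E}
    {f : PowerSeries (integers E)} (hϖ : IsUniformizer ϖ) (hf : IsLubinTateSeries ϖ f) :
    Set (PadicAlgCl p) :=
  {ζ | ‖ζ‖ < 1 ∧ ∃ k : ℕ, HasSum
    (fun m : ℕ => ((PowerSeries.coeff m (scalarSeries hϖ hf (ϖ ^ k)) : integers E) :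
      PadicAlgCl p) * ζ ^ m) 0}

/-- The field `F(ζ_i : i ∈ s)`. -/
def adjoinCoordinates (F : IntermediateField ℚ_[p] (PadicAlgCl p)) {n : ℕ} (s : Finset (Fin n))
    (ζ : Fin n → PadicAlgCl p) : IntermediateField ℚ_[p] (PadicAlgCl p) :=
  F ⊔ IntermediateField.adjoin ℚ_[p] (ζ '' s)

/-- The ideal of `𝒪_F⟦X_1, …, X_n⟧` of the intersection of the hyperplanes `X_i = ζ_i`, `i ∈ s`. The
hyperplanes are defined over `K = F(ζ_i : i ∈ s)`, where their intersection is the closed subscheme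
of `Spec 𝒪_K⟦X_1, …, X_n⟧` with ideal `(X_i - ζ_i : i ∈ s)`; the contraction of this ideal to
`𝒪_F⟦X_1, …, X_n⟧` is the ideal of the image. -/
def hyperplaneIdeal (F : IntermediateField ℚ_[p] (PadicAlgCl p)) {n : ℕ} (s : Finset (Fin n))
    (ζ : Fin n → PadicAlgCl p) : Ideal (MvPowerSeries (Fin n) (integers F)) :=
  (Ideal.span {ψ : MvPowerSeries (Fin n) (integers (adjoinCoordinates F s ζ)) |
      ∃ i ∈ s, ∃ h : ζ i ∈ integers (adjoinCoordinates F s ζ), ψ = X i - C ⟨ζ i, h⟩}).comap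
    (MvPowerSeries.map (Subring.inclusion
      (integers_mono (le_sup_left : F ≤ adjoinCoordinates F s ζ))))

/-- The special points of `Spec A`, where `A = 𝒪_F⟦X_1, …, X_n⟧ / I`: the primes corresponding to
the primes `(X_1 - ζ_1, …, X_n - ζ_n)` of `𝒪_F⟦X_1, …, X_n⟧` that contain `I`, where the `ζ_i` are
torsion points of the Lubin-Tate group. -/
def specialPoints {E F : IntermediateField ℚ_[p] (PadicAlgCl p)} {ϖ : integers E}
    {f : PowerSeries (integers E)} (hϖ : IsUniformizer ϖ) (hf : IsLubinTateSeries ϖ f) {n : ℕ}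
    (I : Ideal (MvPowerSeries (Fin n) (integers F))) :
    Set (PrimeSpectrum (MvPowerSeries (Fin n) (integers F) ⧸ I)) :=
  {P | ∃ ζ : Fin n → PadicAlgCl p, (∀ i, ζ i ∈ torsionPoints hϖ hf) ∧
    P.asIdeal.comap (Ideal.Quotient.mk I) = hyperplaneIdeal F Finset.univ ζ}

/-- The closed subscheme of `Spec 𝒪_F⟦X_1, …, X_n⟧` with ideal `J` is special: after a
multiplicative change of variables it is a finite union of intersections of hyperplanes
`X_i = ζ_i`, where the `ζ_i` are torsion points of the Lubin-Tate group. -/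
def IsSpecial {E F : IntermediateField ℚ_[p] (PadicAlgCl p)} (hEF : E ≤ F) {ϖ : integers E}
    {f : PowerSeries (integers E)} (hϖ : IsUniformizer ϖ) (hf : IsLubinTateSeries ϖ f) {n : ℕ}
    (J : Ideal (MvPowerSeries (Fin n) (integers F))) : Prop :=
  ∃ θ : MvPowerSeries (Fin n) (integers F) →+* MvPowerSeries (Fin n) (integers F),
    IsChangeOfVariables (Subring.inclusion (integers_mono hEF)) hϖ hf θ ∧
    ∃ H : Finset (Finset (Fin n) × (Fin n → PadicAlgCl p)),
      (∀ h ∈ H, ∀ i ∈ h.1, h.2 i ∈ torsionPoints hϖ hf) ∧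
      J.map θ = ⨅ h ∈ H, hyperplaneIdeal F h.1 h.2

end Padic

end LubinTate

end

/-! Write q for the residue cardinality of E. The points killed by ϖ^(k+1) form a cyclic 𝒪_E-module
(`exists_eq_scale`), so any tuple of torsion points is ([a_1](ω), …, [a_n](ω)) with ω of exact order
ϖ^(k+1). It is the point t = ω of the curve t ↦ ([a_i](t)).

The heart is `exists_finite_forall_lin_eq`: the torsion zeros of one non-zero series φ lie on
finitely many translates ∑ [b_i](z_i) = τ, with b primitive and τ torsion. Remove the content of φ,
so that its reduction modulo the maximal ideal is non-zero. Two estimates then meet. Points of high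
order are near the boundary of the disc, |ϖ| ≤ |ω|^(q^k) (`norm_le_norm_pow_of_scale_ne_zero`), so a
zero at ω forces the reduction of φ to vanish along the curve to an order at least a constant times
q^k (`exists_forall_card_pow_lt`). On the other hand [ϖ] reduces to t^q. By noetherianity,
compactness of the primitive vectors and induction on n, vanishing to such an order is possible only
if ϖ^l ∑ b_i a_i is divisible by ϖ^(k+1) for one of finitely many primitive b, with l independent of
the point (`exists_finset_forall_dvd`). Then ∑ [b_i](z_i) is killed by ϖ^l, which leaves finitely
many values.

A change of variables moves b to the first axis, the equation becomes X_1 = τ', and induction on n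
describes the torsion zeros of any ideal as a finite union of images of sets with prescribed torsion
coordinates (`isSpecialLocus_zeros`). The same estimates show that torsion points are dense
(`eq_zero_of_forall_evalAt_eq_zero`). Combined with division by X_i - τ_i, this identifies each
hyperplane ideal with the prime ideal of series vanishing at the torsion points of the intersection.
Finitely many such primes, pulled back by changes of variables, are the only possible generic points
of components. -/

noncomputable section
namespace LubinTate
open MvPowerSeries

/-! ### Linear parts of composite power series. -/

section LinearForms

variable {R : Type*} [CommRing R]

/-- A product of d.degree series without constant term has order at least d.degree, so only
monomials of degree one contribute to linear parts. -/
lemma coeff_single_finsuppProd {σ τ : Type*} {B : σ → MvPowerSeries τ R}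
    (hB : ∀ i, constantCoeff (B i) = 0) (d : σ →₀ ℕ) (hd : d.degree ≠ 1) (j : τ) :
    coeff (Finsupp.single j 1) (d.prod fun s e => (B s) ^ e) = 0 := by
  classical
  rcases Nat.lt_or_gt_of_ne hd with h | h
  · have : d = 0 := (Finsupp.degree_eq_zero_iff d).mp (by omega)
    subst this
    rw [Finsupp.prod_zero_index, coeff_one, if_neg]
    simp
  · apply coeff_of_lt_order
    have h1 : ((d.degree : ℕ) : ℕ∞) ≤ (d.prod fun s e => (B s) ^ e).order := by
      refine le_trans ?_ (le_order_prod _ _)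
      rw [Finsupp.degree_apply, Nat.cast_sum]
      refine Finset.sum_le_sum fun i _ => ?_
      exact le_order_pow_of_constantCoeff_eq_zero _ (hB i)
    refine lt_of_lt_of_le ?_ h1
    rw [Finsupp.degree_single]
    exact_mod_cast h

/-- The chain rule at the origin. -/
lemma coeff_single_subst {σ τ : Type*} [Fintype σ] (φ : MvPowerSeries σ R)
    {B : σ → MvPowerSeries τ R} (hB : ∀ i, constantCoeff (B i) = 0) (j : τ) :
    coeff (Finsupp.single j 1) (φ.subst B) =
      ∑ i, coeff (Finsupp.single i 1) φ * coeff (Finsupp.single j 1) (B i) := by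
  classical
  rw [coeff_subst (hasSubst_of_constantCoeff_zero hB)]
  have hinj : Function.Injective fun i : σ => Finsupp.single i (1 : ℕ) :=
    Finsupp.single_left_injective one_ne_zero
  rw [finsum_eq_finsetSum_of_support_subset (s := Finset.univ.image
    fun i : σ => Finsupp.single i (1 : ℕ)), Finset.sum_image hinj.injOn]
  · simp
  · intro d hd
    by_contra hne
    apply hd
    have : d.degree ≠ 1 := by
      intro h
      obtain ⟨i, rfl⟩ := exists_eq_single_of_degree_eq_one h
      exact hne (by simp)
    simp only [coeff_single_finsuppProd hB d this j, smul_zero]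

end LinearForms

/-! ### The formal module: identities obtained from uniqueness. -/

section Composition

variable {R : Type*} [CommRing R] [IsDomain R] {ϖ : R} {f : PowerSeries R}
  (hϖ : IsUniformizer ϖ) (hf : IsLubinTateSeries ϖ f)

/-- The method for every identity below: compare linear parts, check commutation with f, and use
uniqueness. -/
lemma IsEquivariant.eq_equivariantSeries {σ : Type*} [Finite σ] {a : σ → R}
    {φ : MvPowerSeries σ R} (h : IsEquivariant f a φ) : φ = equivariantSeries hϖ hf a :=
  (existsUnique_isEquivariant hϖ hf a).unique h (isEquivariant_equivariantSeries hϖ hf a)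

lemma constantCoeff_equivariantSeries {σ : Type*} [Finite σ] (a : σ → R) :
    constantCoeff (equivariantSeries hϖ hf a) = 0 :=
  (isEquivariant_equivariantSeries hϖ hf a).constantCoeff_eq

lemma hasSubst_equivariantSeries {σ τ : Type*} [Finite σ] [Finite τ] (B : σ → τ → R) :
    HasSubst fun i => equivariantSeries hϖ hf (B i) :=
  hasSubst_of_constantCoeff_zero fun i => constantCoeff_equivariantSeries hϖ hf (B i)

/-- Linear forms in the formal group compose like linear forms. -/
theorem equivariantSeries_subst {σ τ : Type*} [Fintype σ] [Finite τ] (a : σ → R)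
    (B : σ → τ → R) :
    (equivariantSeries hϖ hf a).subst (fun i => equivariantSeries hϖ hf (B i)) =
      equivariantSeries hϖ hf fun j => ∑ i, a i * B i j := by
  have hB := hasSubst_equivariantSeries hϖ hf B
  have ha := isEquivariant_equivariantSeries hϖ hf a
  have hBi := fun i => isEquivariant_equivariantSeries hϖ hf (B i)
  apply IsEquivariant.eq_equivariantSeries
  refine ⟨constantCoeff_subst_eq_zero hB (fun i => (hBi i).constantCoeff_eq) ha.constantCoeff_eq,
    fun j => ?_, ?_⟩
  · rw [coeff_single_subst _ (fun i => (hBi i).constantCoeff_eq)]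
    simp only [ha.coeff_single_eq, (hBi _).coeff_single_eq]
  -- f is moved past the outer series, then past each of the inner ones.
  · have h1 : PowerSeries.HasSubst (equivariantSeries hϖ hf a) :=
      .of_constantCoeff_zero ha.constantCoeff_eq
    rw [PowerSeries.subst, ← subst_comp_subst_apply h1.const hB, ← PowerSeries.subst,
      ha.subst_eq, subst_comp_subst_apply (hasSubst_subst_X hf) hB,
      subst_comp_subst_apply hB (hasSubst_subst_X hf)]
    congr 1
    funext i
    rw [← (hBi i).subst_eq, PowerSeries.subst, PowerSeries.subst,
      subst_comp_subst_apply (PowerSeries.HasSubst.X i).const hB]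
    congr 1
    funext _
    rw [subst_X hB]

lemma equivariantSeries_single {σ : Type*} [Finite σ] [DecidableEq σ] (i : σ) :
    equivariantSeries hϖ hf (Pi.single i 1) = X i := by
  symm
  apply IsEquivariant.eq_equivariantSeries
  refine ⟨by simp, fun j => ?_, ?_⟩
  · rw [coeff_X, Pi.single_apply]
    congr 1
    rw [eq_iff_iff, (Finsupp.single_left_injective one_ne_zero).eq_iff]
  · rw [subst_X (hasSubst_subst_X hf)]

lemma equivariantSeries_zero {σ : Type*} [Finite σ] :
    equivariantSeries hϖ hf (0 : σ → R) = 0 := by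
  symm
  apply IsEquivariant.eq_equivariantSeries
  refine ⟨by simp, fun j => by simp, ?_⟩
  rw [PowerSeries.subst_zero_of_constantCoeff_zero hf.constantCoeff_eq,
    ← coe_substAlgHom (hasSubst_subst_X hf), map_zero]

lemma scalarSeries_subst {σ : Type*} [Finite σ] (a : R) (b : σ → R) :
    (scalarSeries hϖ hf a).subst (equivariantSeries hϖ hf b) =
      equivariantSeries hϖ hf (a • b) := by
  rw [scalarSeries, PowerSeries.subst, equivariantSeries_subst hϖ hf (fun _ : Unit => a) fun _ => b]
  congr 1
  funext j
  simp

lemma groupLaw_subst {σ : Type*} [Finite σ] (a b : σ → R) :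
    (groupLaw hϖ hf).subst ![equivariantSeries hϖ hf a, equivariantSeries hϖ hf b] =
      equivariantSeries hϖ hf (a + b) := by
  have : (![equivariantSeries hϖ hf a, equivariantSeries hϖ hf b] :
      Fin 2 → MvPowerSeries σ R) = fun i => equivariantSeries hϖ hf ((![a, b] : Fin 2 → σ → R) i) := by
    funext i
    fin_cases i <;> rfl
  rw [groupLaw, this, equivariantSeries_subst]
  congr 1
  funext j
  simp

/-- f commutes with itself and has linear coefficient ϖ. -/
lemma scalarSeries_uniformizer : scalarSeries hϖ hf ϖ = f := by
  symm
  apply IsEquivariant.eq_equivariantSeries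
  refine ⟨hf.constantCoeff_eq, fun i => hf.coeff_one_eq, ?_⟩
  have h1 : (fun i : Unit => f.subst (X i : MvPowerSeries Unit R)) = fun _ => f := by
    funext i
    exact PowerSeries.X_subst f
  rw [h1]
  rfl

end Composition

/-! ### Changes of variables as matrices over the base ring. -/

section ChangeOfVariables

variable {R : Type*} [CommRing R]

/-- The lower triangular unipotent matrix with the entries of `B` below the diagonal. -/
def unipotentMatrix {n : ℕ} (B : Matrix (Fin n) (Fin n) R) : Matrix (Fin n) (Fin n) R :=
  fun i => Pi.single i 1 + (((List.finRange n).filter (· < i)).map fun j =>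
    (Pi.single j (B i j) : Fin n → R)).sum

lemma unipotentMatrix_apply {n : ℕ} (B : Matrix (Fin n) (Fin n) R) (i j : Fin n) :
    unipotentMatrix B i j = if j < i then B i j else if j = i then 1 else 0 := by
  have h1 : ((((List.finRange n).filter (· < i)).map fun j =>
      (Pi.single j (B i j) : Fin n → R)).sum) =
      ∑ k ∈ Finset.univ.filter (· < i), (Pi.single k (B i k) : Fin n → R) := by
    rw [← List.sum_toFinset _ ((List.nodup_finRange n).filter _)]
    congr 1
    ext k
    simp
  rw [unipotentMatrix, h1, Pi.add_apply, Finset.sum_apply, Pi.single_apply]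
  simp only [Pi.single_apply, Finset.sum_ite_eq, Finset.mem_filter, Finset.mem_univ, true_and]
  by_cases h : j < i
  · simp [h, h.ne]
  · simp [h]

/-- The permutation matrix of a swap. -/
def swapMatrix {n : ℕ} (R : Type*) [CommRing R] (i j : Fin n) : Matrix (Fin n) (Fin n) R :=
  fun k => Pi.single (Equiv.swap i j k) 1

/-- The matrices of the multiplicative changes of variables. -/
def changeMatrices (R : Type*) [CommRing R] (n : ℕ) : Submonoid (Matrix (Fin n) (Fin n) R) :=
  Submonoid.closure (Set.range unipotentMatrix ∪ Set.range fun x : Fin n × Fin n =>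
    swapMatrix R x.1 x.2)

lemma unipotentMatrix_mem {n : ℕ} (B : Matrix (Fin n) (Fin n) R) :
    unipotentMatrix B ∈ changeMatrices R n :=
  Submonoid.subset_closure (Or.inl ⟨B, rfl⟩)

lemma swapMatrix_mem {n : ℕ} (i j : Fin n) : swapMatrix R i j ∈ changeMatrices R n :=
  Submonoid.subset_closure (Or.inr ⟨(i, j), rfl⟩)

/-- Supplies the identity change of variables, which is not a constructor of `IsChangeOfVariables`.
-/
lemma unipotentMatrix_zero {n : ℕ} : unipotentMatrix (0 : Matrix (Fin n) (Fin n) R) = 1 := by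
  ext i j
  rw [unipotentMatrix_apply, Matrix.one_apply]
  by_cases h : j < i
  · simp [h, h.ne']
  · simp [h, eq_comm]

lemma swapMatrix_mul_self {n : ℕ} (i j : Fin n) : swapMatrix R i j * swapMatrix R i j = 1 := by
  ext k l
  rw [Matrix.mul_apply, Matrix.one_apply]
  simp only [swapMatrix, Pi.single_apply, ite_mul, one_mul, zero_mul, Finset.sum_ite_eq',
    Finset.mem_univ, if_true, Equiv.swap_apply_self]
  simp only [eq_comm]

lemma isUnit_of_mem_changeMatrices {n : ℕ} {g : Matrix (Fin n) (Fin n) R}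
    (hg : g ∈ changeMatrices R n) : IsUnit g := by
  induction hg using Submonoid.closure_induction with
  | mem x hx =>
    rcases hx with ⟨B, rfl⟩ | ⟨⟨i, j⟩, rfl⟩
    · rw [Matrix.isUnit_iff_isUnit_det, Matrix.det_of_isLowerTriangular]
      · simp [unipotentMatrix_apply]
      · intro i j hij
        have : i < j := hij
        rw [unipotentMatrix_apply, if_neg this.le.not_gt, if_neg this.ne']
    · exact IsUnit.of_mul_eq_one _ (swapMatrix_mul_self i j)
  | one => exact isUnit_one
  | mul x y _ _ hx hy => exact hx.mul hy

/-- The block diagonal matrix with blocks `1` and `g`. -/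
def consMatrix {n : ℕ} (g : Matrix (Fin n) (Fin n) R) : Matrix (Fin (n + 1)) (Fin (n + 1)) R :=
  Fin.cons (Pi.single 0 1) fun i => Fin.cons 0 (g i)

@[simp] lemma consMatrix_zero_zero {n : ℕ} (g : Matrix (Fin n) (Fin n) R) :
    consMatrix g 0 0 = 1 := by simp [consMatrix]

@[simp] lemma consMatrix_zero_succ {n : ℕ} (g : Matrix (Fin n) (Fin n) R) (j : Fin n) :
    consMatrix g 0 j.succ = 0 := by simp [consMatrix]

@[simp] lemma consMatrix_succ_zero {n : ℕ} (g : Matrix (Fin n) (Fin n) R) (i : Fin n) :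
    consMatrix g i.succ 0 = 0 := by simp [consMatrix]

@[simp] lemma consMatrix_succ_succ {n : ℕ} (g : Matrix (Fin n) (Fin n) R) (i j : Fin n) :
    consMatrix g i.succ j.succ = g i j := by simp [consMatrix]

lemma consMatrix_mul {n : ℕ} (g h : Matrix (Fin n) (Fin n) R) :
    consMatrix (g * h) = consMatrix g * consMatrix h := by
  ext i j
  rw [Matrix.mul_apply, Fin.sum_univ_succ]
  refine Fin.cases ?_ (fun i => ?_) i <;> refine Fin.cases ?_ (fun j => ?_) j <;>
    simp [Matrix.mul_apply]

lemma consMatrix_mem {n : ℕ} {g : Matrix (Fin n) (Fin n) R} (hg : g ∈ changeMatrices R n) :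
    consMatrix g ∈ changeMatrices R (n + 1) := by
  induction hg using Submonoid.closure_induction with
  | mem x hx =>
    rcases hx with ⟨B, rfl⟩ | ⟨⟨a, b⟩, rfl⟩
    · convert unipotentMatrix_mem (consMatrix B) using 1
      ext i j
      refine Fin.cases ?_ (fun i => ?_) i <;> refine Fin.cases ?_ (fun j => ?_) j <;>
        simp [unipotentMatrix_apply]
    · convert swapMatrix_mem a.succ b.succ using 1
      ext i j
      refine Fin.cases ?_ (fun i => ?_) i
      · rw [swapMatrix, Equiv.swap_apply_of_ne_of_ne (Fin.succ_ne_zero a).symm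
          (Fin.succ_ne_zero b).symm]
        refine Fin.cases ?_ (fun j => ?_) j <;> simp
      · have : Equiv.swap a.succ b.succ i.succ = (Equiv.swap a b i).succ := by
          simp only [Equiv.swap_apply_def, Fin.succ_inj]
          split_ifs <;> rfl
        rw [swapMatrix, this]
        refine Fin.cases ?_ (fun j => ?_) j <;> simp [swapMatrix, Pi.single_apply]
  | one =>
    convert (changeMatrices R (n + 1)).one_mem using 1
    ext i j
    refine Fin.cases ?_ (fun i => ?_) i <;> refine Fin.cases ?_ (fun j => ?_) j <;>
      simp [Matrix.one_apply, (Fin.succ_ne_zero _).symm]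
  | mul x y _ _ hx hy => rw [consMatrix_mul]; exact mul_mem hx hy

/-- A row vector with an invertible entry is a multiple of the first unit vector after a change of
variables. -/
lemma exists_changeMatrices_vecMul {n : ℕ} {b : Fin (n + 1) → R} {i : Fin (n + 1)}
    (hi : IsUnit (b i)) : ∃ g ∈ changeMatrices R (n + 1),
      Matrix.vecMul b g = Pi.single 0 (b i) := by
  -- The unit entry is swapped to the last place, where the last row of a unipotent matrix can clear
  -- all the other entries, and is then swapped to the front.
  obtain ⟨u, hu⟩ := hi
  let c : Fin (n + 1) → R := fun j => b (Equiv.swap i (Fin.last n) j)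
  have hc : Matrix.vecMul b (swapMatrix R i (Fin.last n)) = c := by
    funext j
    simp only [Matrix.vecMul, dotProduct, swapMatrix, Pi.single_apply, mul_ite, mul_one, mul_zero]
    rw [Finset.sum_eq_single (Equiv.swap i (Fin.last n) j)]
    · simp [c]
    · intro k _ hk
      rw [if_neg]
      rintro rfl
      simp at hk
    · simp
  have hcl : c (Fin.last n) = b i := by simp [c]
  let B : Matrix (Fin (n + 1)) (Fin (n + 1)) R := fun k j =>
    if k = Fin.last n then -(↑u⁻¹ * c j) else 0
  have hB : Matrix.vecMul c (unipotentMatrix B) = Pi.single (Fin.last n) (b i) := by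
    funext j
    simp only [Matrix.vecMul, dotProduct, unipotentMatrix_apply, Pi.single_apply]
    by_cases hj : j = Fin.last n
    · subst hj
      rw [Finset.sum_eq_single (Fin.last n)]
      · simp [hcl]
      · intro k _ hk
        rw [if_neg (Fin.le_last k).not_gt, if_neg (Ne.symm hk), mul_zero]
      · simp
    · rw [if_neg hj, Finset.sum_eq_add j (Fin.last n) hj]
      · simp only [lt_irrefl, if_false, if_true, mul_one, B, Fin.lt_last_iff_ne_last]
        rw [if_pos hj, hcl, ← hu]
        simp
      · intro k _ hk
        simp only [B, if_neg hk.2, if_neg hk.1.symm]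
        simp
      · simp
      · simp
  refine ⟨swapMatrix R i (Fin.last n) * unipotentMatrix B * swapMatrix R 0 (Fin.last n),
    mul_mem (mul_mem (swapMatrix_mem _ _) (unipotentMatrix_mem _)) (swapMatrix_mem _ _), ?_⟩
  rw [← Matrix.vecMul_vecMul, ← Matrix.vecMul_vecMul, hc, hB]
  funext j
  rw [Matrix.single_vecMul, Pi.smul_apply, Matrix.row_apply, swapMatrix,
    Equiv.swap_apply_right, Pi.single_apply, Pi.single_apply]
  simp

variable [IsDomain R] {ϖ : R} {f : PowerSeries R}
  (hϖ : IsUniformizer ϖ) (hf : IsLubinTateSeries ϖ f)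

/-- Each application of L adds one multiple of a unit vector to the linear part, so the nested
series is a single linear form of the formal group. -/
lemma unipotentSeries_eq {n : ℕ} (B : Matrix (Fin n) (Fin n) R) (i : Fin n) :
    unipotentSeries hϖ hf B i = equivariantSeries hϖ hf ((unipotentMatrix B).row i) := by
  rw [unipotentSeries, Matrix.row, unipotentMatrix]
  induction (List.finRange n).filter (· < i) with
  | nil => simp [equivariantSeries_single]
  | cons j l ih =>
    rw [List.foldr_cons, ih, ← equivariantSeries_single hϖ hf j, scalarSeries_subst,
      groupLaw_subst, List.map_cons, List.sum_cons]
    congr 1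
    rw [← Pi.single_smul, smul_eq_mul, mul_one]
    abel

variable {S : Type*} [CommRing S] (ι : R →+* S)

lemma hasSubst_map_equivariantSeries {σ τ : Type*} [Finite σ] [Finite τ] (B : σ → τ → R) :
    HasSubst fun i => MvPowerSeries.map ι (equivariantSeries hϖ hf (B i)) :=
  (hasSubst_equivariantSeries hϖ hf B).map ι

/-- The substitution of the linear forms with coefficients the rows of `g`. -/
def linearSubst {σ τ : Type*} [Finite σ] [Finite τ] (g : Matrix σ τ R) :
    MvPowerSeries σ S →ₐ[S] MvPowerSeries τ S :=
  substAlgHom (hasSubst_map_equivariantSeries hϖ hf ι g.row)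

lemma linearSubst_apply {σ τ : Type*} [Finite σ] [Finite τ] (g : Matrix σ τ R)
    (φ : MvPowerSeries σ S) : linearSubst hϖ hf ι g φ =
      φ.subst fun i => MvPowerSeries.map ι (equivariantSeries hϖ hf (g.row i)) :=
  substAlgHom_apply _ _

lemma linearSubst_linearSubst {σ τ υ : Type*} [Fintype σ] [Fintype τ] [Fintype υ]
    (g : Matrix σ τ R) (h : Matrix τ υ R) (φ : MvPowerSeries σ S) :
    linearSubst hϖ hf ι h (linearSubst hϖ hf ι g φ) = linearSubst hϖ hf ι (g * h) φ := by
  simp only [linearSubst_apply]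
  rw [subst_comp_subst_apply (hasSubst_map_equivariantSeries hϖ hf ι g.row)
    (hasSubst_map_equivariantSeries hϖ hf ι h.row)]
  congr 1
  funext i
  rw [← map_subst (hasSubst_equivariantSeries hϖ hf h.row), equivariantSeries_subst]
  rfl

lemma linearSubst_one {σ : Type*} [Fintype σ] [DecidableEq σ] (φ : MvPowerSeries σ S) :
    linearSubst hϖ hf ι (1 : Matrix σ σ R) φ = φ := by
  rw [linearSubst_apply]
  have : (fun i => MvPowerSeries.map ι (equivariantSeries hϖ hf ((1 : Matrix σ σ R).row i))) =
      (X : σ → MvPowerSeries σ S) := by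
    funext i
    have h1 : (1 : Matrix σ σ R).row i = Pi.single i 1 := by
      funext j
      rw [Matrix.row_apply, Matrix.one_apply, Pi.single_apply]
      simp [eq_comm]
    rw [h1, equivariantSeries_single, map_X]
  rw [this, subst_self]
  rfl

lemma isChangeOfVariables_linearSubst {n : ℕ} {g : Matrix (Fin n) (Fin n) R}
    (hg : g ∈ changeMatrices R n) :
    IsChangeOfVariables ι hϖ hf (linearSubst hϖ hf ι g).toRingHom := by
  have hu : ∀ B : Matrix (Fin n) (Fin n) R, IsChangeOfVariables ι hϖ hf
      (linearSubst hϖ hf ι (unipotentMatrix B)).toRingHom := by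
    intro B
    convert IsChangeOfVariables.unipotent (ι := ι) (hϖ := hϖ) (hf := hf) B using 1
    ext1 φ
    simp only [AlgHom.toRingHom_eq_coe, RingHom.coe_coe, linearSubst_apply, substAlgHom_apply,
      unipotentSeries_eq]
  induction hg using Submonoid.closure_induction with
  | mem x hx =>
    rcases hx with ⟨B, rfl⟩ | ⟨⟨i, j⟩, rfl⟩
    · exact hu B
    · convert IsChangeOfVariables.swap (ι := ι) (hϖ := hϖ) (hf := hf) i j using 1
      ext1 φ
      have h : ∀ k, (swapMatrix R i j).row k = Pi.single (Equiv.swap i j k) 1 := fun _ => rfl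
      simp only [AlgHom.toRingHom_eq_coe, RingHom.coe_coe, linearSubst_apply, substAlgHom_apply,
        h, equivariantSeries_single, map_X]
  | one => rw [← unipotentMatrix_zero]; exact hu 0
  -- Substitution reverses products of matrices.
  | mul x y _ _ hx hy =>
    convert IsChangeOfVariables.comp _ _ hy hx using 1
    ext1 φ
    exact (linearSubst_linearSubst hϖ hf ι x y φ).symm

lemma linearSubst_surjective {n : ℕ} {g : Matrix (Fin n) (Fin n) R} (hg : IsUnit g) :
    Function.Surjective (linearSubst hϖ hf ι g) := by
  obtain ⟨u, rfl⟩ := hg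
  intro φ
  refine ⟨linearSubst hϖ hf ι (↑u⁻¹ : Matrix (Fin n) (Fin n) R) φ, ?_⟩
  rw [linearSubst_linearSubst, Units.inv_mul, linearSubst_one]

end ChangeOfVariables

/-! ### Restriction of power series to one-parameter curves. -/

section Along

variable {R : Type*} [CommRing R] [IsDomain R] {ϖ : R} {f : PowerSeries R}
  (hϖ : IsUniformizer ϖ) (hf : IsLubinTateSeries ϖ f)
  {S : Type*} [CommRing S] (ι : R →+* S)

/-- The restriction of `φ` to the curve `t ↦ ([a_i](t))_i`. -/
def along {σ : Type*} [Finite σ] (a : σ → R) : MvPowerSeries σ S →ₐ[S] PowerSeries S :=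
  linearSubst hϖ hf ι (Matrix.of fun i (_ : Unit) => a i)

lemma along_apply {σ : Type*} [Finite σ] (a : σ → R) (φ : MvPowerSeries σ S) :
    along hϖ hf ι a φ =
      φ.subst fun i => PowerSeries.map ι (scalarSeries hϖ hf (a i)) :=
  linearSubst_apply _ _ _ _ _

lemma along_linearSubst {σ τ : Type*} [Fintype σ] [Fintype τ] (g : Matrix σ τ R) (a : τ → R)
    (φ : MvPowerSeries σ S) :
    along hϖ hf ι a (linearSubst hϖ hf ι g φ) = along hϖ hf ι (g.mulVec a) φ := by
  rw [along, linearSubst_linearSubst]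
  rfl

/-- Scaling the direction by c reparametrises the curve by t ↦ [c](t), because [a_i] ∘ [c] = [a_i
c]. -/
lemma along_smul {σ : Type*} [Fintype σ] (c : R) (a : σ → R) (φ : MvPowerSeries σ S) :
    along hϖ hf ι (c • a) φ =
      (along hϖ hf ι a φ).subst (PowerSeries.map ι (scalarSeries hϖ hf c)) := by
  have h := linearSubst_linearSubst hϖ hf ι (Matrix.of fun i (_ : Unit) => a i)
    (Matrix.of fun (_ : Unit) (_ : Unit) => c) φ
  have h2 : (Matrix.of fun i (_ : Unit) => a i) * (Matrix.of fun (_ : Unit) (_ : Unit) => c) =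
      Matrix.of fun i (_ : Unit) => (c • a) i := by
    ext i j
    simp [Matrix.mul_apply, mul_comm]
  rw [h2] at h
  rw [along, ← h, linearSubst_apply]
  rfl

lemma scalarSeries_one : scalarSeries hϖ hf 1 = PowerSeries.X := by
  rw [scalarSeries, PowerSeries.X, ← equivariantSeries_single hϖ hf]
  congr 1

lemma constantCoeff_scalarSeries (c : R) :
    PowerSeries.constantCoeff (scalarSeries hϖ hf c) = 0 :=
  constantCoeff_equivariantSeries hϖ hf _

lemma scalarSeries_mul (a b : R) : scalarSeries hϖ hf (a * b) =
    (scalarSeries hϖ hf a).subst (scalarSeries hϖ hf b) := by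
  rw [scalarSeries.eq_1 hϖ hf b, scalarSeries_subst]
  rfl

omit [IsDomain R] in
lemma one_lt_card (hϖ : IsUniformizer ϖ) (hf : IsLubinTateSeries ϖ f) :
    1 < Nat.card (R ⧸ Ideal.span {ϖ}) := by
  have hne : Ideal.span {ϖ} ≠ ⊤ := by
    rw [Ne, Ideal.span_singleton_eq_top, hϖ.isUnit_iff]
    simp
  have : Nontrivial (R ⧸ Ideal.span {ϖ}) := Ideal.Quotient.nontrivial_iff.mpr hne
  have hq : Nat.card (R ⧸ Ideal.span {ϖ}) ≠ 0 := by
    intro h0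
    have h1 := congrArg (PowerSeries.coeff 0) hf.map_eq
    rw [h0, PowerSeries.coeff_map, PowerSeries.coeff_zero_eq_constantCoeff_apply,
      hf.constantCoeff_eq] at h1
    simp at h1
  have : Finite (R ⧸ Ideal.span {ϖ}) := Nat.finite_of_card_ne_zero hq
  exact Finite.one_lt_card

variable {ι}

omit [IsDomain R] in
lemma map_lubinTateSeries (hf : IsLubinTateSeries ϖ f) (hι : ι ϖ = 0) :
    PowerSeries.map ι f = PowerSeries.X ^ Nat.card (R ⧸ Ideal.span {ϖ}) := by
  have h : ∀ x ∈ Ideal.span {ϖ}, ι x = 0 := by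
    intro x hx
    obtain ⟨y, rfl⟩ := Ideal.mem_span_singleton.mp hx
    rw [map_mul, hι, zero_mul]
  have h1 := congrArg (PowerSeries.map (Ideal.Quotient.lift _ ι h)) hf.map_eq
  rw [map_pow, PowerSeries.map_X] at h1
  rw [← h1]
  ext m
  simp only [PowerSeries.coeff_map, Ideal.Quotient.lift_mk]

/-- Where ϖ becomes zero, [ϖ] = f becomes X^q. The counting of orders of vanishing rests on this. -/
lemma map_scalarSeries_pow (hι : ι ϖ = 0) (N : ℕ) :
    PowerSeries.map ι (scalarSeries hϖ hf (ϖ ^ N)) =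
      PowerSeries.X ^ (Nat.card (R ⧸ Ideal.span {ϖ}) ^ N) := by
  induction N with
  | zero => rw [pow_zero, pow_zero, pow_one, scalarSeries_one, PowerSeries.map_X]
  | succ N ih =>
    have h1 : PowerSeries.HasSubst (scalarSeries hϖ hf ϖ) :=
      .of_constantCoeff_zero' (constantCoeff_scalarSeries hϖ hf ϖ)
    rw [pow_succ, scalarSeries_mul]
    refine (PowerSeries.map_subst h1 _).trans ?_
    rw [ih, scalarSeries_uniformizer]
    have h2 : PowerSeries.HasSubst (PowerSeries.map ι f) :=
      .of_constantCoeff_zero' (by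
        rw [← PowerSeries.coeff_zero_eq_constantCoeff_apply, PowerSeries.coeff_map,
          PowerSeries.coeff_zero_eq_constantCoeff_apply, hf.constantCoeff_eq, map_zero])
    refine (PowerSeries.subst_pow h2 _ _).trans ?_
    rw [PowerSeries.subst_X h2, map_lubinTateSeries hf hι, ← pow_mul, pow_succ', pow_mul]

lemma along_pow_smul {σ : Type*} [Fintype σ] (hι : ι ϖ = 0) (N : ℕ) (a : σ → R)
    (φ : MvPowerSeries σ S) : along hϖ hf ι (ϖ ^ N • a) φ = (along hϖ hf ι a φ).subst
      (PowerSeries.X ^ (Nat.card (R ⧸ Ideal.span {ϖ}) ^ N) : PowerSeries S) := by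
  rw [along_smul, map_scalarSeries_pow hϖ hf hι]

lemma X_pow_dvd_along_smul {σ : Type*} [Fintype σ] (c : R) (a : σ → R) {φ : MvPowerSeries σ S}
    {m : ℕ} (h : PowerSeries.X ^ m ∣ along hϖ hf ι a φ) :
    PowerSeries.X ^ m ∣ along hϖ hf ι (c • a) φ := by
  obtain ⟨ψ, hψ⟩ := h
  have h0 : PowerSeries.constantCoeff (PowerSeries.map ι (scalarSeries hϖ hf c)) = 0 := by
    rw [← PowerSeries.coeff_zero_eq_constantCoeff_apply, PowerSeries.coeff_map,
      PowerSeries.coeff_zero_eq_constantCoeff_apply, constantCoeff_scalarSeries, map_zero]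
  have h2 : PowerSeries.HasSubst (PowerSeries.map ι (scalarSeries hϖ hf c)) :=
    .of_constantCoeff_zero' h0
  rw [along_smul, hψ]
  refine Dvd.dvd.trans ?_ (dvd_of_eq (PowerSeries.subst_mul h2 _ _).symm)
  refine Dvd.dvd.trans ?_ (dvd_mul_right _ _)
  refine Dvd.dvd.trans ?_ (dvd_of_eq (PowerSeries.subst_pow h2 _ _).symm)
  rw [PowerSeries.subst_X h2]
  exact pow_dvd_pow_of_dvd (PowerSeries.X_dvd_iff.mpr h0) m

lemma rename_succ_eq {n : ℕ} (c : MvPowerSeries (Fin n) S) :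
    finSuccEquiv S n (rename Fin.succ c) = PowerSeries.C c := by
  ext k x
  rw [coeff_coeff_finSuccEquiv, PowerSeries.coeff_C]
  split_ifs with hk
  · subst hk
    have h1 : Finsupp.cons 0 x = Finsupp.embDomain (Fin.succEmb n) x := by
      ext i
      refine Fin.cases ?_ (fun i => ?_) i
      · rw [Finsupp.cons_zero, Finsupp.embDomain_of_notMem_range]
        simp
      · rw [Finsupp.cons_succ]
        exact (Finsupp.embDomain_apply_self (Fin.succEmb n) x i).symm
    rw [h1]
    exact coeff_embDomain_rename (Fin.succEmb n) c x
  · rw [map_zero]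
    apply coeff_rename_eq_zero
    rintro ⟨y, hy⟩
    have := DFunLike.congr_fun hy 0
    rw [Finsupp.cons_zero, Finsupp.mapDomain_of_notMem_range] at this
    · exact hk this.symm
    · simp

lemma along_rename_succ {n : ℕ} (a : Fin (n + 1) → R) (c : MvPowerSeries (Fin n) S) :
    along hϖ hf ι a (rename Fin.succ c) = along hϖ hf ι (Fin.tail a) c := by
  rw [along_apply, along_apply, rename_eq_subst]
  have h2 := hasSubst_map_equivariantSeries hϖ hf ι fun i (_ : Unit) => a i
  refine (subst_comp_subst_apply (HasSubst.X_comp Fin.succ) h2 c).trans ?_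
  congr 1
  funext i
  exact subst_X h2 _

/-- The coefficients of the restriction of `φ` to a curve whose first coordinate is `t`. -/
lemma coeff_along_cons (hι : ι ϖ = 0) {n : ℕ} (φ : MvPowerSeries (Fin (n + 1)) S) (b : Fin n → R)
    (N e : ℕ) : PowerSeries.coeff e (along hϖ hf ι (Fin.cons 1 (ϖ ^ N • b)) φ) =
      ∑ i ∈ Finset.range (e + 1), if Nat.card (R ⧸ Ideal.span {ϖ}) ^ N ∣ e - i then
        PowerSeries.coeff ((e - i) / Nat.card (R ⧸ Ideal.span {ϖ}) ^ N)
          (along hϖ hf ι b (PowerSeries.coeff i (finSuccEquiv S n φ))) else 0 := by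
  -- With φ = ∑ φ_i X_0^i and Q = q^N, the restriction is ∑ t^i ψ_i(t^Q), where ψ_i is the
  -- restriction of φ_i to the curve of `b`.
  set P := finSuccEquiv S n φ with hP
  set Ψ : PowerSeries (MvPowerSeries (Fin n) S) →ₐ[S] PowerSeries S :=
    (along hϖ hf ι (Fin.cons 1 (ϖ ^ N • b))).comp (finSuccEquiv S n).symm.toAlgHom with hΨ
  have hΨφ : along hϖ hf ι (Fin.cons 1 (ϖ ^ N • b)) φ = Ψ P := by
    simp [hΨ, hP]
  have hΨX : Ψ PowerSeries.X = PowerSeries.X := by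
    have h1 : (finSuccEquiv S n).symm PowerSeries.X = X 0 := by
      rw [AlgEquiv.symm_apply_eq, finSuccEquiv_X_zero]
    have h2 := hasSubst_map_equivariantSeries hϖ hf ι
      fun i (_ : Unit) => (Fin.cons 1 (ϖ ^ N • b) : Fin (n + 1) → R) i
    have h3 : Ψ PowerSeries.X = along hϖ hf ι (Fin.cons 1 (ϖ ^ N • b)) (X 0) := by
      rw [← h1]; rfl
    rw [h3, along_apply]
    refine (subst_X h2 0).trans ?_
    have h4 : equivariantSeries hϖ hf (fun _ : Unit => (1 : R)) = PowerSeries.X :=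
      scalarSeries_one hϖ hf
    rw [Fin.cons_zero, h4]
    exact PowerSeries.map_X _
  have hΨC : ∀ c, Ψ (PowerSeries.C c) = (along hϖ hf ι b c).subst
      (PowerSeries.X ^ (Nat.card (R ⧸ Ideal.span {ϖ}) ^ N) : PowerSeries S) := by
    intro c
    have h1 : (finSuccEquiv S n).symm (PowerSeries.C c) = rename Fin.succ c := by
      rw [AlgEquiv.symm_apply_eq, rename_succ_eq]
    have h3 : Ψ (PowerSeries.C c) =
        along hϖ hf ι (Fin.cons 1 (ϖ ^ N • b)) (rename Fin.succ c) := by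
      rw [← h1]; rfl
    rw [h3, along_rename_succ, Fin.tail_cons, along_pow_smul hϖ hf hι]
  -- `Ψ` is used only as an algebra homomorphism, so the infinite sum is truncated: the tail is a
  -- multiple of X^(e+1), and `Ψ` fixes X.
  have hdvd : PowerSeries.X ^ (e + 1) ∣ P - ∑ i ∈ Finset.range (e + 1),
      PowerSeries.C (PowerSeries.coeff i P) * PowerSeries.X ^ i := by
    rw [PowerSeries.X_pow_dvd_iff]
    intro m hm
    simp only [map_sub, map_sum, PowerSeries.coeff_C_mul, PowerSeries.coeff_X_pow]
    rw [Finset.sum_eq_single m]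
    · simp
    · intro j _ hj
      rw [if_neg hj.symm, mul_zero]
    · intro h
      exact absurd (Finset.mem_range.mpr hm) h
  obtain ⟨T, hT⟩ := hdvd
  have hq : Nat.card (R ⧸ Ideal.span {ϖ}) ^ N ≠ 0 :=
    pow_ne_zero _ (one_lt_card hϖ hf).ne_bot
  have hΨP := congrArg Ψ (sub_eq_iff_eq_add.mp hT)
  rw [hΨφ, hΨP, map_add, map_mul, map_pow, hΨX, map_add, map_sum]
  rw [show PowerSeries.coeff e (PowerSeries.X ^ (e + 1) * Ψ T) = 0 from
    PowerSeries.X_pow_dvd_iff.mp (dvd_mul_right _ _) e (Nat.lt_succ_self e), zero_add, map_sum]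
  refine Finset.sum_congr rfl fun i hi => ?_
  rw [map_mul, map_pow, hΨX, hΨC, PowerSeries.coeff_mul_X_pow',
    if_pos (Nat.lt_succ_iff.mp (Finset.mem_range.mp hi)), PowerSeries.coeff_subst_X_pow hq]
  rfl

/-- No cancellation occurs in degree i₀ + dQ, Q = q^N: an index i < i₀ is excluded by the congruence
modulo Q, and an index i > i₀ would need a term of degree below d, the common lower bound for the
orders. -/
lemma coeff_along_cons_ne_zero (hι : ι ϖ = 0) {n : ℕ} {φ : MvPowerSeries (Fin (n + 1)) S}
    {b : Fin n → R} {N d i₀ : ℕ} (hi₀ : i₀ < Nat.card (R ⧸ Ideal.span {ϖ}) ^ N)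
    (hd : ∀ i, PowerSeries.X ^ d ∣
      along hϖ hf ι b (PowerSeries.coeff i (finSuccEquiv S n φ)))
    (h0 : PowerSeries.coeff d
      (along hϖ hf ι b (PowerSeries.coeff i₀ (finSuccEquiv S n φ))) ≠ 0) :
    PowerSeries.coeff (i₀ + d * Nat.card (R ⧸ Ideal.span {ϖ}) ^ N)
      (along hϖ hf ι (Fin.cons 1 (ϖ ^ N • b)) φ) ≠ 0 := by
  rw [coeff_along_cons hϖ hf hι]
  set Q := Nat.card (R ⧸ Ideal.span {ϖ}) ^ N
  have hQ : 0 < Q := by omega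
  rw [Finset.sum_eq_single i₀]
  · rw [Nat.add_sub_cancel_left, if_pos (dvd_mul_left _ _), Nat.mul_div_cancel _ hQ]
    exact h0
  · intro i hi hne
    split_ifs with hdiv
    · rcases Nat.lt_or_gt_of_ne hne with h | h
      · exfalso
        have h1 : i₀ + d * Q - i = (i₀ - i) + d * Q := by omega
        rw [h1, Nat.dvd_add_left (dvd_mul_left _ _)] at hdiv
        have := Nat.le_of_dvd (by omega) hdiv
        omega
      · apply PowerSeries.X_pow_dvd_iff.mp (hd i)
        rw [Nat.div_lt_iff_lt_mul hQ]
        have := Finset.mem_range.mp hi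
        omega
    · rfl
  · intro h
    exact absurd (Finset.mem_range.mpr (by omega)) h

lemma X_pow_dvd_of_subst {φ : PowerSeries S} {Q m : ℕ} (hQ : 0 < Q)
    (h : PowerSeries.X ^ m ∣ φ.subst (PowerSeries.X ^ Q : PowerSeries S)) :
    ∃ m', m ≤ Q * m' ∧ PowerSeries.X ^ m' ∣ φ := by
  -- The ceiling of m / Q.
  refine ⟨(m + Q - 1) / Q, ?_, ?_⟩
  · have := Nat.lt_mul_div_succ (m + Q - 1) hQ
    rw [Nat.mul_add, mul_one] at this
    omega
  · rw [PowerSeries.X_pow_dvd_iff] at h ⊢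
    intro e he
    have h1 : Q * e < m := by
      have h2 := (Nat.le_div_iff_mul_le hQ).mp (Nat.succ_le_of_lt he)
      rw [Nat.succ_mul, mul_comm] at h2
      omega
    have h3 := h (Q * e) h1
    rw [PowerSeries.coeff_subst_X_pow hQ.ne', if_pos (dvd_mul_right _ _),
      Nat.mul_div_cancel_left _ hQ] at h3
    exact h3

lemma exists_coeff_finSuccEquiv_ne_zero {n : ℕ} {φ : MvPowerSeries (Fin (n + 1)) S}
    (hφ : φ ≠ 0) : ∃ i, PowerSeries.coeff i (finSuccEquiv S n φ) ≠ 0 := by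
  by_contra! h
  apply hφ
  apply (finSuccEquiv S n).injective
  rw [map_zero]
  ext1 i
  rw [h i, map_zero]

/-- A non-zero series does not vanish on all the curves `t ↦ ([a_i](t))_i`. -/
lemma exists_along_ne_zero (hι : ι ϖ = 0) {n : ℕ} {φ : MvPowerSeries (Fin n) S} (hφ : φ ≠ 0) :
    ∃ a : Fin n → R, along hϖ hf ι a φ ≠ 0 := by
  classical
  induction n with
  | zero =>
    refine ⟨0, fun h => hφ ?_⟩
    have h1 : φ = C (constantCoeff φ) := by
      ext m
      rw [Subsingleton.elim m 0]
      simp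
    rw [h1] at h ⊢
    rw [along_apply, subst_C] at h
    have h2 := congrArg constantCoeff h
    rw [constantCoeff_C, map_zero] at h2
    rw [h2, map_zero]
  | succ n ih =>
    obtain ⟨i, hi⟩ := exists_coeff_finSuccEquiv_ne_zero hφ
    obtain ⟨b, hb⟩ := ih hi
    -- `Nat.find` gives the least order along `b` among all the coefficients. If index `j` attains
    -- it, the exponent N = j will do, as j < q^j.
    have hex : ∃ d, ∃ j, PowerSeries.coeff d
        (along hϖ hf ι b (PowerSeries.coeff j (finSuccEquiv S n φ))) ≠ 0 := by
      by_contra! h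
      exact hb (PowerSeries.ext fun d => by rw [h d i, map_zero])
    obtain ⟨j, hj⟩ := Nat.find_spec hex
    have hlt : j < Nat.card (R ⧸ Ideal.span {ϖ}) ^ j := Nat.lt_pow_self (one_lt_card hϖ hf)
    refine ⟨Fin.cons 1 (ϖ ^ j • b), fun h => ?_⟩
    refine coeff_along_cons_ne_zero hϖ hf hι hlt (fun i => ?_) hj (by rw [h, map_zero])
    rw [PowerSeries.X_pow_dvd_iff]
    intro m hm
    by_contra hne
    exact Nat.find_min hex hm ⟨i, hne⟩

end Along

/-! ### High order of vanishing along a curve forces an approximate linear relation. -/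

section Cover

variable {R : Type*} [CommRing R] [IsDomain R] {ϖ : R} {f : PowerSeries R}
  (hϖ : IsUniformizer ϖ) (hf : IsLubinTateSeries ϖ f)
  {κ : Type*} [Field κ] {ι : R →+* κ}

omit [IsDomain R] in
lemma exists_isUnit_iff (hϖ : IsUniformizer ϖ) {σ : Type*} {a : σ → R} :
    (∃ i, IsUnit (a i)) ↔ ¬ ∀ i, ϖ ∣ a i := by
  push Not
  exact exists_congr fun i => hϖ.isUnit_iff _

omit [IsDomain R] in
lemma exists_isUnit_vecMul (hϖ : IsUniformizer ϖ) {n : ℕ} {g : Matrix (Fin n) (Fin n) R}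
    (hg : IsUnit g) {b : Fin n → R} (hb : ∃ i, IsUnit (b i)) :
    ∃ i, IsUnit (Matrix.vecMul b g i) := by
  obtain ⟨u, rfl⟩ := hg
  rw [exists_isUnit_iff hϖ] at hb ⊢
  contrapose! hb
  intro i
  have h1 : b = Matrix.vecMul (Matrix.vecMul b u) (↑u⁻¹ : Matrix (Fin n) (Fin n) R) := by
    rw [Matrix.vecMul_vecMul, Units.mul_inv, Matrix.vecMul_one]
  rw [h1, Matrix.vecMul, dotProduct]
  exact Finset.dvd_sum fun j _ => Dvd.dvd.mul_right (hb j) _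

/-- Uniform control of the order of vanishing on the curves with first coordinate `t` and the other
coordinates highly divisible. -/
lemma exists_forall_cons (hι : ι ϖ = 0) {n : ℕ} {φ : MvPowerSeries (Fin (n + 1)) κ} (c : ℕ)
    {i₀ : ℕ} : ∃ N c' l : ℕ, 0 < N ∧ ∀ (b : Fin n → R) (k m : ℕ),
      Nat.card (R ⧸ Ideal.span {ϖ}) ^ k ≤ c * m →
      PowerSeries.X ^ m ∣ along hϖ hf ι (Fin.cons 1 (ϖ ^ N • b)) φ →
      k ≤ l ∨ ∃ m', Nat.card (R ⧸ Ideal.span {ϖ}) ^ k ≤ c' * m' ∧ PowerSeries.X ^ m' ∣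
        along hϖ hf ι b (PowerSeries.coeff i₀ (finSuccEquiv κ n φ)) := by
  classical
  set q := Nat.card (R ⧸ Ideal.span {ϖ}) with hq
  have hq1 : 1 < q := one_lt_card hϖ hf
  set P := finSuccEquiv κ n φ with hP
  -- Finitely many coefficients generate the ideal of all of them, so along every curve the least
  -- order is attained among these. This is what makes the bounds uniform in `b`.
  obtain ⟨M, hM⟩ : ∃ M, ∀ i, PowerSeries.coeff i P ∈
      Ideal.span ((fun j => PowerSeries.coeff j P) '' Set.Iic M) := by
    let J : ℕ →o Ideal (MvPowerSeries (Fin n) κ) :=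
      ⟨fun M => Ideal.span ((fun j => PowerSeries.coeff j P) '' Set.Iic M), fun M M' h =>
        Ideal.span_mono (Set.image_mono (Set.Iic_subset_Iic.mpr h))⟩
    obtain ⟨M, hM⟩ := monotone_stabilizes_iff_noetherian.mpr
      (inferInstance : IsNoetherian (MvPowerSeries (Fin n) κ) (MvPowerSeries (Fin n) κ)) J
    refine ⟨M, fun i => ?_⟩
    have h1 : PowerSeries.coeff i P ∈ J (max M i) :=
      Ideal.subset_span ⟨i, Set.mem_Iic.mpr (le_max_right _ _), rfl⟩
    rw [← hM _ (le_max_left _ _)] at h1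
    exact h1
  have hMlt : M < q ^ (M + 1) := lt_trans (Nat.lt_succ_self M) (Nat.lt_pow_self hq1)
  -- N = M + 1 makes q^N exceed the indices up to M. If d is the least order, then m ≤ q^N (1 + d):
  -- for d = 0 this bounds k by c q^N, for d > 0 it gives q^k ≤ 2 c q^N d. The + 1 keeps the
  -- constant positive for the case where all coefficients vanish along `b`.
  refine ⟨M + 1, 2 * c * q ^ (M + 1) + 1, c * q ^ (M + 1), Nat.succ_pos M, ?_⟩
  intro b k m hk hm
  by_cases hex : ∃ d, ∃ j, j ≤ M ∧ PowerSeries.coeff d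
      (along hϖ hf ι b (PowerSeries.coeff j P)) ≠ 0
  · obtain ⟨j, hjM, hj⟩ := Nat.find_spec hex
    set d := Nat.find hex with hd
    have hdvd : ∀ i, PowerSeries.X ^ d ∣ along hϖ hf ι b (PowerSeries.coeff i P) := by
      intro i
      have h1 : Ideal.span ((fun j => PowerSeries.coeff j P) '' Set.Iic M) ≤
          (Ideal.span {(PowerSeries.X ^ d : PowerSeries κ)}).comap (along hϖ hf ι b) := by
        rw [Ideal.span_le]
        rintro _ ⟨j', hj', rfl⟩
        rw [SetLike.mem_coe, Ideal.mem_comap, Ideal.mem_span_singleton, PowerSeries.X_pow_dvd_iff]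
        intro e he
        by_contra hne
        exact Nat.find_min hex he ⟨j', hj', hne⟩
      exact Ideal.mem_span_singleton.mp (h1 (hM i))
    have hne : PowerSeries.coeff (j + d * q ^ (M + 1))
        (along hϖ hf ι (Fin.cons 1 (ϖ ^ (M + 1) • b)) φ) ≠ 0 :=
      coeff_along_cons_ne_zero hϖ hf hι (lt_of_le_of_lt hjM hMlt) hdvd hj
    have hmle : m ≤ j + d * q ^ (M + 1) := by
      by_contra hlt
      exact hne (PowerSeries.X_pow_dvd_iff.mp hm _ (by omega))
    have hkle : q ^ k ≤ c * (q ^ (M + 1) * (1 + d)) := by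
      refine hk.trans (Nat.mul_le_mul_left _ (hmle.trans ?_))
      rw [mul_add, mul_one, mul_comm d]
      omega
    rcases Nat.eq_zero_or_pos d with h0 | hpos
    · left
      rw [h0, add_zero, mul_one] at hkle
      exact le_trans (Nat.lt_pow_self hq1).le hkle
    · right
      refine ⟨d, hkle.trans ?_, hdvd i₀⟩
      have : c * (q ^ (M + 1) * (1 + d)) ≤ c * (q ^ (M + 1) * (2 * d)) := by
        gcongr
        omega
      nlinarith
  · right
    push Not at hex
    refine ⟨q ^ k, Nat.le_mul_of_pos_left _ (Nat.succ_pos _), ?_⟩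
    have h1 : Ideal.span ((fun j => PowerSeries.coeff j P) '' Set.Iic M) ≤
        RingHom.ker (along hϖ hf ι b) := by
      rw [Ideal.span_le]
      rintro _ ⟨j', hj', rfl⟩
      exact PowerSeries.ext fun e => by rw [hex e j' hj', map_zero]
    rw [show along hϖ hf ι b (PowerSeries.coeff i₀ P) = 0 from h1 (hM i₀)]
    exact dvd_zero _

variable [TopologicalSpace R] [IsTopologicalRing R] [CompactSpace R]

/-- If a non-zero series over the residue field vanishes to high order along the curve
`t ↦ ([a_i](t))_i`, then `a` nearly satisfies one of finitely many primitive linear equations. -/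
theorem exists_finset_forall_dvd (hι : ι ϖ = 0) (hopen : ∀ N : ℕ, IsOpen {x : R | ϖ ^ N ∣ x})
    (hsep : ∀ x : R, (∀ N : ℕ, ϖ ^ N ∣ x) → x = 0) {n : ℕ} {φ : MvPowerSeries (Fin n) κ}
    (hφ : φ ≠ 0) (c : ℕ) :
    ∃ (B : Finset (Fin n → R)) (l : ℕ), (∀ b ∈ B, ∃ i, IsUnit (b i)) ∧
      ∀ (a : Fin n → R) (k m : ℕ), Nat.card (R ⧸ Ideal.span {ϖ}) ^ k ≤ c * m →
        PowerSeries.X ^ m ∣ along hϖ hf ι a φ →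
        ∃ b ∈ B, ϖ ^ k ∣ ϖ ^ l * ∑ i, b i * a i := by
  classical
  set q := Nat.card (R ⧸ Ideal.span {ϖ}) with hq
  have hq1 : 1 < q := one_lt_card hϖ hf
  -- c is generalised because `exists_forall_cons` changes the constant.
  induction n generalizing c with
  | zero =>
    refine ⟨∅, 0, by simp, fun a k m hk hm => ?_⟩
    -- In no variables φ is a non-zero constant: m = 0 contradicts q^k ≤ c m, and m > 0 contradicts
    -- the divisibility.
    exfalso
    have h1 : φ = C (constantCoeff φ) := by
      ext m
      rw [Subsingleton.elim m 0]
      simp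
    have h0 : constantCoeff φ ≠ 0 := by
      intro h
      rw [h, map_zero] at h1
      exact hφ h1
    rw [h1, along_apply, subst_C] at hm
    rcases Nat.eq_zero_or_pos m with rfl | hpos
    · have := Nat.pos_of_ne_zero (pow_ne_zero k hq1.ne_bot)
      omega
    · have h2 := PowerSeries.X_pow_dvd_iff.mp hm 0 hpos
      rw [PowerSeries.coeff_zero_eq_constantCoeff_apply] at h2
      exact h0 ((constantCoeff_C (σ := Unit) _).symm.trans h2)
  | succ n ih =>
    -- the primitive vectors form a compact set
    have hclosed : IsClosed {a : Fin (n + 1) → R | ∃ i, IsUnit (a i)} := by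
      have h1 : {a : Fin (n + 1) → R | ∃ i, IsUnit (a i)} =
          (⋂ i, (fun a : Fin (n + 1) → R => a i) ⁻¹' {x | ϖ ^ 1 ∣ x})ᶜ := by
        ext a
        simp only [Set.mem_ofPred_eq, exists_isUnit_iff hϖ, Set.mem_compl_iff, Set.mem_iInter,
          Set.mem_preimage, pow_one]
      rw [h1, isClosed_compl_iff]
      exact isOpen_iInter_of_finite fun i => (hopen 1).preimage (continuous_apply i)
    have hprim : ∃ (B : Finset (Fin (n + 1) → R)) (l : ℕ), (∀ b ∈ B, ∃ i, IsUnit (b i)) ∧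
        ∀ a ∈ {a : Fin (n + 1) → R | ∃ i, IsUnit (a i)}, ∀ k m : ℕ, q ^ k ≤ c * m →
          PowerSeries.X ^ m ∣ along hϖ hf ι a φ →
          ∃ b ∈ B, ϖ ^ k ∣ ϖ ^ l * ∑ i, b i * a i := by
      -- By compactness a neighbourhood of one primitive vector suffices: for unions the sets of
      -- relations are united and the exponents l added.
      refine hclosed.isCompact.induction_on (p := fun U => ∃ (B : Finset (Fin (n + 1) → R)) (l : ℕ),
        (∀ b ∈ B, ∃ i, IsUnit (b i)) ∧ ∀ a ∈ U, ∀ k m : ℕ, q ^ k ≤ c * m →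
          PowerSeries.X ^ m ∣ along hϖ hf ι a φ →
          ∃ b ∈ B, ϖ ^ k ∣ ϖ ^ l * ∑ i, b i * a i) ?_ ?_ ?_ ?_
      · exact ⟨∅, 0, by simp, by simp⟩
      · rintro U V hUV ⟨B, l, hB, h⟩
        exact ⟨B, l, hB, fun a ha => h a (hUV ha)⟩
      · rintro U V ⟨B, l, hB, h⟩ ⟨B', l', hB', h'⟩
        refine ⟨B ∪ B', l + l', fun b hb => ?_, fun a ha k m hk hm => ?_⟩
        · rcases Finset.mem_union.mp hb with hb | hb
          exacts [hB b hb, hB' b hb]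
        · rcases ha with ha | ha
          · obtain ⟨b, hb, hdvd⟩ := h a ha k m hk hm
            refine ⟨b, Finset.mem_union_left _ hb, hdvd.trans ?_⟩
            exact mul_dvd_mul_right (pow_dvd_pow _ (Nat.le_add_right _ _)) _
          · obtain ⟨b, hb, hdvd⟩ := h' a ha k m hk hm
            refine ⟨b, Finset.mem_union_right _ hb, hdvd.trans ?_⟩
            exact mul_dvd_mul_right (pow_dvd_pow _ (Nat.le_add_left _ _)) _
      · rintro a₀ ⟨i, hi⟩
        -- Coordinates are changed so that a₀ lies on the first axis. `g` acts on row vectors, hence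
        -- the transpose.
        obtain ⟨g, hg, hga⟩ := exists_changeMatrices_vecMul hi
        have hgT : IsUnit g.transpose := by
          rw [Matrix.isUnit_iff_isUnit_det, Matrix.det_transpose, ← Matrix.isUnit_iff_isUnit_det]
          exact isUnit_of_mem_changeMatrices hg
        obtain ⟨T, hT⟩ := hgT
        have hTa : T.val.mulVec a₀ = Pi.single 0 (a₀ i) := by
          rw [hT, Matrix.mulVec_transpose, hga]
        set ψ := linearSubst hϖ hf ι (↑T⁻¹ : Matrix (Fin (n + 1)) (Fin (n + 1)) R) φ with hψ
        have hψφ : ∀ a : Fin (n + 1) → R,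
            along hϖ hf ι (T.val.mulVec a) ψ = along hϖ hf ι a φ := by
          intro a
          rw [hψ, along_linearSubst, Matrix.mulVec_mulVec, Units.inv_mul, Matrix.one_mulVec]
        have hψ0 : ψ ≠ 0 := by
          intro h0
          apply hφ
          rw [← linearSubst_one hϖ hf ι φ, ← Units.inv_mul T, ← linearSubst_linearSubst, ← hψ, h0,
            map_zero]
        obtain ⟨i₀, hi₀⟩ := exists_coeff_finSuccEquiv_ne_zero hψ0
        obtain ⟨N, c', l, hN, hmain⟩ := exists_forall_cons hϖ hf hι (φ := ψ) c (i₀ := i₀)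
        obtain ⟨B, l', hB, hB'⟩ := ih hi₀ c'
        -- On this neighbourhood T a is a unit followed by multiples of ϖ^N. Dividing by the unit
        -- gives the curves treated in `exists_forall_cons`.
        let U : Set (Fin (n + 1) → R) := ⋂ j, (fun a => a j - a₀ j) ⁻¹' {x | ϖ ^ N ∣ x}
        have hU : IsOpen U := isOpen_iInter_of_finite fun j =>
          (hopen N).preimage ((continuous_apply j).sub continuous_const)
        refine ⟨U, mem_nhdsWithin_of_mem_nhds (hU.mem_nhds (by simp [U])), ?_⟩
        -- The relations found by induction for one coefficient of ψ are padded by 0 and carried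
        -- back by T. The additional unit vector serves the case k ≤ l, where divisibility is
        -- automatic.
        refine ⟨(insert (Pi.single 0 1) (B.image fun b => Fin.cons 0 b)).image
          fun b => Matrix.vecMul b T.val, l + l', ?_, ?_⟩
        · intro b hb
          obtain ⟨b', hb', rfl⟩ := Finset.mem_image.mp hb
          apply exists_isUnit_vecMul hϖ T.isUnit
          rcases Finset.mem_insert.mp hb' with rfl | hb'
          · exact ⟨0, by simp⟩
          · obtain ⟨b'', hb'', rfl⟩ := Finset.mem_image.mp hb'
            obtain ⟨j, hj⟩ := hB b'' hb''
            exact ⟨j.succ, by simpa using hj⟩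
        · intro a ha k m hk hm
          set y := T.val.mulVec a with hy
          have hyT : ∀ j, ϖ ^ N ∣ y j - (Pi.single 0 (a₀ i) : Fin (n + 1) → R) j := by
            intro j
            rw [← hTa, hy, ← Pi.sub_apply, ← Matrix.mulVec_sub, Matrix.mulVec, dotProduct]
            exact Finset.dvd_sum fun j' _ => Dvd.dvd.mul_left (Set.mem_iInter.mp ha j') _
          have hy0 : IsUnit (y 0) := by
            rw [hϖ.isUnit_iff] at hi ⊢
            contrapose! hi
            have h1 := (dvd_pow_self ϖ hN.ne').trans (hyT 0)
            rw [Pi.single_eq_same] at h1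
            exact (dvd_sub_right hi).mp h1
          obtain ⟨v, hv⟩ := hy0
          have hys : ∀ j : Fin n, ∃ z, y j.succ = ϖ ^ N * z := by
            intro j
            have h1 := hyT j.succ
            rw [Pi.single_eq_of_ne (Fin.succ_ne_zero j), sub_zero] at h1
            exact h1
          choose z hz using hys
          have hcons : (↑v⁻¹ : R) • y = Fin.cons 1 (ϖ ^ N • ((↑v⁻¹ : R) • z)) := by
            funext j
            refine Fin.cases ?_ (fun j => ?_) j
            · simp [← hv]
            · simp only [Pi.smul_apply, smul_eq_mul, Fin.cons_succ, hz]
              ring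
          have hm' : PowerSeries.X ^ m ∣
              along hϖ hf ι (Fin.cons 1 (ϖ ^ N • ((↑v⁻¹ : R) • z))) ψ := by
            rw [← hcons]
            apply X_pow_dvd_along_smul
            rwa [hψφ]
          have hsum : ∀ b : Fin (n + 1) → R,
              ∑ j, Matrix.vecMul b T.val j * a j = ∑ j, b j * y j := by
            intro b
            exact (Matrix.dotProduct_mulVec b _ a).symm
          rcases hmain _ k m hk hm' with h | ⟨m', hk', hm''⟩
          · refine ⟨_, Finset.mem_image_of_mem _ (Finset.mem_insert_self _ _), ?_⟩
            exact Dvd.dvd.mul_right (pow_dvd_pow _ (by omega)) _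
          · obtain ⟨b, hb, hdvd⟩ := hB' _ k m' hk' hm''
            refine ⟨_, Finset.mem_image_of_mem _ (Finset.mem_insert_of_mem
              (Finset.mem_image_of_mem _ hb)), ?_⟩
            rw [hsum, Fin.sum_univ_succ]
            simp only [Fin.cons_zero, zero_mul, zero_add, Fin.cons_succ, hz]
            have h2 : ∑ j, b j * (ϖ ^ N * z j) =
                ϖ ^ N * v * ∑ j, b j * ((↑v⁻¹ : R) • z) j := by
              rw [Finset.mul_sum]
              refine Finset.sum_congr rfl fun j _ => ?_
              simp only [Pi.smul_apply, smul_eq_mul]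
              linear_combination (-(b j * ϖ ^ N * z j)) * v.mul_inv
            rw [h2, pow_add]
            refine hdvd.trans ⟨ϖ ^ l * (ϖ ^ N * v), by ring⟩
    obtain ⟨B, l, hB, h⟩ := hprim
    -- A non-zero a is ϖ^j a' with a' primitive. Passing to a' divides the order by q^j, which
    -- matches the passage from k to k - j. The unit vector covers a = 0 and k ≤ j.
    refine ⟨insert (Pi.single 0 1) B, l, fun b hb => ?_, fun a k m hk hm => ?_⟩
    · rcases Finset.mem_insert.mp hb with rfl | hb
      · exact ⟨0, by simp⟩
      · exact hB b hb
    · by_cases ha : ∀ i, a i = 0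
      · exact ⟨_, Finset.mem_insert_self _ _, by simp [ha]⟩
      · have hex : ∃ N, ¬ ∀ i, ϖ ^ N ∣ a i := by
          by_contra! h'
          exact ha fun i => hsep _ fun N => h' N i
        have hpos : Nat.find hex ≠ 0 := by
          intro h0
          have := Nat.find_spec hex
          rw [h0] at this
          simp at this
        obtain ⟨j, hj⟩ := Nat.exists_eq_succ_of_ne_zero hpos
        have h1 : ∀ i, ϖ ^ j ∣ a i := by
          have := Nat.find_min hex (m := j) (by omega)
          simpa using this
        choose a' ha' using h1
        have haa' : a = ϖ ^ j • a' := funext ha'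
        have hprim' : ∃ i, IsUnit (a' i) := by
          rw [exists_isUnit_iff hϖ]
          intro hdvd
          have := Nat.find_spec hex
          rw [hj] at this
          apply this
          intro i
          rw [ha', pow_succ]
          exact mul_dvd_mul_left _ (hdvd i)
        rcases le_total k j with hkj | hkj
        · refine ⟨_, Finset.mem_insert_self _ _, ?_⟩
          refine Dvd.dvd.mul_left (Finset.dvd_sum fun i _ => ?_) _
          rw [ha']
          exact Dvd.dvd.mul_left (Dvd.dvd.mul_right (pow_dvd_pow _ hkj) _) _
        · rw [haa', along_pow_smul hϖ hf hι] at hm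
          have hQ : 0 < q ^ j := pow_pos (by omega) _
          obtain ⟨m', hmm', hm'⟩ := X_pow_dvd_of_subst hQ hm
          have hk' : q ^ (k - j) ≤ c * m' := by
            have h2 : q ^ j * q ^ (k - j) ≤ q ^ j * (c * m') := by
              rw [← pow_add, Nat.add_sub_cancel' hkj]
              calc q ^ k ≤ c * m := hk
                _ ≤ c * (q ^ j * m') := Nat.mul_le_mul_left _ hmm'
                _ = q ^ j * (c * m') := by ring
            exact Nat.le_of_mul_le_mul_left h2 hQ
          obtain ⟨b, hb, hdvd⟩ := h a' hprim' _ m' hk' hm'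
          refine ⟨b, Finset.mem_insert_of_mem hb, ?_⟩
          have h3 : ∑ i, b i * a i = ϖ ^ j * ∑ i, b i * a' i := by
            rw [Finset.mul_sum]
            refine Finset.sum_congr rfl fun i _ => ?_
            rw [ha']
            ring
          have h4 : ϖ ^ k = ϖ ^ j * ϖ ^ (k - j) := by
            rw [← pow_add, Nat.add_sub_cancel' hkj]
          rw [h3, h4, mul_left_comm]
          exact mul_dvd_mul_left _ hdvd

end Cover

/-! ### The closed ball and the open disc of ℂ_p. -/

section Ball

variable (p : ℕ) [Fact p.Prime]

/-- The closed unit ball of `ℂ_p`. -/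
def ball : Subring ℂ_[p] where
  carrier := {x | ‖x‖ ≤ 1}
  mul_mem' := fun {x y} hx hy => by
    change ‖x * y‖ ≤ 1
    rw [norm_mul]; exact mul_le_one₀ hx (norm_nonneg y) hy
  one_mem' := by change ‖(1 : ℂ_[p])‖ ≤ 1; rw [norm_one]
  add_mem' := fun {x y} hx hy =>
    (PadicComplex.isNonarchimedean p x y).trans (max_le hx hy)
  zero_mem' := by change ‖(0 : ℂ_[p])‖ ≤ 1; rw [norm_zero]; exact zero_le_one
  neg_mem' := fun {x} hx => by change ‖-x‖ ≤ 1; rw [norm_neg]; exact hx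

variable {p}

lemma norm_coe_ball_le (x : ball p) : ‖(x : ℂ_[p])‖ ≤ 1 := x.2

lemma norm_add_le_of_le {x y : ℂ_[p]} {r : ℝ} (hx : ‖x‖ ≤ r) (hy : ‖y‖ ≤ r) : ‖x + y‖ ≤ r :=
  (PadicComplex.isNonarchimedean p x y).trans (max_le hx hy)

lemma norm_add_lt_of_lt {x y : ℂ_[p]} {r : ℝ} (hx : ‖x‖ < r) (hy : ‖y‖ < r) : ‖x + y‖ < r :=
  (PadicComplex.isNonarchimedean p x y).trans_lt (max_lt hx hy)

lemma norm_sub_lt_of_lt {x y : ℂ_[p]} {r : ℝ} (hx : ‖x‖ < r) (hy : ‖y‖ < r) : ‖x - y‖ < r := by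
  rw [sub_eq_add_neg]
  exact norm_add_lt_of_lt hx (by rwa [norm_neg])

lemma norm_sum_le_of_le {ι : Type*} (s : Finset ι) {g : ι → ℂ_[p]} {r : ℝ} (hr : 0 ≤ r)
    (h : ∀ i ∈ s, ‖g i‖ ≤ r) : ‖∑ i ∈ s, g i‖ ≤ r := by
  classical
  induction s using Finset.induction_on with
  | empty => simpa
  | insert a s ha ih =>
    rw [Finset.sum_insert ha]
    exact norm_add_le_of_le (h a (Finset.mem_insert_self _ _))
      (ih fun i hi => h i (Finset.mem_insert_of_mem hi))

instance : CompleteSpace (ball p) := by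
  have h : IsClosed ((ball p : Set ℂ_[p])) := by
    have h1 : (ball p : Set ℂ_[p]) = Metric.closedBall 0 1 := by
      ext x
      rw [mem_closedBall_zero_iff]
      rfl
    rw [h1]
    exact Metric.isClosed_closedBall
  exact h.completeSpace_coe

instance : IsUniformAddGroup (ball p) :=
  inferInstanceAs (IsUniformAddGroup (ball p).toAddSubgroup)

/-- The ideal of the elements of norm less than `r`. -/
def ballIdeal (p : ℕ) [Fact p.Prime] (r : ℝ) (hr : 0 < r) : Ideal (ball p) where
  carrier := {x | ‖(x : ℂ_[p])‖ < r}
  add_mem' := fun {x y} hx hy => by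
    change ‖((x + y : ball p) : ℂ_[p])‖ < r
    rw [Subring.coe_add]
    exact norm_add_lt_of_lt hx hy
  zero_mem' := by change ‖((0 : ball p) : ℂ_[p])‖ < r; simpa using hr
  smul_mem' := fun c {x} hx => by
    change ‖((c * x : ball p) : ℂ_[p])‖ < r
    rw [Subring.coe_mul, norm_mul]
    exact lt_of_le_of_lt (mul_le_of_le_one_left (norm_nonneg _) c.2) hx

lemma mem_ballIdeal {r : ℝ} (hr : 0 < r) {x : ball p} :
    x ∈ ballIdeal p r hr ↔ ‖(x : ℂ_[p])‖ < r := Iff.rfl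

/-- Balls around 0 are ideals. Evaluation of power series by `aeval` needs this form of the
topology. -/
instance : IsLinearTopology (ball p) (ball p) := by
  refine IsLinearTopology.mk_of_hasBasis' (ι := {r : ℝ // 0 < r}) (ball p) (p := fun _ => True)
    (s := fun r => ballIdeal p r.1 r.2) ?_ (fun I r m hm => I.smul_mem r hm)
  refine (Metric.nhds_basis_ball (x := (0 : ball p))).to_hasBasis ?_ ?_
  · intro r hr
    refine ⟨⟨r, hr⟩, trivial, fun x hx => ?_⟩
    rw [mem_ball_zero_iff]
    exact hx
  · rintro ⟨r, hr⟩ -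
    refine ⟨r, hr, fun x hx => ?_⟩
    rw [mem_ball_zero_iff] at hx
    exact hx

variable (p) in
/-- The open unit disc of `ℂ_p`. -/
@[ext] structure Disc where
  /-- The underlying element of the closed unit ball. -/
  val : ball p
  norm_lt : ‖(val : ℂ_[p])‖ < 1

instance : CoeOut (Disc p) (ball p) := ⟨Disc.val⟩

instance : Zero (Disc p) := ⟨⟨0, by simp⟩⟩

@[simp] lemma Disc.coe_zero : ((0 : Disc p) : ball p) = 0 := rfl

lemma hasEval_disc {σ : Type*} [Finite σ] (z : σ → Disc p) :
    HasEval fun i => (z i : ball p) where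
  hpow i := by
    rw [IsTopologicallyNilpotent, tendsto_subtype_rng]
    simp only [Subring.coe_pow, Subring.coe_zero]
    exact tendsto_pow_atTop_nhds_zero_of_norm_lt_one (z i).norm_lt
  tendsto_zero := by
    rw [Filter.cofinite_eq_bot]
    exact Filter.tendsto_bot

end Ball

/-! ### Values of power series on the open polydisc. -/

section Evaluation

variable {p : ℕ} [Fact p.Prime] {R : Type*} [CommRing R] [Algebra R (ball p)]
  {σ τ : Type*} [Finite σ] [Finite τ]

attribute [local instance] DiscreteTopology.instContinuousSMul

/-- The value of a power series at a point of the open polydisc. -/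
def evalAt (z : σ → Disc p) : MvPowerSeries σ R →ₐ[R] ball p :=
  -- Discrete coefficients: no topology on R has to be compatible with that of the ball.
  letI : UniformSpace R := ⊥
  aeval (hasEval_disc z)

lemma hasSum_evalAt (z : σ → Disc p) (φ : MvPowerSeries σ R) :
    HasSum (fun d : σ →₀ ℕ => algebraMap R (ball p) (coeff d φ) *
      d.prod fun i e => (z i : ball p) ^ e) (evalAt z φ) :=
  let _ : UniformSpace R := ⊥
  by simpa only [Algebra.smul_def] using! hasSum_aeval (hasEval_disc z) φ

@[simp] lemma evalAt_X (z : σ → Disc p) (i : σ) :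
    evalAt z (X i : MvPowerSeries σ R) = z i := by
  let _ : UniformSpace R := ⊥
  rw [evalAt, ← MvPolynomial.coe_X, aeval_coe, MvPolynomial.aeval_X]

@[simp] lemma evalAt_C (z : σ → Disc p) (r : R) :
    evalAt z (C r : MvPowerSeries σ R) = algebraMap R (ball p) r :=
  (evalAt z).commutes r

/-- The ultrametric inequality bounds the partial sums, and the closed ball of radius r contains
their limit. -/
lemma norm_evalAt_le (z : σ → Disc p) (φ : MvPowerSeries σ R) {r : ℝ} (hr : 0 ≤ r)
    (h : ∀ d, coeff d φ ≠ 0 → ‖((d.prod fun i e => (z i : ball p) ^ e : ball p) : ℂ_[p])‖ ≤ r) :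
    ‖(evalAt z φ : ℂ_[p])‖ ≤ r := by
  have h1 := (hasSum_evalAt z φ).map (ball p).subtype continuous_subtype_val
  have hcl : IsClosed {x : ℂ_[p] | ‖x‖ ≤ r} := isClosed_le continuous_norm continuous_const
  refine hcl.mem_of_tendsto h1 (Filter.Eventually.of_forall fun s => ?_)
  refine norm_sum_le_of_le s hr fun d _ => ?_
  simp only [Function.comp_apply, Subring.subtype_apply, Subring.coe_mul, norm_mul]
  by_cases hd : coeff d φ = 0
  · rw [hd, map_zero]
    simpa using hr
  · exact (mul_le_of_le_one_left (norm_nonneg _) (norm_coe_ball_le _)).trans (h d hd)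

omit [Finite σ] in
lemma norm_finsuppProd_le {z : σ → Disc p} {r : ℝ} (hr : ∀ i, ‖((z i : ball p) : ℂ_[p])‖ ≤ r)
    (d : σ →₀ ℕ) :
    ‖((d.prod fun i e => (z i : ball p) ^ e : ball p) : ℂ_[p])‖ ≤ r ^ d.degree := by
  rw [Finsupp.prod, SubmonoidClass.coe_finsetProd, norm_prod, Finsupp.degree_apply,
    ← Finset.prod_pow_eq_pow_sum]
  refine Finset.prod_le_prod (fun i _ => norm_nonneg _) fun i _ => ?_
  rw [Subring.coe_pow, norm_pow]
  exact pow_le_pow_left₀ (norm_nonneg _) (hr i) _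

/-- Finitely many coordinates have a common bound r < 1, and every monomial that occurs has positive
degree. -/
lemma norm_evalAt_lt_one (z : σ → Disc p) {φ : MvPowerSeries σ R} (hφ : constantCoeff φ = 0) :
    ‖(evalAt z φ : ℂ_[p])‖ < 1 := by
  obtain ⟨r, hr0, hr1, hr⟩ : ∃ r : ℝ, 0 ≤ r ∧ r < 1 ∧ ∀ i, ‖((z i : ball p) : ℂ_[p])‖ ≤ r := by
    cases isEmpty_or_nonempty σ
    · exact ⟨0, le_rfl, one_pos, fun i => isEmptyElim i⟩
    · obtain ⟨i, hi⟩ := Finite.exists_max fun i => ‖((z i : ball p) : ℂ_[p])‖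
      exact ⟨_, norm_nonneg _, (z i).norm_lt, hi⟩
  refine lt_of_le_of_lt (norm_evalAt_le z φ hr0 fun d hd => ?_) hr1
  refine (norm_finsuppProd_le hr d).trans ?_
  have : d.degree ≠ 0 := by
    intro h
    rw [(Finsupp.degree_eq_zero_iff d).mp h] at hd
    exact hd hφ
  exact pow_le_of_le_one hr0 hr1.le this

/-- The value of a power series without constant term, as a point of the disc. -/
def evalDisc (z : σ → Disc p) (φ : MvPowerSeries σ R) (hφ : constantCoeff φ = 0) : Disc p :=
  ⟨evalAt z φ, norm_evalAt_lt_one z hφ⟩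

lemma evalAt_subst (z : τ → Disc p) {a : σ → MvPowerSeries τ R} (ha : ∀ i, constantCoeff (a i) = 0)
    (φ : MvPowerSeries σ R) :
    evalAt z (φ.subst a) = evalAt (fun i => evalDisc z (a i) (ha i)) φ := by
  let _ : UniformSpace R := ⊥
  have h := eval₂_subst (R := R) (S := R) (hasSubst_of_constantCoeff_zero ha) (hasEval_disc z) φ
  rw [← coe_aeval (hasEval_disc z)] at h
  refine h.trans ?_
  rw [evalAt, ← coe_aeval]
  rfl

lemma evalAt_map {R' : Type*} [CommRing R'] [Algebra R' (ball p)] (ι : R →+* R')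
    (hι : ∀ x, algebraMap R' (ball p) (ι x) = algebraMap R (ball p) x) (z : σ → Disc p)
    (φ : MvPowerSeries σ R) : evalAt z (MvPowerSeries.map ι φ) = evalAt z φ := by
  refine (hasSum_evalAt z _).unique ?_
  simp only [coeff_map, hι]
  exact hasSum_evalAt z φ

lemma evalAt_zero (φ : MvPowerSeries σ R) :
    evalAt (fun _ => (0 : Disc p)) φ = algebraMap R (ball p) (constantCoeff φ) := by
  refine (hasSum_evalAt _ φ).unique ?_
  convert hasSum_single (0 : σ →₀ ℕ) ?_ using 1
  · simp
  · intro d hd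
    obtain ⟨i, hi⟩ := Finsupp.ne_iff.mp hd
    rw [Finsupp.prod, Finset.prod_eq_zero (i := i) (by simpa using hi), mul_zero]
    rw [Disc.coe_zero, zero_pow hi]

lemma evalAt_rename (e : σ → τ) (z : τ → Disc p) (φ : MvPowerSeries σ R) :
    evalAt z (rename e φ) = evalAt (fun i => z (e i)) φ := by
  rw [rename_eq_subst, evalAt_subst z (fun i => by simp)]
  congr 1
  congr 1
  funext i
  ext
  simp [evalDisc]

/-- The value of a power series in one variable. -/
abbrev evalOne (x : Disc p) : PowerSeries R →ₐ[R] ball p := evalAt (σ := Unit) fun _ => x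

lemma evalOne_X (x : Disc p) : evalOne x (PowerSeries.X : PowerSeries R) = x := evalAt_X _ _

lemma evalOne_C (x : Disc p) (r : R) :
    evalOne x (PowerSeries.C r : PowerSeries R) = algebraMap R (ball p) r := evalAt_C _ _

lemma hasSum_evalOne (x : Disc p) (φ : PowerSeries R) :
    HasSum (fun m : ℕ => algebraMap R (ball p) (PowerSeries.coeff m φ) * (x : ball p) ^ m)
      (evalOne x φ) := by
  have h := hasSum_evalAt (fun _ : Unit => x) φ
  rw [← (Finsupp.uniqueLinearEquiv ℕ ℕ ()).symm.toEquiv.hasSum_iff] at h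
  convert h using 1
  funext m
  simp [PowerSeries.coeff]

lemma evalOne_polynomial (x : Disc p) (P : Polynomial R) :
    evalOne x (P : PowerSeries R) = Polynomial.aeval (x : ball p) P := by
  have h : (evalOne x).comp (Polynomial.coeToPowerSeries.algHom R) =
      Polynomial.aeval (x : ball p) := by
    apply Polynomial.algHom_ext
    simp [Polynomial.coeToPowerSeries.algHom_apply, evalOne_X]
  have := DFunLike.congr_fun h P
  simpa [Polynomial.coeToPowerSeries.algHom_apply] using this

end Evaluation

/-! ### The module structure on the disc and the size of torsion points. -/

section Points

variable {p : ℕ} [Fact p.Prime] {R : Type*} [CommRing R] [IsDomain R] [Algebra R (ball p)]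
  {ϖ : R} {f : PowerSeries R} (hϖ : IsUniformizer ϖ) (hf : IsLubinTateSeries ϖ f)

/-- The linear combination `∑ aᵢ zᵢ` for the group structure on the disc. -/
def lin {σ : Type*} [Finite σ] (a : σ → R) (z : σ → Disc p) : Disc p :=
  evalDisc z (equivariantSeries hϖ hf a) (constantCoeff_equivariantSeries hϖ hf a)

/-- The scalar multiplication by `[c]` on the disc. -/
def scale (c : R) (x : Disc p) : Disc p := lin hϖ hf (fun _ : Unit => c) fun _ => x

lemma lin_lin {σ τ : Type*} [Fintype σ] [Finite τ] (a : σ → R) (B : σ → τ → R) (z : τ → Disc p) :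
    lin hϖ hf a (fun i => lin hϖ hf (B i) z) = lin hϖ hf (fun j => ∑ i, a i * B i j) z := by
  ext1
  change evalAt _ _ = evalAt _ _
  rw [← equivariantSeries_subst hϖ hf, evalAt_subst]
  rfl

lemma lin_single {σ : Type*} [Finite σ] [DecidableEq σ] (i : σ) (z : σ → Disc p) :
    lin hϖ hf (Pi.single i 1) z = z i := by
  ext1
  change evalAt _ _ = _
  rw [equivariantSeries_single, evalAt_X]

lemma lin_zero {σ : Type*} [Finite σ] (z : σ → Disc p) : lin hϖ hf (0 : σ → R) z = 0 := by
  ext1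
  change evalAt _ _ = _
  rw [equivariantSeries_zero, map_zero, Disc.coe_zero]

lemma scale_lin {σ : Type*} [Finite σ] (c : R) (a : σ → R) (z : σ → Disc p) :
    scale hϖ hf c (lin hϖ hf a z) = lin hϖ hf (c • a) z := by
  rw [scale, lin_lin hϖ hf (fun _ : Unit => c) (fun _ => a) z]
  congr 1
  funext j
  simp

lemma scale_scale (c d : R) (x : Disc p) :
    scale hϖ hf c (scale hϖ hf d x) = scale hϖ hf (c * d) x := by
  rw [scale.eq_1 hϖ hf d, scale_lin]
  rfl

lemma scale_one (x : Disc p) : scale hϖ hf 1 x = x := by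
  rw [scale]
  exact lin_single hϖ hf () _

lemma scale_zero (x : Disc p) : scale hϖ hf 0 x = 0 := lin_zero hϖ hf _

lemma lin_apply_zero {σ : Type*} [Finite σ] (a : σ → R) :
    lin hϖ hf a (fun _ => (0 : Disc p)) = 0 := by
  ext1
  change evalAt _ _ = _
  rw [evalAt_zero, constantCoeff_equivariantSeries, map_zero, Disc.coe_zero]

lemma scale_apply_zero (c : R) : scale hϖ hf c (0 : Disc p) = 0 := lin_apply_zero hϖ hf _

lemma lin_scale_const {σ : Type*} [Fintype σ] (a c : σ → R) (x : Disc p) :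
    lin hϖ hf a (fun i => scale hϖ hf (c i) x) = scale hϖ hf (∑ i, a i * c i) x :=
  lin_lin hϖ hf a (fun i (_ : Unit) => c i) _

lemma scale_lin_comm {σ : Type*} [Fintype σ] (c : R) (a : σ → R) (z : σ → Disc p) :
    lin hϖ hf a (fun i => scale hϖ hf c (z i)) = scale hϖ hf c (lin hϖ hf a z) := by
  classical
  have h := lin_lin hϖ hf a (fun i => c • Pi.single (M := fun _ => R) i (1 : R)) z
  simp only [← scale_lin, lin_single] at h
  rw [scale_lin, h]
  congr 1
  funext j
  simp [Pi.single_apply, mul_comm]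

lemma coe_scale (c : R) (x : Disc p) :
    (scale hϖ hf c x : ball p) = evalOne x (scalarSeries hϖ hf c) := rfl

lemma coe_scale_uniformizer (x : Disc p) : (scale hϖ hf ϖ x : ball p) = evalOne x f := by
  rw [coe_scale, scalarSeries_uniformizer]

lemma evalAt_linearSubst {S : Type*} [CommRing S] [Algebra S (ball p)] (ι : R →+* S)
    (hι : ∀ x, algebraMap S (ball p) (ι x) = algebraMap R (ball p) x) {σ τ : Type*} [Finite σ]
    [Finite τ] (g : Matrix σ τ R) (z : τ → Disc p) (φ : MvPowerSeries σ S) :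
    evalAt z (linearSubst hϖ hf ι g φ) = evalAt (fun i => lin hϖ hf (g.row i) z) φ := by
  rw [linearSubst_apply, evalAt_subst z fun i => by
    rw [constantCoeff_map, constantCoeff_equivariantSeries, map_zero]]
  congr 1
  congr 1
  funext i
  ext1
  exact evalAt_map ι hι z _

lemma evalOne_along {S : Type*} [CommRing S] [Algebra S (ball p)] (ι : R →+* S)
    (hι : ∀ x, algebraMap S (ball p) (ι x) = algebraMap R (ball p) x) {σ : Type*} [Finite σ]
    (a : σ → R) (x : Disc p) (φ : MvPowerSeries σ S) :
    evalOne x (along hϖ hf ι a φ) = evalAt (fun i => scale hϖ hf (a i) x) φ :=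
  evalAt_linearSubst hϖ hf ι hι _ _ φ

omit [IsDomain R] [Algebra R (ball p)] in
lemma span_isMaximal (hϖ : IsUniformizer ϖ) : (Ideal.span {ϖ}).IsMaximal := by
  rw [Ideal.isMaximal_iff]
  refine ⟨fun h => (hϖ.isUnit_iff ϖ).mp
    (isUnit_of_dvd_one (Ideal.mem_span_singleton.mp h)) dvd_rfl, ?_⟩
  intro J x _ hx hxJ
  rw [Ideal.mem_span_singleton] at hx
  have := Ideal.eq_top_of_isUnit_mem J hxJ ((hϖ.isUnit_iff x).mpr hx)
  simp [this]

local notation "q" => Nat.card (R ⧸ Ideal.span (Singleton.singleton ϖ : Set R))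

-- Apart from X^q, all terms of f are multiples of ϖ. As q > 1, the linear term is exactly ϖ X,
-- whence u(0) = 1.
include hϖ in
omit [Algebra R (ball p)] in
lemma exists_eq_X_pow_add (hf : IsLubinTateSeries ϖ f) :
    ∃ u : PowerSeries R, f = PowerSeries.X ^ q + PowerSeries.C ϖ * (PowerSeries.X * u) ∧
      PowerSeries.constantCoeff u = 1 := by
  have h1 : ∀ m, ϖ ∣ PowerSeries.coeff m (f - PowerSeries.X ^ q) := by
    intro m
    rw [← Ideal.mem_span_singleton, ← Ideal.Quotient.eq_zero_iff_mem, ← PowerSeries.coeff_map]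
    rw [map_sub, hf.map_eq, map_pow, PowerSeries.map_X, sub_self, map_zero]
  choose w hw using h1
  have hq := one_lt_card hϖ hf
  have h2 : f - PowerSeries.X ^ q = PowerSeries.C ϖ * PowerSeries.mk w := by
    ext m
    rw [hw, PowerSeries.coeff_C_mul, PowerSeries.coeff_mk]
  have h3 : w 0 = 0 := by
    have := hw 0
    rw [map_sub, PowerSeries.coeff_zero_eq_constantCoeff_apply, hf.constantCoeff_eq,
      PowerSeries.coeff_X_pow, if_neg (by omega), sub_zero] at this
    exact (mul_eq_zero.mp this.symm).resolve_left hϖ.ne_zero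
  have h4 : w 1 = 1 := by
    have := hw 1
    rw [map_sub, hf.coeff_one_eq, PowerSeries.coeff_X_pow, if_neg (by omega), sub_zero] at this
    exact mul_left_cancel₀ hϖ.ne_zero (by rw [← this, mul_one])
  obtain ⟨u, hu⟩ := PowerSeries.X_dvd_iff.mpr (show PowerSeries.constantCoeff
    (PowerSeries.mk w) = 0 by rw [← PowerSeries.coeff_zero_eq_constantCoeff_apply,
      PowerSeries.coeff_mk, h3])
  refine ⟨u, by rw [← hu, ← h2]; ring, ?_⟩
  rw [← PowerSeries.coeff_zero_eq_constantCoeff_apply, ← PowerSeries.coeff_succ_X_mul, ← hu,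
    PowerSeries.coeff_mk, h4]

include hϖ in
lemma exists_evalOne_eq (hf : IsLubinTateSeries ϖ f) (x : Disc p) :
    ∃ v : ball p, ‖(v : ℂ_[p]) - 1‖ < 1 ∧
      evalOne x f = (x : ball p) ^ q + algebraMap R (ball p) ϖ * (x * v) := by
  obtain ⟨u, hu, hu1⟩ := exists_eq_X_pow_add hϖ hf
  refine ⟨evalOne x u, ?_, ?_⟩
  · have h1 : ‖((evalOne x (u - 1) : ball p) : ℂ_[p])‖ < 1 :=
      norm_evalAt_lt_one _ (by rw [map_sub, map_one, sub_eq_zero]; exact hu1)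
    rwa [map_sub, map_one, AddSubgroupClass.coe_sub, Subring.coe_one] at h1
  · conv_lhs => rw [hu]
    rw [map_add, map_pow, map_mul, map_mul, evalOne_X, evalOne_C]

lemma norm_eq_one_of_norm_sub_one_lt {v : ℂ_[p]} (h : ‖v - 1‖ < 1) : ‖v‖ = 1 := by
  have h3 := IsUltrametricDist.norm_add_eq_max_of_norm_ne_norm
    (x := v - 1) (y := 1) (by rw [norm_one]; exact h.ne)
  rwa [sub_add_cancel, norm_one, max_eq_right h.le] at h3

include hϖ in
lemma exists_pow_card_sub_one_eq {x : Disc p} (hx : x ≠ 0) (h : scale hϖ hf ϖ x = 0) :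
    ∃ v : ball p, ‖(v : ℂ_[p]) - 1‖ < 1 ∧
      (x : ball p) ^ (q - 1) = -(algebraMap R (ball p) ϖ * v) := by
  have h0 : evalOne x f = 0 := by rw [← coe_scale_uniformizer hϖ hf, h]; rfl
  obtain ⟨v, hv, h1⟩ := exists_evalOne_eq hϖ hf x
  refine ⟨v, hv, ?_⟩
  have hx0 : (x : ball p) ≠ 0 := fun h => hx (Disc.ext h)
  have hq := one_lt_card hϖ hf
  have h2 : (x : ball p) * ((x : ball p) ^ (q - 1) + algebraMap R (ball p) ϖ * v) = 0 := by
    rw [← h0, h1]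
    conv_rhs => rw [← Nat.sub_add_cancel hq.le]
    ring
  exact eq_neg_of_add_eq_zero_left ((mul_eq_zero.mp h2).resolve_left hx0)

variable (hϖ1 : ‖(algebraMap R (ball p) ϖ : ℂ_[p])‖ < 1)

-- The Newton polygon of f / X has a single slope, so all the non-zero points killed by ϖ have the
-- same norm.
include hϖ in
lemma norm_pow_eq_of_scale_eq_zero {x : Disc p} (hx : x ≠ 0) (h : scale hϖ hf ϖ x = 0) :
    ‖((x : ball p) : ℂ_[p])‖ ^ (q - 1) = ‖(algebraMap R (ball p) ϖ : ℂ_[p])‖ := by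
  obtain ⟨v, hv, h1⟩ := exists_pow_card_sub_one_eq hϖ hf hx h
  have h3 := congrArg (fun y : ball p => ‖(y : ℂ_[p])‖) h1
  simpa [norm_eq_one_of_norm_sub_one_lt hv] using h3

-- Points of high order lie near the boundary of the disc. Each step back through f costs at most a
-- q-th root, since ϖ x cannot be the dominant term of f(x).
include hϖ1 in
lemma norm_le_norm_pow_of_scale_ne_zero (k : ℕ) {x : Disc p} (hx : scale hϖ hf (ϖ ^ k) x ≠ 0)
    (h : scale hϖ hf (ϖ ^ (k + 1)) x = 0) :
    ‖(algebraMap R (ball p) ϖ : ℂ_[p])‖ ≤ ‖((x : ball p) : ℂ_[p])‖ ^ q ^ k := by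
  have hq := one_lt_card hϖ hf
  induction k generalizing x with
  | zero =>
    rw [pow_zero, scale_one] at hx
    rw [zero_add, pow_one] at h
    rw [← norm_pow_eq_of_scale_eq_zero hϖ hf hx h]
    exact pow_le_pow_of_le_one (norm_nonneg _) x.norm_lt.le (by rw [pow_zero]; omega)
  | succ k ih =>
    have h1 := ih (x := scale hϖ hf ϖ x) (by rwa [scale_scale, ← pow_succ])
      (by rwa [scale_scale, ← pow_succ])
    obtain ⟨v, hv, h2⟩ := exists_evalOne_eq hϖ hf x
    rw [coe_scale_uniformizer, h2, Subring.coe_add, Subring.coe_pow, Subring.coe_mul,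
      Subring.coe_mul] at h1
    have h3 := PadicComplex.isNonarchimedean p (((x : ball p) : ℂ_[p]) ^ q)
      ((algebraMap R (ball p) ϖ : ℂ_[p]) * (((x : ball p) : ℂ_[p]) * (v : ℂ_[p])))
    have hpos : 0 < q ^ k := pow_pos (by omega) k
    rcases le_max_iff.mp h3 with h4 | h4
    · rw [pow_succ', pow_mul, ← norm_pow]
      exact h1.trans (pow_le_pow_left₀ (norm_nonneg _) h4 _)
    · rw [norm_mul, norm_mul, norm_eq_one_of_norm_sub_one_lt hv, mul_one] at h4
      have hϖx : ‖(algebraMap R (ball p) ϖ : ℂ_[p])‖ * ‖((x : ball p) : ℂ_[p])‖ < 1 :=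
        mul_lt_one_of_nonneg_of_lt_one_left (norm_nonneg _) hϖ1 x.norm_lt.le
      have h5 := (h1.trans (pow_le_pow_left₀ (norm_nonneg _) h4 _)).trans
        (pow_le_of_le_one (by positivity) hϖx.le hpos.ne')
      -- Now |ϖ| ≤ |ϖ| |x| with |x| < 1. The map to the ball is not assumed injective, so |ϖ| = 0 is
      -- no contradiction, but it makes the claim trivial.
      have h6 : ‖(algebraMap R (ball p) ϖ : ℂ_[p])‖ = 0 := by
        by_contra h7
        have := lt_of_le_of_ne (norm_nonneg _) (Ne.symm h7)
        have := mul_lt_of_lt_one_right this x.norm_lt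
        linarith
      rw [h6]
      positivity

end Points

/-! ### Cyclicity of the torsion of a given level. -/

section Residue

variable {p : ℕ} [Fact p.Prime] {R : Type*} [CommRing R] [IsDomain R] [Algebra R (ball p)]
  {ϖ : R} {f : PowerSeries R} (hϖ : IsUniformizer ϖ) (hf : IsLubinTateSeries ϖ f)
  (hϖ1 : ‖(algebraMap R (ball p) ϖ : ℂ_[p])‖ < 1)

local notation "q" => Nat.card (R ⧸ Ideal.span (Singleton.singleton ϖ : Set R))

instance : (ballIdeal p 1 one_pos).IsPrime where
  ne_top' := by
    rw [Ne, Ideal.eq_top_iff_one, mem_ballIdeal, Subring.coe_one, norm_one]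
    exact lt_irrefl _
  mem_or_mem' := fun {x y} h => by
    simp only [mem_ballIdeal, Subring.coe_mul, norm_mul] at h ⊢
    by_contra! h1
    exact absurd h (not_lt.mpr (one_le_mul_of_one_le_of_one_le h1.1 h1.2))

include hϖ hf hϖ1 in
omit [IsDomain R] in
/-- The elements of the residue field of `ℂ_p` fixed by the Frobenius come from `R`. -/
lemma exists_norm_sub_lt_one {x : ball p} (hx : ‖((x ^ q - x : ball p) : ℂ_[p])‖ < 1) :
    ∃ c : R, ‖((x - algebraMap R (ball p) c : ball p) : ℂ_[p])‖ < 1 := by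
  have hmax := span_isMaximal hϖ
  let _ : Field (R ⧸ Ideal.span {ϖ}) := Ideal.Quotient.field _
  have hq := one_lt_card hϖ hf
  have : Finite (R ⧸ Ideal.span {ϖ}) := Nat.finite_of_card_ne_zero (by omega)
  let _ : Fintype (R ⧸ Ideal.span {ϖ}) := Fintype.ofFinite _
  let π := Ideal.Quotient.mk (ballIdeal p 1 one_pos)
  let j : R ⧸ Ideal.span {ϖ} →+* ball p ⧸ ballIdeal p 1 one_pos :=
    Ideal.Quotient.lift _ (π.comp (algebraMap R (ball p))) (by
      intro a ha
      obtain ⟨b, rfl⟩ := Ideal.mem_span_singleton.mp ha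
      rw [map_mul, RingHom.comp_apply, Ideal.Quotient.eq_zero_iff_mem.mpr, zero_mul]
      exact hϖ1)
  -- This polynomial already splits over R / ϖ, so its roots in the residue ring of the ball come
  -- from R / ϖ.
  let P : Polynomial (R ⧸ Ideal.span {ϖ}) := Polynomial.X ^ q - Polynomial.X
  have hP : P.Monic := Polynomial.monic_X_pow_sub (by
    rw [Polynomial.degree_X]; exact_mod_cast hq)
  have hroots : P.roots = Finset.univ.val := by
    have := FiniteField.roots_X_pow_card_sub_X (R ⧸ Ideal.span {ϖ})
    rwa [← Nat.card_eq_fintype_card] at this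
  have hsplit := Polynomial.prod_multiset_X_sub_C_of_monic_of_roots_card_eq hP (by
    rw [hroots, FiniteField.X_pow_card_sub_X_natDegree_eq _ hq, Nat.card_eq_fintype_card]
    rfl)
  rw [hroots] at hsplit
  have h1 : Polynomial.eval₂ j (π x) P = 0 := by
    simp only [P, Polynomial.eval₂_sub, Polynomial.eval₂_pow, Polynomial.eval₂_X]
    rw [← map_pow, ← map_sub, Ideal.Quotient.eq_zero_iff_mem]
    exact hx
  have h2 : ∏ a : R ⧸ Ideal.span {ϖ}, (π x - j a) = 0 := by
    rw [← h1, ← hsplit]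
    change _ = Polynomial.eval₂ j (π x) (∏ a : R ⧸ Ideal.span {ϖ},
      (Polynomial.X - Polynomial.C a))
    rw [Polynomial.eval₂_finsetProd]
    simp
  obtain ⟨a, -, ha⟩ := Finset.prod_eq_zero_iff.mp h2
  obtain ⟨c, rfl⟩ := Ideal.Quotient.mk_surjective a
  refine ⟨c, ?_⟩
  rw [← mem_ballIdeal one_pos, ← Ideal.Quotient.eq_zero_iff_mem, map_sub]
  exact ha

/-- To first order the formal group law is addition; the remaining terms have degree at least two.
-/
lemma norm_lin_sub_le {σ : Type*} [Fintype σ] (a : σ → R) (z : σ → Disc p) {r : ℝ} (hr1 : r ≤ 1)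
    (hr0 : 0 ≤ r) (hz : ∀ i, ‖((z i : ball p) : ℂ_[p])‖ ≤ r) :
    ‖(((lin hϖ hf a z : ball p) - ∑ i, algebraMap R (ball p) (a i) * z i : ball p) : ℂ_[p])‖ ≤
      r ^ 2 := by
  classical
  have h1 : (lin hϖ hf a z : ball p) - ∑ i, algebraMap R (ball p) (a i) * z i =
      evalAt z (equivariantSeries hϖ hf a - ∑ i, C (a i) * X i) := by
    simp only [map_sub, map_sum, map_mul, evalAt_C, evalAt_X]
    rfl
  rw [h1]
  refine norm_evalAt_le z _ (by positivity) fun d hd => ?_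
  refine (norm_finsuppProd_le hz d).trans (pow_le_pow_of_le_one hr0 hr1 ?_)
  by_contra! h2
  apply hd
  have hcoeff : ∀ d : σ →₀ ℕ, coeff d (∑ i, C (a i) * X i : MvPowerSeries σ R) =
      ∑ i, if d = Finsupp.single i 1 then a i else 0 := by
    intro d
    simp [coeff_C_mul, coeff_X]
  have heq := isEquivariant_equivariantSeries hϖ hf a
  rw [map_sub, hcoeff]
  interval_cases h3 : d.degree
  · rw [(Finsupp.degree_eq_zero_iff d).mp h3, coeff_zero_eq_constantCoeff_apply,
      heq.constantCoeff_eq, Finset.sum_eq_zero, sub_zero]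
    intro i _
    rw [if_neg]
    exact (Finsupp.single_ne_zero.mpr one_ne_zero).symm
  · obtain ⟨i, rfl⟩ := exists_eq_single_of_degree_eq_one h3
    rw [heq.coeff_single_eq, Finset.sum_eq_single i, if_pos rfl, sub_self]
    · intro j _ hj
      rw [if_neg]
      exact fun h => hj (Finsupp.single_left_injective one_ne_zero h).symm
    · simp

/-- In module notation, (η - cω) + cω = η. -/
lemma lin_lin_sub (c : R) (η ω : Disc p) :
    lin hϖ hf ![1, c] ![lin hϖ hf ![1, -c] ![η, ω], ω] = η := by
  have h1 : (![lin hϖ hf ![1, -c] ![η, ω], ω] : Fin 2 → Disc p) = fun i =>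
      lin hϖ hf ((![![1, -c], ![0, 1]] : Fin 2 → Fin 2 → R) i) ![η, ω] := by
    funext i
    fin_cases i
    · rfl
    · change ω = lin hϖ hf ![0, 1] _
      have : (![0, 1] : Fin 2 → R) = Pi.single 1 1 := by
        ext i; fin_cases i <;> rfl
      rw [this, lin_single]
      rfl
  rw [h1, lin_lin]
  have h2 : (fun j => ∑ i, (![1, c] : Fin 2 → R) i * (![![1, -c], ![0, 1]] : Fin 2 → Fin 2 → R) i j)
      = Pi.single 0 1 := by
    ext i; fin_cases i <;> simp [Fin.sum_univ_two]
  rw [h2, lin_single]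
  rfl

lemma lin_pair_scale (a b c d : R) (ω : Disc p) :
    lin hϖ hf ![a, b] ![scale hϖ hf c ω, scale hϖ hf d ω] = scale hϖ hf (a * c + b * d) ω := by
  have := lin_scale_const hϖ hf ![a, b] ![c, d] ω
  rw [Fin.sum_univ_two] at this
  refine Eq.trans ?_ this
  congr 1
  funext i
  fin_cases i <;> rfl

lemma scale_lin_pair (a b c : R) (η ω : Disc p) : scale hϖ hf c (lin hϖ hf ![a, b] ![η, ω]) =
    lin hϖ hf ![a, b] ![scale hϖ hf c η, scale hϖ hf c ω] := by
  rw [← scale_lin_comm]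
  congr 1
  funext i
  fin_cases i <;> rfl

-- η / ω is a unit whose residue is fixed by the q-th power map, hence is congruent to some c in R.
-- Then η - [c](ω) is smaller than ω and killed by ϖ. Non-zero such points have the norm of ω, so it
-- is zero.
include hϖ1 in
lemma exists_eq_scale_of_scale_uniformizer {ω η : Disc p} (hω : ω ≠ 0)
    (hω1 : scale hϖ hf ϖ ω = 0) (hη1 : scale hϖ hf ϖ η = 0) : ∃ a, η = scale hϖ hf a ω := by
  by_cases hη : η = 0
  · exact ⟨0, by rw [hη, scale_zero]⟩
  have hq := one_lt_card hϖ hf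
  have hω0 : ((ω : ball p) : ℂ_[p]) ≠ 0 := fun h => hω (Disc.ext (Subtype.ext h))
  have hω0' : 0 < ‖((ω : ball p) : ℂ_[p])‖ := norm_pos_iff.mpr hω0
  have hnorm : ∀ x : Disc p, x ≠ 0 → scale hϖ hf ϖ x = 0 →
      ‖((x : ball p) : ℂ_[p])‖ = ‖((ω : ball p) : ℂ_[p])‖ := by
    intro x hx hx1
    refine (pow_left_inj₀ (norm_nonneg _) (norm_nonneg _) (n := q - 1) (by omega)).mp ?_
    rw [norm_pow_eq_of_scale_eq_zero hϖ hf hx hx1, norm_pow_eq_of_scale_eq_zero hϖ hf hω hω1]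
  obtain ⟨v, hv, hv'⟩ := exists_pow_card_sub_one_eq hϖ hf hω hω1
  obtain ⟨w, hw, hw'⟩ := exists_pow_card_sub_one_eq hϖ hf hη hη1
  have hx1 : ‖((η : ball p) : ℂ_[p]) / ((ω : ball p) : ℂ_[p])‖ = 1 := by
    rw [norm_div, hnorm η hη hη1, div_self hω0'.ne']
  let x : ball p := ⟨((η : ball p) : ℂ_[p]) / ((ω : ball p) : ℂ_[p]), hx1.le⟩
  have hxω : x * (ω : ball p) = η := Subtype.ext (div_mul_cancel₀ _ hω0)
  have hϖ0 : algebraMap R (ball p) ϖ ≠ 0 := by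
    intro h0
    rw [h0, zero_mul, neg_zero] at hv'
    exact hω (Disc.ext (pow_eq_zero_iff (by omega) |>.mp hv'))
  have hpow : x ^ (q - 1) * v = w := by
    rw [← hxω, mul_pow, hv'] at hw'
    apply mul_left_cancel₀ hϖ0
    linear_combination -hw'
  have hxq : ‖((x ^ q - x : ball p) : ℂ_[p])‖ < 1 := by
    have h1 : (x ^ q - x) * v = x * (w - v) := by
      rw [← hpow]
      conv_lhs => rw [← Nat.sub_add_cancel hq.le]
      ring
    have h2 := congrArg (fun y : ball p => ‖(y : ℂ_[p])‖) h1
    simp only [Subring.coe_mul, norm_mul, norm_eq_one_of_norm_sub_one_lt hv, mul_one] at h2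
    rw [h2, AddSubgroupClass.coe_sub]
    refine lt_of_le_of_lt (mul_le_of_le_one_left (norm_nonneg _) x.2) ?_
    rw [← sub_sub_sub_cancel_right _ _ (1 : ℂ_[p])]
    exact norm_sub_lt_of_lt hw hv
  obtain ⟨c, hc⟩ := exists_norm_sub_lt_one hϖ hf hϖ1 hxq
  have hδ1 : scale hϖ hf ϖ (lin hϖ hf ![1, -c] ![η, ω]) = 0 := by
    rw [scale_lin_pair, hη1, hω1, ← scale_zero hϖ hf ω, lin_pair_scale]
    simp [scale_zero]
  have hδ : lin hϖ hf ![1, -c] ![η, ω] = 0 := by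
    by_contra h0
    have h1 := norm_lin_sub_le hϖ hf ![1, -c] ![η, ω] ω.norm_lt.le (norm_nonneg _) (by
      intro i
      fin_cases i
      · exact (hnorm η hη hη1).le
      · exact le_rfl)
    have h2 : ‖((∑ i, algebraMap R (ball p) ((![1, -c] : Fin 2 → R) i) *
        ((![η, ω] : Fin 2 → Disc p) i : ball p) : ball p) : ℂ_[p])‖ <
        ‖((ω : ball p) : ℂ_[p])‖ := by
      have : ∑ i, algebraMap R (ball p) ((![1, -c] : Fin 2 → R) i) *
        ((![η, ω] : Fin 2 → Disc p) i : ball p) = (x - algebraMap R (ball p) c) * ω := by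
        simp only [Fin.sum_univ_two, Matrix.cons_val_zero, Matrix.cons_val_one, map_one, map_neg]
        rw [sub_mul, hxω]
        ring
      rw [this, Subring.coe_mul, norm_mul]
      exact mul_lt_of_lt_one_left hω0' hc
    have h3 := norm_add_lt_of_lt (h1.trans_lt (pow_lt_self_of_lt_one₀ hω0' ω.norm_lt one_lt_two)) h2
    rw [AddSubgroupClass.coe_sub, sub_add_cancel, hnorm _ h0 hδ1] at h3
    exact lt_irrefl _ h3
  refine ⟨c, ?_⟩
  have h := lin_lin_sub hϖ hf c η ω
  rw [hδ] at h
  have h2 := lin_pair_scale hϖ hf 1 c 0 1 ω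
  rw [scale_zero, scale_one, h] at h2
  rw [h2]
  simp

include hϖ1 in
/-- The points killed by `ϖ ^ (k + 1)` form a cyclic module. -/
theorem exists_eq_scale {k : ℕ} {ω η : Disc p} (hω : scale hϖ hf (ϖ ^ k) ω ≠ 0)
    (hω1 : scale hϖ hf (ϖ ^ (k + 1)) ω = 0) (hη : scale hϖ hf (ϖ ^ (k + 1)) η = 0) :
    ∃ a, η = scale hϖ hf a ω := by
  -- If [ϖ](η) = [aϖ](ω), then η - [a](ω) is killed by ϖ, hence is a multiple of [ϖ^(k+1)](ω) by the
  -- case of level one.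
  induction k generalizing ω η with
  | zero =>
    rw [pow_zero, scale_one] at hω
    rw [zero_add, pow_one] at hω1 hη
    exact exists_eq_scale_of_scale_uniformizer hϖ hf hϖ1 hω hω1 hη
  | succ k ih =>
    obtain ⟨a, ha⟩ := ih (ω := scale hϖ hf ϖ ω) (η := scale hϖ hf ϖ η)
      (by rwa [scale_scale, ← pow_succ]) (by rwa [scale_scale, ← pow_succ])
      (by rwa [scale_scale, ← pow_succ])
    have hδ : scale hϖ hf ϖ (lin hϖ hf ![1, -a] ![η, ω]) = 0 := by
      have h1 := lin_pair_scale hϖ hf 1 (-a) a 1 (scale hϖ hf ϖ ω)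
      rw [scale_lin_pair, ha]
      rw [scale_one] at h1
      rw [h1]
      simp [scale_zero]
    obtain ⟨b, hb⟩ := exists_eq_scale_of_scale_uniformizer hϖ hf hϖ1 hω
      (by rwa [scale_scale, ← pow_succ']) hδ
    refine ⟨b * ϖ ^ (k + 1) + a, ?_⟩
    have h := lin_lin_sub hϖ hf a η ω
    have h2 := lin_pair_scale hϖ hf 1 a (b * ϖ ^ (k + 1)) 1 ω
    rw [scale_one, ← scale_scale, ← hb, h] at h2
    rw [h2]
    simp

end Residue

/-! ### Adic completeness from compactness. -/

section Complete

variable {R : Type*} [CommRing R] {ϖ : R}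

lemma IsUniformizer.isLocalRing (hϖ : IsUniformizer ϖ) : IsLocalRing R := by
  have : Nontrivial R := ⟨⟨ϖ, 0, hϖ.ne_zero⟩⟩
  refine IsLocalRing.of_nonunits_add fun a b ha hb => ?_
  rw [mem_nonunits_iff, hϖ.isUnit_iff, not_not] at ha hb ⊢
  exact dvd_add ha hb

lemma IsUniformizer.maximalIdeal_eq [IsLocalRing R] (hϖ : IsUniformizer ϖ) :
    IsLocalRing.maximalIdeal R = Ideal.span {ϖ} := by
  ext x
  rw [IsLocalRing.mem_maximalIdeal, mem_nonunits_iff, hϖ.isUnit_iff, not_not,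
    Ideal.mem_span_singleton]

/-- The congruences x ≡ g N modulo ϖ^N cut out nested non-empty closed sets of a compact space; a
common point is the limit. -/
lemma isAdicComplete_span [TopologicalSpace R] [IsTopologicalRing R] [CompactSpace R]
    (hopen : ∀ N : ℕ, IsOpen {x : R | ϖ ^ N ∣ x}) (hsep : ∀ x : R, (∀ N : ℕ, ϖ ^ N ∣ x) → x = 0) :
    IsAdicComplete (Ideal.span {ϖ}) R where
  haus' x hx := by
    apply hsep
    intro N
    have := hx N
    rwa [SModEq.zero, smul_eq_mul, Ideal.mul_top, Ideal.span_singleton_pow,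
      Ideal.mem_span_singleton] at this
  prec' g hg := by
    simp only [SModEq.sub_mem, smul_eq_mul, Ideal.mul_top, Ideal.span_singleton_pow,
      Ideal.mem_span_singleton] at hg ⊢
    have hclosed : ∀ N, IsClosed {x : R | ϖ ^ N ∣ x - g N} := by
      intro N
      have h1 : IsClosed {x : R | ϖ ^ N ∣ x} := by
        have h2 : {x : R | ϖ ^ N ∣ x} = ((Ideal.span {ϖ ^ N}).toAddSubgroup : Set R) := by
          ext x
          exact Ideal.mem_span_singleton.symm
        have h3 := hopen N
        rw [h2] at h3 ⊢
        exact AddSubgroup.isClosed_of_isOpen _ h3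
      exact h1.preimage (continuous_id.sub continuous_const)
    obtain ⟨L, hL⟩ := IsCompact.nonempty_iInter_of_sequence_nonempty_isCompact_isClosed
      (fun N => {x : R | ϖ ^ N ∣ x - g N}) (fun N x hx => by
        have h1 : ϖ ^ N ∣ x - g (N + 1) := (pow_dvd_pow ϖ N.le_succ).trans hx
        have h2 := dvd_sub h1 (hg N.le_succ)
        have h3 : x - g (N + 1) - (g N - g (N + 1)) = x - g N := by ring
        rwa [h3] at h2)
      (fun N => ⟨g N, by simp⟩) (hclosed 0).isCompact hclosed
    refine ⟨L, fun N => ?_⟩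
    rw [← neg_sub, dvd_neg]
    exact Set.mem_iInter.mp hL N

end Complete

/-! ### Existence, integrality and finiteness of torsion points by Weierstrass preparation. -/

section Weierstrass

variable {p : ℕ} [Fact p.Prime] {R : Type*} [CommRing R] [IsDomain R] [Algebra R (ball p)]
  {ϖ : R} {f : PowerSeries R} (hϖ : IsUniformizer ϖ) (hf : IsLubinTateSeries ϖ f)
  (hϖ1 : ‖(algebraMap R (ball p) ϖ : ℂ_[p])‖ < 1)
  [TopologicalSpace R] [IsTopologicalRing R] [CompactSpace R]
  (hopen : ∀ N : ℕ, IsOpen {x : R | ϖ ^ N ∣ x}) (hsep : ∀ x : R, (∀ N : ℕ, ϖ ^ N ∣ x) → x = 0)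

local notation "q" => Nat.card (R ⧸ Ideal.span (Singleton.singleton ϖ : Set R))

include hϖ hopen hsep in
omit [IsDomain R] in
/-- The zeros of a power series congruent to `X ^ m` are those of a distinguished polynomial of
degree `m`. -/
lemma exists_polynomial_of_map_eq_X_pow {g : PowerSeries R} {m : ℕ}
    (hg : PowerSeries.map (Ideal.Quotient.mk (Ideal.span {ϖ})) g = PowerSeries.X ^ m) :
    ∃ P : Polynomial R, P.Monic ∧ P.natDegree = m ∧ (∀ i < m, ϖ ∣ P.coeff i) ∧
      ∀ x : Disc p, evalOne x g = 0 ↔ Polynomial.aeval (x : ball p) P = 0 := by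
  have := hϖ.isLocalRing
  have hmax := hϖ.maximalIdeal_eq
  have h1 := isAdicComplete_span hopen hsep
  rw [← hmax] at h1 hg
  have hne : PowerSeries.map (IsLocalRing.residue R) g ≠ 0 := by
    change PowerSeries.map (Ideal.Quotient.mk _) g ≠ 0
    rw [hg]
    exact pow_ne_zero _ PowerSeries.X_ne_zero
  -- The unit factor takes unit values, so it has no zeros.
  obtain ⟨P, u, hP⟩ := PowerSeries.exists_isWeierstrassFactorization hne
  have hdeg : P.natDegree = m := by
    rw [hP.natDegree_eq_toNat_order_map]
    have : PowerSeries.map (IsLocalRing.residue R) g = PowerSeries.X ^ m := hg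
    rw [this, PowerSeries.order_X_pow]
    rfl
  refine ⟨P, hP.isDistinguishedAt.monic, hdeg, fun i hi => ?_, fun x => ?_⟩
  · rw [← Ideal.mem_span_singleton, ← hmax]
    exact hP.isDistinguishedAt.mem (hdeg ▸ hi)
  · conv_lhs => rw [hP.eq_mul, map_mul, evalOne_polynomial]
    rw [(hP.isUnit.map (evalOne x)).mul_left_eq_zero]

-- At a root of norm at least 1 the leading term would exceed all the others, whose coefficients are
-- divisible by ϖ.
include hϖ1 in
omit [TopologicalSpace R] [IsTopologicalRing R] [CompactSpace R] in
lemma exists_disc_root {P : Polynomial R} (hP : P.Monic) (hdeg : P.natDegree ≠ 0)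
    (hdvd : ∀ i < P.natDegree, ϖ ∣ P.coeff i) :
    ∃ x : Disc p, Polynomial.aeval (x : ball p) P = 0 := by
  let j : R →+* ℂ_[p] := (ball p).subtype.comp (algebraMap R (ball p))
  have hdeg' : (P.map j).degree ≠ 0 := by
    rw [hP.degree_map, Polynomial.degree_eq_natDegree hP.ne_zero]
    exact_mod_cast hdeg
  obtain ⟨x, hx⟩ := IsAlgClosed.exists_root (P.map j) hdeg'
  rw [Polynomial.IsRoot.def, Polynomial.eval_map] at hx
  have hx1 : ‖x‖ < 1 := by
    by_contra! h1
    have h2 := hx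
    rw [hP.as_sum, Polynomial.eval₂_add, Polynomial.eval₂_X_pow, Polynomial.eval₂_finsetSum] at h2
    have h3 := eq_neg_of_add_eq_zero_left h2
    have hj1 : ‖j ϖ‖ < 1 := hϖ1
    have h4 : ‖x ^ P.natDegree‖ ≤ ‖j ϖ‖ * ‖x‖ ^ P.natDegree := by
      rw [h3, norm_neg]
      refine norm_sum_le_of_le _ (by positivity) fun i hi => ?_
      obtain ⟨c, hc⟩ := hdvd i (Finset.mem_range.mp hi)
      rw [Polynomial.eval₂_mul, Polynomial.eval₂_C, Polynomial.eval₂_X_pow, hc, map_mul,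
        norm_mul, norm_mul, norm_pow]
      have h5 : ‖j c‖ ≤ 1 := norm_coe_ball_le _
      have h6 : ‖x‖ ^ i ≤ ‖x‖ ^ P.natDegree :=
        pow_le_pow_right₀ h1 (Finset.mem_range.mp hi).le
      exact mul_le_mul (mul_le_of_le_one_right (norm_nonneg _) h5) h6 (by positivity)
        (norm_nonneg _)
    rw [norm_pow] at h4
    have h5 : 0 < ‖x‖ ^ P.natDegree := by positivity
    have h6 := mul_lt_of_lt_one_left h5 hj1
    linarith
  refine ⟨⟨⟨x, hx1.le⟩, hx1⟩, ?_⟩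
  apply Subtype.ext
  rw [Polynomial.aeval_def, ← Subring.subtype_apply, Polynomial.hom_eval₂]
  exact hx

include hf in
omit [Algebra R (ball p)] [TopologicalSpace R] [IsTopologicalRing R] [CompactSpace R] in
lemma map_mk_scalarSeries_pow (N : ℕ) : PowerSeries.map (Ideal.Quotient.mk (Ideal.span {ϖ}))
    (scalarSeries hϖ hf (ϖ ^ N)) = PowerSeries.X ^ q ^ N := by
  exact map_scalarSeries_pow hϖ hf
    (Ideal.Quotient.eq_zero_iff_mem.mpr (Ideal.mem_span_singleton_self ϖ)) N

include hϖ1 hopen hsep in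
/-- There are points of exact order `ϖ ^ (k + 1)`. -/
theorem exists_scale_eq_zero (hinj : algebraMap R (ball p) ϖ ≠ 0) (k : ℕ) :
    ∃ x : Disc p, scale hϖ hf (ϖ ^ k) x ≠ 0 ∧ scale hϖ hf (ϖ ^ (k + 1)) x = 0 := by
  have hq := one_lt_card hϖ hf
  have hmax := span_isMaximal hϖ
  let _ : Field (R ⧸ Ideal.span {ϖ}) := Ideal.Quotient.field _
  -- With f = X g, a zero of g ∘ [ϖ^k] is killed by ϖ^(k+1), but not by ϖ^k because g(0) = ϖ. This
  -- composite reduces to X^(q^k (q - 1)), so it has zeros in the disc.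
  obtain ⟨g, hg⟩ := PowerSeries.X_dvd_iff.mpr hf.constantCoeff_eq
  have hg0 : PowerSeries.constantCoeff g = ϖ := by
    rw [← hf.coeff_one_eq, hg, ← zero_add 1, PowerSeries.coeff_succ_X_mul]
    simp
  have hgmap : PowerSeries.map (Ideal.Quotient.mk (Ideal.span {ϖ})) g = PowerSeries.X ^ (q - 1) := by
    have h1 := hf.map_eq
    rw [hg, map_mul, PowerSeries.map_X, ← Nat.sub_add_cancel hq.le, pow_succ'] at h1
    exact mul_left_cancel₀ PowerSeries.X_ne_zero h1
  have hc := constantCoeff_scalarSeries hϖ hf (ϖ ^ k)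
  have hs : PowerSeries.HasSubst (scalarSeries hϖ hf (ϖ ^ k)) := .of_constantCoeff_zero hc
  have hX : PowerSeries.HasSubst (PowerSeries.X ^ q ^ k : PowerSeries (R ⧸ Ideal.span {ϖ})) :=
    PowerSeries.HasSubst.X_pow (pow_pos (by omega) k).ne'
  obtain ⟨P, hP, hdeg, hdvd, hroot⟩ := exists_polynomial_of_map_eq_X_pow (p := p) hϖ hopen hsep
    (g := g.subst (scalarSeries hϖ hf (ϖ ^ k))) (m := q ^ k * (q - 1)) (by
      refine (PowerSeries.map_subst hs g).trans ?_
      rw [hgmap]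
      refine (congrArg (fun y => PowerSeries.subst y _)
        (map_mk_scalarSeries_pow hϖ hf k)).trans ?_
      rw [PowerSeries.subst_pow hX, PowerSeries.subst_X hX, ← pow_mul])
  obtain ⟨x, hx⟩ := exists_disc_root hϖ1 hP (by
    rw [hdeg]
    exact (Nat.mul_pos (pow_pos (by omega) k) (by omega)).ne') (hdeg ▸ hdvd)
  have hx' : evalOne (scale hϖ hf (ϖ ^ k) x) g = 0 := by
    rw [← (hroot x).mpr hx]
    exact (evalAt_subst (fun _ => x) (fun _ : Unit => hc) g).symm
  refine ⟨x, fun h0 => ?_, ?_⟩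
  · rw [h0, evalOne, evalAt_zero] at hx'
    exact hinj (by rw [← hx', ← hg0]; rfl)
  · rw [pow_succ', ← scale_scale]
    ext1
    rw [coe_scale_uniformizer]
    refine (congrArg (evalOne _) hg).trans ?_
    rw [map_mul, hx', mul_zero, Disc.coe_zero]

include hopen hsep in
/-- Torsion points are integral over `R`. -/
lemma exists_monic_of_scale_eq_zero (k : ℕ) : ∃ P : Polynomial R, P.Monic ∧
    ∀ x : Disc p, scale hϖ hf (ϖ ^ k) x = 0 → Polynomial.aeval (x : ball p) P = 0 := by
  obtain ⟨P, hP, -, -, hroot⟩ := exists_polynomial_of_map_eq_X_pow (p := p) hϖ hopen hsep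
    (map_mk_scalarSeries_pow hϖ hf k)
  refine ⟨P, hP, fun x hx => (hroot x).mp ?_⟩
  rw [← coe_scale, hx, Disc.coe_zero]

include hopen hsep in
lemma finite_setOf_scale_eq_zero (k : ℕ) :
    {x : Disc p | scale hϖ hf (ϖ ^ k) x = 0}.Finite := by
  obtain ⟨P, hP, h⟩ := exists_monic_of_scale_eq_zero (p := p) hϖ hf hopen hsep k
  have hfin : {y : ball p | Polynomial.aeval y P = 0}.Finite := by
    have h1 := Polynomial.finite_setOfPred_isRoot (hP.map (algebraMap R (ball p))).ne_zero
    refine h1.subset fun y hy => ?_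
    rwa [Set.mem_ofPred_eq, Polynomial.IsRoot.def, Polynomial.eval_map_algebraMap]
  exact (hfin.preimage (f := Disc.val) fun x _ y _ hxy => Disc.ext hxy).subset fun x hx => h x hx

end Weierstrass

/-! ### Rings of integers of finite extensions and zeros of series over them. -/

section Integers

variable {p : ℕ} [Fact p.Prime]

/-- The inclusion of `𝒪_K` into the closed unit ball of `ℂ_p`. -/
instance (K : IntermediateField ℚ_[p] (PadicAlgCl p)) : Algebra (integers K) (ball p) :=
  RingHom.toAlgebra
    (((algebraMap (PadicAlgCl p) ℂ_[p]).comp (integers K).subtype).codRestrict (ball p) fun x => by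
      change ‖((x : PadicAlgCl p) : ℂ_[p])‖ ≤ 1
      rw [PadicComplex.norm_extends]
      exact x.2.2)

variable {K : IntermediateField ℚ_[p] (PadicAlgCl p)}

lemma coe_algebraMap (x : integers K) :
    ((algebraMap (integers K) (ball p) x : ball p) : ℂ_[p]) = ((x : PadicAlgCl p) : ℂ_[p]) := rfl

@[simp] lemma norm_algebraMap (x : integers K) :
    ‖((algebraMap (integers K) (ball p) x : ball p) : ℂ_[p])‖ = ‖(x : PadicAlgCl p)‖ := by
  rw [coe_algebraMap, PadicComplex.norm_extends]

lemma algebraMap_integers_injective :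
    Function.Injective (algebraMap (integers K) (ball p)) := by
  intro x y h
  exact Subtype.ext ((algebraMap (PadicAlgCl p) ℂ_[p]).injective (congrArg Subtype.val h))

lemma algebraMap_inclusion {E : IntermediateField ℚ_[p] (PadicAlgCl p)} (h : E ≤ K)
    (x : integers E) : algebraMap (integers K) (ball p)
      (Subring.inclusion (integers_mono h) x) = algebraMap (integers E) (ball p) x := rfl

lemma integers_norm_le (x : integers K) : ‖(x : PadicAlgCl p)‖ ≤ 1 := x.2.2

lemma integers_dvd_iff {x y : integers K} (hx : x ≠ 0) :
    x ∣ y ↔ ‖(y : PadicAlgCl p)‖ ≤ ‖(x : PadicAlgCl p)‖ := by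
  have hx0 : (x : PadicAlgCl p) ≠ 0 := fun h => hx (Subtype.ext h)
  constructor
  · rintro ⟨c, rfl⟩
    rw [Subring.coe_mul, norm_mul]
    exact mul_le_of_le_one_right (norm_nonneg _) c.2.2
  · intro h
    refine ⟨⟨(y : PadicAlgCl p) / x, div_mem y.2.1 x.2.1, ?_⟩, ?_⟩
    · rw [norm_div]
      exact div_le_one_of_le₀ h (norm_nonneg _)
    · exact Subtype.ext (mul_div_cancel₀ _ hx0).symm

lemma IsUniformizer.norm_lt_one {ϖ : integers K} (hϖ : IsUniformizer ϖ) :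
    ‖(ϖ : PadicAlgCl p)‖ < 1 := by
  by_contra! h
  have h1 : ϖ ∣ 1 := by
    rw [integers_dvd_iff hϖ.ne_zero, Subring.coe_one, norm_one]
    exact h
  exact (hϖ.isUnit_iff ϖ).mp (isUnit_of_dvd_one h1) dvd_rfl

lemma isOpen_dvd {ϖ : integers K} (hϖ : ϖ ≠ 0) (N : ℕ) : IsOpen {x : integers K | ϖ ^ N ∣ x} := by
  have h0 : ϖ ^ N ≠ 0 := pow_ne_zero _ hϖ
  have h1 : {x : integers K | ϖ ^ N ∣ x} =
      Subtype.val ⁻¹' Metric.closedBall (0 : PadicAlgCl p)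
        ‖((ϖ ^ N : integers K) : PadicAlgCl p)‖ := by
    ext x
    simp only [Set.mem_ofPred_eq, integers_dvd_iff h0, Set.mem_preimage, mem_closedBall_zero_iff]
  rw [h1]
  refine (IsUltrametricDist.isOpen_closedBall _ ?_).preimage continuous_subtype_val
  rw [norm_ne_zero_iff]
  exact fun h => h0 (Subtype.ext h)

lemma eq_zero_of_forall_pow_dvd {ϖ : integers K} (hϖ : IsUniformizer ϖ) {x : integers K}
    (h : ∀ N : ℕ, ϖ ^ N ∣ x) : x = 0 := by
  have h1 : ∀ N : ℕ, ‖(x : PadicAlgCl p)‖ ≤ ‖(ϖ : PadicAlgCl p)‖ ^ N := by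
    intro N
    have := (integers_dvd_iff (pow_ne_zero N hϖ.ne_zero)).mp (h N)
    rwa [Subring.coe_pow, norm_pow] at this
  have h2 := ge_of_tendsto' (tendsto_pow_atTop_nhds_zero_of_lt_one (norm_nonneg _)
    hϖ.norm_lt_one) h1
  exact Subtype.ext (norm_le_zero_iff.mp h2)

variable (K) in
/-- The maximal ideal of `𝒪_K`. -/
def maxIdeal : Ideal (integers K) where
  carrier := {x | ‖(x : PadicAlgCl p)‖ < 1}
  add_mem' := fun {x y} hx hy =>
    (PadicAlgCl.isNonarchimedean p (x : PadicAlgCl p) y).trans_lt (max_lt hx hy)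
  zero_mem' := by
    change ‖((0 : integers K) : PadicAlgCl p)‖ < 1
    rw [Subring.coe_zero, norm_zero]
    exact one_pos
  smul_mem' := fun c {x} hx => by
    change ‖((c * x : integers K) : PadicAlgCl p)‖ < 1
    rw [Subring.coe_mul, norm_mul]
    exact lt_of_le_of_lt (mul_le_of_le_one_left (norm_nonneg _) c.2.2) hx

lemma mem_maxIdeal {x : integers K} : x ∈ maxIdeal K ↔ ‖(x : PadicAlgCl p)‖ < 1 := Iff.rfl

instance : (maxIdeal K).IsMaximal := by
  rw [Ideal.isMaximal_iff]
  refine ⟨by rw [mem_maxIdeal, Subring.coe_one, norm_one]; exact lt_irrefl _, ?_⟩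
  intro J x _ hx hxJ
  have hx1 : ‖(x : PadicAlgCl p)‖ = 1 := le_antisymm x.2.2 (not_lt.mp hx)
  have hx0 : x ≠ 0 := by
    rintro rfl
    simp at hx1
  obtain ⟨y, hy⟩ := (integers_dvd_iff (y := 1) hx0).mpr (by
    rw [hx1, Subring.coe_one, norm_one])
  rw [hy]
  exact J.mul_mem_right y hxJ

variable (K) in
/-- The residue field of `𝒪_K`. -/
abbrev ResidueField : Type := integers K ⧸ maxIdeal K

instance : Field (ResidueField K) := Ideal.Quotient.field _

variable [FiniteDimensional ℚ_[p] K]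

instance : CompactSpace (integers K) := by
  refine (isCompact_iff_compactSpace (s := (integers K : Set (PadicAlgCl p)))).mp ?_
  let W : Submodule ℚ_[p] (PadicAlgCl p) := Subalgebra.toSubmodule K.toSubalgebra
  have : FiniteDimensional ℚ_[p] W := ‹FiniteDimensional ℚ_[p] K›
  have : ProperSpace W := FiniteDimensional.proper ℚ_[p] W
  have h1 := (isCompact_closedBall (0 : W) 1).image continuous_subtype_val
  convert h1 using 1
  ext x
  constructor
  · rintro ⟨hx, hx1⟩
    exact ⟨⟨x, hx⟩, by rw [mem_closedBall_zero_iff]; exact hx1, rfl⟩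
  · rintro ⟨y, hy, rfl⟩
    rw [mem_closedBall_zero_iff] at hy
    exact ⟨y.2, hy⟩

-- The norm attains its maximum on the compact maximal ideal. This takes the place of a uniformizer
-- of K.
variable (K) in
lemma exists_norm_gap : ∃ ρ : ℝ, 0 < ρ ∧ ρ < 1 ∧
    ∀ x : integers K, ‖(x : PadicAlgCl p)‖ < 1 → ‖(x : PadicAlgCl p)‖ ≤ ρ := by
  have hcl : IsClosed {x : integers K | ‖(x : PadicAlgCl p)‖ < 1} := by
    have h1 : {x : integers K | ‖(x : PadicAlgCl p)‖ < 1} =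
        Subtype.val ⁻¹' Metric.ball (0 : PadicAlgCl p) 1 := by
      ext x
      simp
    rw [h1]
    exact (IsUltrametricDist.isClosed_ball _ _).preimage continuous_subtype_val
  obtain ⟨y, hy, hmax⟩ := hcl.isCompact.exists_isMaxOn ⟨0, by simp⟩
    (continuous_norm.comp continuous_subtype_val).continuousOn
  -- The 1 / 2 only serves to make ρ positive.
  refine ⟨max ‖(y : PadicAlgCl p)‖ (1 / 2), by positivity, max_lt hy (by norm_num), fun x hx => ?_⟩
  exact le_max_of_le_left (hmax hx)

/-- Extraction of the content. A coefficient of norm above ρ times the supremum divides all the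
others: relative to a strictly larger one it would be smaller by a factor of at most ρ. -/
lemma exists_eq_C_mul {σ : Type*} {φ : MvPowerSeries σ (integers K)} (hφ : φ ≠ 0) :
    ∃ (c : integers K) (ψ : MvPowerSeries σ (integers K)), c ≠ 0 ∧ φ = C c * ψ ∧
      MvPowerSeries.map (Ideal.Quotient.mk (maxIdeal K)) ψ ≠ 0 := by
  obtain ⟨ρ, hρ0, hρ1, hρ⟩ := exists_norm_gap K
  let w : (σ →₀ ℕ) → ℝ := fun d => ‖((coeff d φ : integers K) : PadicAlgCl p)‖
  have hbdd : BddAbove (Set.range w) := ⟨1, by rintro _ ⟨d, rfl⟩; exact integers_norm_le _⟩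
  obtain ⟨d₀, hd₀⟩ := MvPowerSeries.ne_zero_iff_exists_coeff_ne_zero φ |>.mp hφ
  have hpos : 0 < sSup (Set.range w) := by
    refine lt_of_lt_of_le ?_ (le_csSup hbdd ⟨d₀, rfl⟩)
    exact norm_pos_iff.mpr fun h => hd₀ (Subtype.ext h)
  obtain ⟨_, ⟨d, rfl⟩, hd⟩ := exists_lt_of_lt_csSup (Set.range_nonempty w)
    (mul_lt_of_lt_one_left hpos hρ1)
  have hd0 : coeff d φ ≠ 0 := by
    intro h0
    have : w d = 0 := by simp [w, h0]
    rw [this] at hd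
    exact absurd hd (not_lt.mpr (by positivity))
  have hdvd : ∀ e, coeff d φ ∣ coeff e φ := by
    intro e
    rw [integers_dvd_iff hd0]
    by_contra! hlt
    have he0 : coeff e φ ≠ 0 := by
      intro h0
      rw [h0, Subring.coe_zero, norm_zero] at hlt
      exact absurd hlt (not_lt.mpr (norm_nonneg _))
    obtain ⟨x, hx⟩ := (integers_dvd_iff he0).mpr hlt.le
    have h1 := congrArg (fun y : integers K => ‖(y : PadicAlgCl p)‖) hx
    simp only [Subring.coe_mul, norm_mul] at h1
    have hepos := (norm_nonneg _).trans_lt hlt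
    have h2 : ‖(x : PadicAlgCl p)‖ < 1 := by
      by_contra! h3
      have := le_mul_of_one_le_right hepos.le h3
      linarith
    have h3 := mul_le_mul_of_nonneg_left (hρ x h2) hepos.le
    have h4 : w e ≤ sSup (Set.range w) := le_csSup hbdd ⟨e, rfl⟩
    have h5 := mul_le_mul_of_nonneg_left h4 hρ0.le
    simp only [w] at hd h5
    linarith
  obtain ⟨ψ, hψ⟩ : ∃ ψ : MvPowerSeries σ (integers K), ∀ e, coeff e φ = coeff d φ * coeff e ψ := by
    choose ψ hψ using hdvd
    exact ⟨ψ, hψ⟩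
  refine ⟨coeff d φ, ψ, hd0, ?_, ?_⟩
  · refine MvPowerSeries.ext fun e => ?_
    rw [coeff_C_mul, hψ]
  · intro h0
    have h1 := congrArg (coeff d) h0
    rw [coeff_map, map_zero, Ideal.Quotient.eq_zero_iff_mem] at h1
    have h2 : coeff d ψ = 1 := by
      refine mul_left_cancel₀ hd0 ?_
      rw [mul_one]
      exact (hψ d).symm
    rw [h2, mem_maxIdeal, Subring.coe_one, norm_one] at h1
    exact lt_irrefl _ h1

omit [FiniteDimensional ℚ_[p] K] in
/-- A zero of a power series over `𝒪_K` cannot be too large. -/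
lemma norm_pow_le_of_evalOne_eq_zero {ρ : ℝ} (hρ0 : 0 ≤ ρ)
    (hρ : ∀ x : integers K, ‖(x : PadicAlgCl p)‖ < 1 → ‖(x : PadicAlgCl p)‖ ≤ ρ)
    {g : PowerSeries (integers K)} {x : Disc p} (hx : evalOne x g = 0) {d : ℕ}
    (hd : PowerSeries.coeff d (PowerSeries.map (Ideal.Quotient.mk (maxIdeal K)) g) ≠ 0)
    (hlt : ∀ i < d, PowerSeries.coeff i (PowerSeries.map (Ideal.Quotient.mk (maxIdeal K)) g) = 0) :
    ‖((x : ball p) : ℂ_[p])‖ ^ d ≤ ρ := by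
  rw [PowerSeries.coeff_map, Ne, Ideal.Quotient.eq_zero_iff_mem, mem_maxIdeal, not_lt] at hd
  simp only [PowerSeries.coeff_map, Ideal.Quotient.eq_zero_iff_mem, mem_maxIdeal] at hlt
  -- g is X^d h plus terms of degree below d. As h(x) has norm 1, x^d has the norm of the value of
  -- the lower terms, whose coefficients have norm at most ρ.
  set h : PowerSeries (integers K) := PowerSeries.mk fun i => PowerSeries.coeff (i + d) g with hh
  have h1 : g = PowerSeries.X ^ d * h + (PowerSeries.trunc d g : PowerSeries (integers K)) :=
    PowerSeries.eq_X_pow_mul_shift_add_trunc d g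
  have hunit : ‖((evalOne x h : ball p) : ℂ_[p])‖ = 1 := by
    have h2 : h = (h - PowerSeries.C (PowerSeries.coeff d g)) +
      PowerSeries.C (PowerSeries.coeff d g) := by ring
    have h3 : ‖((evalOne x (h - PowerSeries.C (PowerSeries.coeff d g)) : ball p) : ℂ_[p])‖ < 1 :=
      norm_evalAt_lt_one _ (by
        change PowerSeries.constantCoeff _ = 0
        rw [map_sub, ← PowerSeries.coeff_zero_eq_constantCoeff_apply, hh, PowerSeries.coeff_mk]
        simp)
    have h4 : ‖((algebraMap (integers K) (ball p) (PowerSeries.coeff d g) : ball p) : ℂ_[p])‖ = 1 := by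
      rw [norm_algebraMap]
      exact le_antisymm (integers_norm_le _) hd
    rw [h2, map_add, evalOne_C, Subring.coe_add,
      IsUltrametricDist.norm_add_eq_max_of_norm_ne_norm (by rw [h4]; exact h3.ne), h4,
      max_eq_right h3.le]
  have h2 := hx
  rw [h1, map_add, map_mul, map_pow, evalOne_X, evalOne_polynomial] at h2
  have h3 := congrArg (fun y : ball p => ‖(y : ℂ_[p])‖) (eq_neg_of_add_eq_zero_left h2)
  simp only [Subring.coe_mul, Subring.coe_pow, norm_mul, norm_pow, hunit, mul_one,
    NegMemClass.coe_neg, norm_neg] at h3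
  rw [h3, Polynomial.aeval_eq_sum_range, AddSubmonoidClass.coe_finsetSum]
  refine norm_sum_le_of_le _ hρ0 fun i _ => ?_
  rw [Algebra.smul_def, Subring.coe_mul, Subring.coe_pow, norm_mul, norm_pow, norm_algebraMap]
  refine (mul_le_of_le_one_right (norm_nonneg _) (pow_le_one₀ (norm_nonneg _) x.norm_lt.le)).trans ?_
  rw [PowerSeries.coeff_trunc]
  split_ifs with hi
  · exact hρ _ (hlt i hi)
  · simpa using hρ0

end Integers

/-! ### Compatibility of restriction to curves with change of coefficients. -/

section MapAlong

variable {R : Type*} [CommRing R] [IsDomain R] {ϖ : R} {f : PowerSeries R}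
  (hϖ : IsUniformizer ϖ) (hf : IsLubinTateSeries ϖ f)

lemma map_linearSubst {S S' : Type*} [CommRing S] [CommRing S'] (ι : R →+* S) (π : S →+* S')
    {σ τ : Type*} [Finite σ] [Finite τ] (g : Matrix σ τ R) (φ : MvPowerSeries σ S) :
    MvPowerSeries.map π (linearSubst hϖ hf ι g φ) =
      linearSubst hϖ hf (π.comp ι) g (MvPowerSeries.map π φ) := by
  rw [linearSubst_apply, linearSubst_apply,
    map_subst (hasSubst_map_equivariantSeries hϖ hf ι g.row)]
  congr 1

lemma map_along {S S' : Type*} [CommRing S] [CommRing S'] (ι : R →+* S) (π : S →+* S')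
    {σ : Type*} [Finite σ] (a : σ → R) (φ : MvPowerSeries σ S) :
    PowerSeries.map π (along hϖ hf ι a φ) =
      along hϖ hf (π.comp ι) a (MvPowerSeries.map π φ) :=
  map_linearSubst hϖ hf ι π _ φ

end MapAlong

/-! ### Torsion zeros of a power series and density of torsion points. -/

section Zeros

variable {p : ℕ} [Fact p.Prime] {E : IntermediateField ℚ_[p] (PadicAlgCl p)}
  [FiniteDimensional ℚ_[p] E] {ϖ : integers E} {f : PowerSeries (integers E)}
  (hϖ : IsUniformizer ϖ) (hf : IsLubinTateSeries ϖ f)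

local notation "q" => Nat.card (integers E ⧸ Ideal.span (Singleton.singleton ϖ : Set (integers E)))

omit [FiniteDimensional ℚ_[p] E] in
lemma IsUniformizer.norm_algebraMap_lt_one (hϖ : IsUniformizer ϖ) :
    ‖((algebraMap (integers E) (ball p) ϖ : ball p) : ℂ_[p])‖ < 1 := by
  rw [norm_algebraMap]
  exact hϖ.norm_lt_one

omit [FiniteDimensional ℚ_[p] E] in
lemma IsUniformizer.algebraMap_ne_zero (hϖ : IsUniformizer ϖ) :
    algebraMap (integers E) (ball p) ϖ ≠ 0 := by
  rw [Ne, map_eq_zero_iff _ algebraMap_integers_injective]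
  exact hϖ.ne_zero

/-- The torsion points of the disc. -/
def IsTorsion (x : Disc p) : Prop := ∃ k : ℕ, scale hϖ hf (ϖ ^ k) x = 0

variable {hϖ hf}

omit [FiniteDimensional ℚ_[p] E] in
lemma scale_pow_eq_zero_of_le {x : Disc p} {k m : ℕ} (hkm : k ≤ m)
    (h : scale hϖ hf (ϖ ^ k) x = 0) : scale hϖ hf (ϖ ^ m) x = 0 := by
  obtain ⟨d, rfl⟩ := Nat.exists_eq_add_of_le' hkm
  rw [pow_add, ← scale_scale, h, scale_apply_zero]

omit [FiniteDimensional ℚ_[p] E] in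
lemma exists_forall_scale_eq_zero {σ : Type*} [Finite σ] {z : σ → Disc p}
    (hz : ∀ i, IsTorsion hϖ hf (z i)) : ∃ k : ℕ, ∀ i, scale hϖ hf (ϖ ^ k) (z i) = 0 := by
  cases nonempty_fintype σ
  choose k hk using hz
  exact ⟨Finset.univ.sup k, fun i =>
    scale_pow_eq_zero_of_le (Finset.le_sup (Finset.mem_univ i)) (hk i)⟩

omit [FiniteDimensional ℚ_[p] E] in
lemma IsTorsion.lin {σ : Type*} [Finite σ] {z : σ → Disc p} (hz : ∀ i, IsTorsion hϖ hf (z i))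
    (a : σ → integers E) : IsTorsion hϖ hf (lin hϖ hf a z) := by
  cases nonempty_fintype σ
  obtain ⟨k, hk⟩ := exists_forall_scale_eq_zero hz
  refine ⟨k, ?_⟩
  rw [← scale_lin_comm]
  simp only [hk]
  exact lin_apply_zero hϖ hf a

variable (hϖ hf)

/-- Torsion points are multiples of a single point of exact order a power of `ϖ`. -/
lemma exists_eq_scale_of_isTorsion {σ : Type*} [Finite σ] {z : σ → Disc p}
    (hz : ∀ i, IsTorsion hϖ hf (z i)) : ∃ (k : ℕ) (ω : Disc p) (a : σ → integers E),
      scale hϖ hf (ϖ ^ k) ω ≠ 0 ∧ scale hϖ hf (ϖ ^ (k + 1)) ω = 0 ∧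
      z = fun i => scale hϖ hf (a i) ω := by
  obtain ⟨k, hk⟩ := exists_forall_scale_eq_zero hz
  obtain ⟨ω, hω, hω1⟩ := exists_scale_eq_zero hϖ hf hϖ.norm_algebraMap_lt_one
    (isOpen_dvd hϖ.ne_zero) (fun _ => eq_zero_of_forall_pow_dvd hϖ) hϖ.algebraMap_ne_zero k
  have h1 : ∀ i, ∃ a, z i = scale hϖ hf a ω := fun i =>
    exists_eq_scale hϖ hf hϖ.norm_algebraMap_lt_one hω hω1
      (scale_pow_eq_zero_of_le k.le_succ (hk i))
  choose a ha using h1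
  exact ⟨k, ω, a, hω, hω1, funext ha⟩

variable {K : IntermediateField ℚ_[p] (PadicAlgCl p)} [FiniteDimensional ℚ_[p] K] (hEK : E ≤ K)

/-- The map from `𝒪_E` to the residue field of `K`. -/
def toResidueField : integers E →+* ResidueField K :=
  (Ideal.Quotient.mk (maxIdeal K)).comp (Subring.inclusion (integers_mono hEK))

include hϖ in
omit [FiniteDimensional ℚ_[p] E] [FiniteDimensional ℚ_[p] K] in
lemma toResidueField_uniformizer : toResidueField hEK ϖ = 0 :=
  Ideal.Quotient.eq_zero_iff_mem.mpr hϖ.norm_lt_one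

omit [FiniteDimensional ℚ_[p] E] in
/-- The order of vanishing along a curve controls the order of the torsion points which are
zeros. -/
lemma exists_forall_card_pow_lt : ∃ e : ℕ, ∀ {n : ℕ} (ψ : MvPowerSeries (Fin n) (integers K))
    (a : Fin n → integers E) (k d : ℕ) (ω : Disc p), scale hϖ hf (ϖ ^ k) ω ≠ 0 →
    scale hϖ hf (ϖ ^ (k + 1)) ω = 0 → evalAt (fun i => scale hϖ hf (a i) ω) ψ = 0 →
    PowerSeries.coeff d (along hϖ hf (toResidueField hEK) a
      (MvPowerSeries.map (Ideal.Quotient.mk (maxIdeal K)) ψ)) ≠ 0 →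
    (∀ i < d, PowerSeries.coeff i (along hϖ hf (toResidueField hEK) a
      (MvPowerSeries.map (Ideal.Quotient.mk (maxIdeal K)) ψ)) = 0) →
    q ^ k < d * e := by
  obtain ⟨ρ, hρ0, hρ1, hρ⟩ := exists_norm_gap K
  -- e satisfies ρ^e < |ϖ|. If d e ≤ q^k, then |ϖ| ≤ |ω|^(q^k) ≤ (|ω|^d)^e ≤ ρ^e, which is absurd.
  obtain ⟨e, he⟩ := exists_pow_lt_of_lt_one (norm_pos_iff.mpr fun h =>
    hϖ.algebraMap_ne_zero (Subtype.ext h)) hρ1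
  refine ⟨e, fun {n} ψ a k d ω hω hω1 hψ hd hlt => ?_⟩
  by_contra! hge
  have h1 := norm_le_norm_pow_of_scale_ne_zero hϖ hf hϖ.norm_algebraMap_lt_one k hω hω1
  rw [← evalOne_along hϖ hf (Subring.inclusion (integers_mono hEK)) (algebraMap_inclusion hEK)] at hψ
  have h2 := norm_pow_le_of_evalOne_eq_zero hρ0.le hρ hψ (d := d)
    (by rw [map_along]; exact hd) (by intro i hi; rw [map_along]; exact hlt i hi)
  have h3 := pow_le_pow_of_le_one (norm_nonneg _) ω.norm_lt.le hge
  rw [pow_mul] at h3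
  have h4 := pow_le_pow_left₀ (by positivity) h2 e
  linarith

include hEK in
/-- The torsion points which are zeros of a non-zero power series lie on finitely many translates of
hyperplanes. -/
theorem exists_finite_forall_lin_eq {n : ℕ} {φ : MvPowerSeries (Fin n) (integers K)}
    (hφ : φ ≠ 0) : ∃ W : Set ((Fin n → integers E) × Disc p), W.Finite ∧
      (∀ w ∈ W, (∃ i, IsUnit (w.1 i)) ∧ IsTorsion hϖ hf w.2) ∧
      ∀ z : Fin n → Disc p, (∀ i, IsTorsion hϖ hf (z i)) → evalAt z φ = 0 →
        ∃ w ∈ W, lin hϖ hf w.1 z = w.2 := by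
  classical
  obtain ⟨c, ψ, hc, rfl, hψ⟩ := exists_eq_C_mul hφ
  obtain ⟨e, he⟩ := exists_forall_card_pow_lt hϖ hf hEK
  -- The constant turns q^k < d e into q^(k+1) ≤ q (e + 1) d. With e + 1 it stays positive, as
  -- needed when the restriction vanishes identically.
  obtain ⟨B, l, hB, hdvd⟩ := exists_finset_forall_dvd hϖ hf (toResidueField_uniformizer hϖ hEK)
    (isOpen_dvd hϖ.ne_zero) (fun _ => eq_zero_of_forall_pow_dvd hϖ) hψ (q * (e + 1))
  have hq := one_lt_card hϖ hf
  refine ⟨(B : Set _) ×ˢ {x | scale hϖ hf (ϖ ^ l) x = 0}, B.finite_toSet.prod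
    (finite_setOf_scale_eq_zero hϖ hf (isOpen_dvd hϖ.ne_zero)
      (fun _ => eq_zero_of_forall_pow_dvd hϖ) l), ?_, ?_⟩
  · rintro ⟨b, τ⟩ ⟨hb, hτ⟩
    exact ⟨hB b hb, l, hτ⟩
  intro z hz hzφ
  obtain ⟨k, ω, a, hω, hω1, rfl⟩ := exists_eq_scale_of_isTorsion hϖ hf hz
  rw [map_mul, evalAt_C, mul_eq_zero, map_eq_zero_iff _ algebraMap_integers_injective] at hzφ
  have hzψ := hzφ.resolve_left hc
  obtain ⟨m, hm, hXm⟩ : ∃ m, q ^ (k + 1) ≤ q * (e + 1) * m ∧ PowerSeries.X ^ m ∣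
      along hϖ hf (toResidueField hEK) a (MvPowerSeries.map (Ideal.Quotient.mk (maxIdeal K)) ψ) := by
    set g := along hϖ hf (toResidueField hEK) a
      (MvPowerSeries.map (Ideal.Quotient.mk (maxIdeal K)) ψ) with hg
    by_cases hg0 : g = 0
    · refine ⟨q ^ (k + 1), ?_, by rw [hg0]; exact dvd_zero _⟩
      exact Nat.le_mul_of_pos_left _ (by positivity)
    · have hex : ∃ d, PowerSeries.coeff d g ≠ 0 := by
        by_contra! h
        exact hg0 (PowerSeries.ext h)
      have hlt : ∀ i < Nat.find hex, PowerSeries.coeff i g = 0 := fun i hi => by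
        simpa using Nat.find_min hex hi
      refine ⟨Nat.find hex, ?_, PowerSeries.X_pow_dvd_iff.mpr hlt⟩
      have h1 := he ψ a k _ ω hω hω1 hzψ (Nat.find_spec hex) hlt
      rw [pow_succ', mul_assoc]
      apply Nat.mul_le_mul_left
      nlinarith
  obtain ⟨b, hb, s, hs⟩ := hdvd a (k + 1) m hm hXm
  -- ϖ^(k+1) kills ω and divides ϖ^l ∑ b_i a_i, so ϖ^l kills ∑ [b_i](z_i).
  refine ⟨(b, lin hϖ hf b fun i => scale hϖ hf (a i) ω), ⟨hb, ?_⟩, rfl⟩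
  rw [Set.mem_ofPred_eq, lin_scale_const, scale_scale, hs, mul_comm, ← scale_scale, hω1,
    scale_apply_zero]

include hEK in
/-- The torsion points are dense. -/
theorem eq_zero_of_forall_evalAt_eq_zero {n : ℕ} {φ : MvPowerSeries (Fin n) (integers K)}
    (h : ∀ z : Fin n → Disc p, (∀ i, IsTorsion hϖ hf (z i)) → evalAt z φ = 0) : φ = 0 := by
  classical
  by_contra hφ
  obtain ⟨c, ψ, hc, rfl, hψ⟩ := exists_eq_C_mul hφ
  obtain ⟨e, he⟩ := exists_forall_card_pow_lt hϖ hf hEK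
  obtain ⟨a, ha⟩ := exists_along_ne_zero hϖ hf (toResidueField_uniformizer hϖ hEK) hψ
  have hex : ∃ d, PowerSeries.coeff d (along hϖ hf (toResidueField hEK) a
      (MvPowerSeries.map (Ideal.Quotient.mk (maxIdeal K)) ψ)) ≠ 0 := by
    by_contra! h
    exact ha (PowerSeries.ext h)
  set d := Nat.find hex with hd
  -- The reduction has finite order d along the chosen curve, so a zero at level k would satisfy q^k
  -- < d e. The level k = d e violates this.
  obtain ⟨ω, hω, hω1⟩ := exists_scale_eq_zero hϖ hf hϖ.norm_algebraMap_lt_one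
    (isOpen_dvd hϖ.ne_zero) (fun _ => eq_zero_of_forall_pow_dvd hϖ) hϖ.algebraMap_ne_zero (d * e)
  have h1 := h (fun i => scale hϖ hf (a i) ω) fun i => ⟨d * e + 1, by
    rw [scale_scale, mul_comm, ← scale_scale, hω1, scale_apply_zero]⟩
  rw [map_mul, evalAt_C, mul_eq_zero, map_eq_zero_iff _ algebraMap_integers_injective] at h1
  have h2 := he ψ a (d * e) d ω hω hω1 (h1.resolve_left hc) (Nat.find_spec hex) fun i hi => by
    simpa using Nat.find_min hex hi
  exact absurd h2 (not_lt.mpr (Nat.lt_pow_self (one_lt_card hϖ hf)).le)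

end Zeros

/-! ### Torsion points in the algebraic closure and in ℂ_p agree. -/

section Algebraic

variable {p : ℕ} [Fact p.Prime]

/-- The point of the disc of `ℂ_p` given by an element of norm less than `1` of the algebraic
closure of `ℚ_p`; elements of norm at least `1` are sent to `0`. -/
def toDisc (ζ : PadicAlgCl p) : Disc p :=
  if h : ‖ζ‖ < 1 then ⟨⟨(ζ : ℂ_[p]), by
    change ‖(ζ : ℂ_[p])‖ ≤ 1
    rw [PadicComplex.norm_extends]; exact h.le⟩, by
    change ‖(ζ : ℂ_[p])‖ < 1
    rw [PadicComplex.norm_extends]; exact h⟩ else 0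

lemma coe_toDisc {ζ : PadicAlgCl p} (h : ‖ζ‖ < 1) :
    ((toDisc ζ : ball p) : ℂ_[p]) = (ζ : ℂ_[p]) := by
  rw [toDisc, dif_pos h]

lemma toDisc_val {K : IntermediateField ℚ_[p] (PadicAlgCl p)} {x : integers K}
    (h : ‖(x : PadicAlgCl p)‖ < 1) :
    (toDisc (x : PadicAlgCl p) : ball p) = algebraMap (integers K) (ball p) x :=
  Subtype.ext (coe_toDisc h)

lemma isometry_coe : Isometry (algebraMap (PadicAlgCl p) ℂ_[p]) :=
  AddMonoidHomClass.isometry_of_norm _ fun x => PadicComplex.norm_extends p x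

/-- The isometric embedding into ℂ_p both preserves and reflects sums whose value lies in the
algebraic closure. -/
lemma mem_torsionPoints_iff {E : IntermediateField ℚ_[p] (PadicAlgCl p)} {ϖ : integers E}
    {f : PowerSeries (integers E)} (hϖ : IsUniformizer ϖ) (hf : IsLubinTateSeries ϖ f)
    {ζ : PadicAlgCl p} :
    ζ ∈ torsionPoints hϖ hf ↔ ‖ζ‖ < 1 ∧ IsTorsion hϖ hf (toDisc ζ) := by
  refine and_congr_right fun hζ => exists_congr fun k => ?_
  have h1 := (hasSum_evalOne (toDisc ζ) (scalarSeries hϖ hf (ϖ ^ k))).map (ball p).subtype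
    continuous_subtype_val
  have h2 : (⇑(ball p).subtype ∘ fun m => algebraMap (integers E) (ball p)
      (PowerSeries.coeff m (scalarSeries hϖ hf (ϖ ^ k))) * (toDisc ζ : ball p) ^ m) =
      ⇑(algebraMap (PadicAlgCl p) ℂ_[p]) ∘ fun m =>
        ((PowerSeries.coeff m (scalarSeries hϖ hf (ϖ ^ k)) : integers E) : PadicAlgCl p) *
          ζ ^ m := by
    funext m
    simp only [Function.comp_apply, Subring.subtype_apply,
      coe_toDisc hζ, coe_algebraMap, map_mul, map_pow]
    rfl
  rw [h2, ← coe_scale] at h1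
  constructor
  · intro h
    have h3 := h.map (algebraMap (PadicAlgCl p) ℂ_[p]) isometry_coe.continuous
    rw [map_zero] at h3
    exact Disc.ext (Subtype.ext (h1.unique h3))
  · intro h
    rw [h] at h1
    refine (isometry_coe.isUniformInducing.isInducing.hasSum_iff _ _).mp ?_
    rw [map_zero]
    exact h1

variable {E : IntermediateField ℚ_[p] (PadicAlgCl p)} [FiniteDimensional ℚ_[p] E] {ϖ : integers E}
  {f : PowerSeries (integers E)} {hϖ : IsUniformizer ϖ} {hf : IsLubinTateSeries ϖ f}

/-- Torsion points are roots of monic polynomials over 𝒪_E, and the algebraic closure has no further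
elements algebraic over it. -/
lemma IsTorsion.exists_toDisc_eq {x : Disc p} (hx : IsTorsion hϖ hf x) :
    ∃ ζ ∈ torsionPoints hϖ hf, toDisc ζ = x := by
  obtain ⟨k, hk⟩ := hx
  obtain ⟨P, hP, hroot⟩ := exists_monic_of_scale_eq_zero (p := p) hϖ hf (isOpen_dvd hϖ.ne_zero)
    (fun _ => eq_zero_of_forall_pow_dvd hϖ) k
  have h1 : Polynomial.eval₂ (algebraMap (PadicAlgCl p) ℂ_[p]) ((x : ball p) : ℂ_[p])
      (P.map (integers E).subtype) = 0 := by
    have h2 := congrArg (ball p).subtype (hroot x hk)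
    rw [Polynomial.aeval_def, Polynomial.hom_eval₂, map_zero] at h2
    rw [Polynomial.eval₂_map]
    exact h2
  have hint : IsIntegral (PadicAlgCl p) ((x : ball p) : ℂ_[p]) := ⟨_, hP.map _, h1⟩
  obtain ⟨ζ, hζ⟩ := minpoly.mem_range_of_degree_eq_one (PadicAlgCl p) ((x : ball p) : ℂ_[p])
    (IsAlgClosed.degree_eq_one_of_irreducible _ (minpoly.irreducible hint))
  have hζ1 : ‖ζ‖ < 1 := by
    rw [← PadicComplex.norm_extends p ζ]
    exact lt_of_eq_of_lt (congrArg norm hζ) x.norm_lt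
  have hζx : toDisc ζ = x := Disc.ext (Subtype.ext ((coe_toDisc hζ1).trans hζ))
  exact ⟨ζ, (mem_torsionPoints_iff hϖ hf).mpr ⟨hζ1, hζx ▸ ⟨k, hk⟩⟩, hζx⟩

end Algebraic

/-! ### Division by X_i - τ. -/

section Division

variable {p : ℕ} [Fact p.Prime]

lemma evalAt_congr {R : Type*} [CommRing R] [Algebra R (ball p)] {σ : Type*} [Finite σ]
    {z w : σ → Disc p} {φ : MvPowerSeries σ R}
    (h : ∀ d, coeff d φ ≠ 0 → ∀ i, d i ≠ 0 → z i = w i) : evalAt z φ = evalAt w φ := by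
  refine (hasSum_evalAt z φ).unique ?_
  convert hasSum_evalAt w φ using 2 with d
  by_cases hd : coeff d φ = 0
  · rw [hd, map_zero, zero_mul, zero_mul]
  · congr 1
    refine Finsupp.prod_congr fun i hi => ?_
    rw [h d hd i (Finsupp.mem_support_iff.mp hi)]

variable {K : IntermediateField ℚ_[p] (PadicAlgCl p)} [FiniteDimensional ℚ_[p] K]

/-- The image of 𝒪_K in the ball is compact, hence closed, and contains the partial sums. -/
lemma evalOne_mem_range {τ : integers K} (hτ : ‖(τ : PadicAlgCl p)‖ < 1)
    (g : PowerSeries (integers K)) :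
    ∃ y : integers K, algebraMap (integers K) (ball p) y = evalOne (toDisc (τ : PadicAlgCl p)) g := by
  have hcont : Continuous (algebraMap (integers K) (ball p)) :=
    (isometry_coe.continuous.comp continuous_subtype_val).subtype_mk _
  have hcl : IsClosed (Set.range (algebraMap (integers K) (ball p))) :=
    (isCompact_range hcont).isClosed
  refine hcl.mem_of_tendsto (hasSum_evalOne (toDisc (τ : PadicAlgCl p)) g)
    (Filter.Eventually.of_forall fun s => ?_)
  refine ⟨∑ m ∈ s, PowerSeries.coeff m g * τ ^ m, ?_⟩
  rw [map_sum]
  refine Finset.sum_congr rfl fun m _ => ?_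
  rw [map_mul, map_pow, toDisc_val hτ]

/-- Division of a power series by `X i - τ`. -/
lemma exists_division {σ : Type*} (i : σ) {τ : integers K}
    (hτ : ‖(τ : PadicAlgCl p)‖ < 1) (φ : MvPowerSeries σ (integers K)) :
    ∃ g r : MvPowerSeries σ (integers K), φ = (X i - C τ) * g + r ∧
      ∀ d, coeff d r ≠ 0 → d i = 0 ∧ ∃ k, coeff (d + Finsupp.single i k) φ ≠ 0 := by
  classical
  -- Horner's scheme: S d is the sum of τ^k times the coefficient of X^d X_i^k. The quotient has
  -- coefficients S (d + e_i), and the remainder keeps S d where d_i = 0.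
  have h1 : ∀ d : σ →₀ ℕ, ∃ y : integers K, algebraMap (integers K) (ball p) y =
      evalOne (toDisc (τ : PadicAlgCl p))
        (PowerSeries.mk fun k => coeff (d + Finsupp.single i k) φ) :=
    fun d => evalOne_mem_range hτ _
  choose S hS using h1
  have hrec : ∀ d, S d = coeff d φ + τ * S (d + Finsupp.single i 1) := by
    intro d
    apply algebraMap_integers_injective
    rw [hS]
    conv_lhs => rw [PowerSeries.eq_X_mul_shift_add_const
      (PowerSeries.mk fun k => coeff (d + Finsupp.single i k) φ)]
    rw [map_add, map_mul, map_add, map_mul, hS, evalOne_X, evalOne_C, toDisc_val hτ, add_comm]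
    congr 2
    · rw [← PowerSeries.coeff_zero_eq_constantCoeff_apply, PowerSeries.coeff_mk]
      simp
    · congr 1
      ext k
      rw [PowerSeries.coeff_mk, PowerSeries.coeff_mk, PowerSeries.coeff_mk, add_assoc,
        ← Finsupp.single_add, add_comm k 1]
  let g : MvPowerSeries σ (integers K) := fun d => S (d + Finsupp.single i 1)
  let r : MvPowerSeries σ (integers K) := fun d => if d i = 0 then S d else 0
  have hg : ∀ d, coeff d g = S (d + Finsupp.single i 1) := fun d => rfl
  have hr : ∀ d, coeff d r = if d i = 0 then S d else 0 := fun d => rfl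
  refine ⟨g, r, ?_, fun d hd => ?_⟩
  · refine MvPowerSeries.ext fun d => ?_
    rw [map_add, sub_mul, map_sub, coeff_C_mul, X, coeff_monomial_mul, hr]
    simp only [hg]
    have hle : Finsupp.single i 1 ≤ d ↔ d i ≠ 0 := by
      rw [Finsupp.single_le_iff, Nat.one_le_iff_ne_zero]
    by_cases h0 : d i = 0
    · rw [if_neg (by rw [hle]; exact not_not.mpr h0), if_pos h0, hrec d]
      ring
    · rw [if_pos (hle.mpr h0), if_neg h0, tsub_add_cancel_of_le (hle.mpr h0), hrec d]
      ring
  · rw [hr] at hd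
    split_ifs at hd with h0
    · refine ⟨h0, ?_⟩
      by_contra! hk
      apply hd
      apply algebraMap_integers_injective
      rw [hS, map_zero]
      have : (PowerSeries.mk fun k => coeff (d + Finsupp.single i k) φ) = 0 := by
        ext k
        rw [PowerSeries.coeff_mk, hk, map_zero]
      rw [this, map_zero]
    · exact absurd rfl hd

/-- Modulo the ideal of an intersection of hyperplanes `X i = τ i`, `i ∈ s`, every power series is
congruent to one in the other variables. -/
lemma exists_remainder {σ : Type*} (s : Finset σ) {τ : σ → integers K}
    (hτ : ∀ i ∈ s, ‖(τ i : PadicAlgCl p)‖ < 1) (φ : MvPowerSeries σ (integers K)) :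
    ∃ r : MvPowerSeries σ (integers K), φ - r ∈ Ideal.span ((fun i => X i - C (τ i)) '' s) ∧
      ∀ d, coeff d r ≠ 0 → ∀ i ∈ s, d i = 0 := by
  classical
  induction s using Finset.induction_on with
  | empty => exact ⟨φ, by simp, by simp⟩
  | insert i s hi ih =>
    obtain ⟨r₁, h1, h2⟩ := ih fun j hj => hτ j (Finset.mem_insert_of_mem hj)
    obtain ⟨g, r, h3, h4⟩ := exists_division i (hτ i (Finset.mem_insert_self i s)) r₁
    refine ⟨r, ?_, fun d hd j hj => ?_⟩
    · have h5 : φ - r = (φ - r₁) + g * (X i - C (τ i)) := by rw [h3]; ring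
      rw [h5]
      refine add_mem (Ideal.span_mono (Set.image_mono (by simp)) h1)
        (Ideal.mul_mem_left _ _ (Ideal.subset_span ⟨i, by simp, rfl⟩))
    -- Up to a power of X_i, monomials of the new remainder occur in `r₁`, so variables eliminated
    -- earlier do not return.
    · obtain ⟨h5, k, hk⟩ := h4 d hd
      rcases Finset.mem_insert.mp hj with rfl | hj
      · exact h5
      · have := h2 _ hk j hj
        simpa using (Nat.add_eq_zero_iff.mp this).1

end Division

/-! ### Hyperplane ideals as vanishing ideals of torsion points. -/

section Hyperplane

variable {p : ℕ} [Fact p.Prime] {E : IntermediateField ℚ_[p] (PadicAlgCl p)}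
  [FiniteDimensional ℚ_[p] E] {ϖ : integers E} {f : PowerSeries (integers E)}
  (hϖ : IsUniformizer ϖ) (hf : IsLubinTateSeries ϖ f)

/-- The torsion points `z` of the polydisc with `z i = τ i` for `i ∈ s`. -/
def torsionOn {n : ℕ} (s : Finset (Fin n)) (τ : Fin n → Disc p) : Set (Fin n → Disc p) :=
  {z | (∀ i, IsTorsion hϖ hf (z i)) ∧ ∀ i ∈ s, z i = τ i}

variable {hϖ hf}

omit [FiniteDimensional ℚ_[p] E] in
lemma isTorsion_zero : IsTorsion hϖ hf (0 : Disc p) := ⟨0, scale_apply_zero hϖ hf _⟩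

omit [FiniteDimensional ℚ_[p] E] in
lemma piecewise_mem_torsionOn {n : ℕ} {s : Finset (Fin n)} {τ z : Fin n → Disc p}
    (hτ : ∀ i ∈ s, IsTorsion hϖ hf (τ i)) (hz : ∀ i, IsTorsion hϖ hf (z i)) :
    s.piecewise τ z ∈ torsionOn hϖ hf s τ := by
  refine ⟨fun i => ?_, fun i hi => s.piecewise_eq_of_mem _ _ hi⟩
  by_cases hi : i ∈ s
  · rw [s.piecewise_eq_of_mem _ _ hi]
    exact hτ i hi
  · rw [s.piecewise_eq_of_notMem _ _ hi]
    exact hz i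

variable {K : IntermediateField ℚ_[p] (PadicAlgCl p)} [FiniteDimensional ℚ_[p] K] (hEK : E ≤ K)

include hEK in
/-- A power series not involving the variables in `s` which vanishes on the torsion points with
given coordinates in `s` is zero. -/
lemma eq_zero_of_forall_torsionOn {n : ℕ} {s : Finset (Fin n)} {τ : Fin n → Disc p}
    (hτ : ∀ i ∈ s, IsTorsion hϖ hf (τ i)) {r r' : MvPowerSeries (Fin n) (integers K)}
    (hr : ∀ d, coeff d r ≠ 0 → ∀ i ∈ s, d i = 0) (hr' : ∀ d, coeff d r' ≠ 0 → ∀ i ∈ s, d i = 0)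
    (h : ∀ z ∈ torsionOn hϖ hf s τ, evalAt z r * evalAt z r' = 0) : r = 0 ∨ r' = 0 := by
  -- The factors do not involve the variables in s, so their values at any torsion point are those
  -- at the point with the coordinates in s replaced by τ. Density then applies to r r'. The product
  -- form serves both the vanishing criterion and primality.
  rw [← mul_eq_zero]
  refine eq_zero_of_forall_evalAt_eq_zero hϖ hf hEK fun z hz => ?_
  have hcongr : ∀ r : MvPowerSeries (Fin n) (integers K),
      (∀ d, coeff d r ≠ 0 → ∀ i ∈ s, d i = 0) → evalAt z r = evalAt (s.piecewise τ z) r := by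
    intro r hr
    refine evalAt_congr fun d hd i hi => ?_
    rw [s.piecewise_eq_of_notMem _ _ fun his => hi (hr d hd i his)]
  rw [map_mul, hcongr r hr, hcongr r' hr']
  exact h _ (piecewise_mem_torsionOn hτ hz)

omit [FiniteDimensional ℚ_[p] E] [FiniteDimensional ℚ_[p] K] in
lemma evalAt_eq_zero_of_mem_span {n : ℕ} {s : Finset (Fin n)} {τ : Fin n → integers K}
    (hτ : ∀ i ∈ s, ‖(τ i : PadicAlgCl p)‖ < 1)
    {φ : MvPowerSeries (Fin n) (integers K)}
    (hφ : φ ∈ Ideal.span ((fun i => X i - C (τ i)) '' (s : Set (Fin n)))) {z : Fin n → Disc p}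
    (hz : z ∈ torsionOn hϖ hf s fun i => toDisc (τ i : PadicAlgCl p)) : evalAt z φ = 0 := by
  have h1 : Ideal.span ((fun i => X i - C (τ i)) '' (s : Set (Fin n))) ≤
      RingHom.ker (evalAt (R := integers K) z) := by
    rw [Ideal.span_le]
    rintro _ ⟨i, hi, rfl⟩
    change evalAt z (X i - C (τ i)) = 0
    rw [map_sub, evalAt_X, evalAt_C, hz.2 i hi, toDisc_val (hτ i hi), sub_self]
  exact h1 hφ

omit [FiniteDimensional ℚ_[p] E] in
lemma isTorsion_toDisc {ζ : PadicAlgCl p} (h : ζ ∈ torsionPoints hϖ hf) :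
    IsTorsion hϖ hf (toDisc ζ) := ((mem_torsionPoints_iff hϖ hf).mp h).2

instance (F : IntermediateField ℚ_[p] (PadicAlgCl p)) [FiniteDimensional ℚ_[p] F] {n : ℕ}
    (s : Finset (Fin n)) (ζ : Fin n → PadicAlgCl p) :
    FiniteDimensional ℚ_[p] (adjoinCoordinates F s ζ) := by
  have : Finite (ζ '' s) := (s.finite_toSet.image ζ).to_subtype
  have : FiniteDimensional ℚ_[p] (IntermediateField.adjoin ℚ_[p] (ζ '' s)) :=
    IntermediateField.finiteDimensional_adjoin fun x _ =>
      (Algebra.IsAlgebraic.isAlgebraic x).isIntegral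
  exact IntermediateField.finiteDimensional_sup _ _

variable {F : IntermediateField ℚ_[p] (PadicAlgCl p)}

variable [FiniteDimensional ℚ_[p] F]

omit [FiniteDimensional ℚ_[p] E] in
/-- The ideal of an intersection of hyperplanes is defined over a finite extension which contains
the coordinates. -/
lemma exists_coordinates {n : ℕ} (s : Finset (Fin n)) (ζ : Fin n → PadicAlgCl p)
    (hζ : ∀ i ∈ s, ζ i ∈ torsionPoints hϖ hf) :
    ∃ (K : IntermediateField ℚ_[p] (PadicAlgCl p)) (_ : FiniteDimensional ℚ_[p] K) (hFK : F ≤ K)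
      (τ : Fin n → integers K), (∀ i ∈ s, (τ i : PadicAlgCl p) = ζ i) ∧
      hyperplaneIdeal F s ζ = (Ideal.span ((fun i => X i - C (τ i)) '' (s : Set (Fin n)))).comap
        (MvPowerSeries.map (Subring.inclusion (integers_mono hFK))) := by
  have hmem : ∀ i ∈ s, ζ i ∈ integers (adjoinCoordinates F s ζ) := fun i hi =>
    ⟨(le_sup_right : _ ≤ adjoinCoordinates F s ζ)
      (IntermediateField.subset_adjoin _ _ ⟨i, hi, rfl⟩), (hζ i hi).1.le⟩
  let τ : Fin n → integers (adjoinCoordinates F s ζ) := fun i =>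
    if h : i ∈ s then ⟨ζ i, hmem i h⟩ else 0
  have hτ : ∀ i (hi : i ∈ s), τ i = ⟨ζ i, hmem i hi⟩ := fun i hi => dif_pos hi
  refine ⟨adjoinCoordinates F s ζ, inferInstance, le_sup_left, τ, fun i hi => by rw [hτ i hi], ?_⟩
  rw [hyperplaneIdeal]
  congr 2
  ext ψ
  constructor
  · rintro ⟨i, hi, h, rfl⟩
    exact ⟨i, hi, congrArg (fun y => X i - C y) (hτ i hi)⟩
  · rintro ⟨i, hi, rfl⟩
    exact ⟨i, hi, hmem i hi, congrArg (fun y => X i - C y) (hτ i hi)⟩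

omit [FiniteDimensional ℚ_[p] E] in
lemma torsionOn_congr {n : ℕ} {s : Finset (Fin n)} {τ τ' : Fin n → Disc p}
    (h : ∀ i ∈ s, τ i = τ' i) : torsionOn hϖ hf s τ = torsionOn hϖ hf s τ' := by
  ext z
  exact and_congr_right fun _ => forall₂_congr fun i hi => by rw [h i hi]

omit [FiniteDimensional ℚ_[p] E] in
/-- Power series over `𝒪_F` can be reduced to power series in the variables outside `s` with the
same values on an intersection of hyperplanes. -/
lemma exists_reduction (hEF : E ≤ F) {n : ℕ} {s : Finset (Fin n)} {ζ : Fin n → PadicAlgCl p}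
    (hζ : ∀ i ∈ s, ζ i ∈ torsionPoints hϖ hf) :
    ∃ (K : IntermediateField ℚ_[p] (PadicAlgCl p)) (_ : FiniteDimensional ℚ_[p] K) (_ : E ≤ K),
      ∀ φ : MvPowerSeries (Fin n) (integers F), ∃ r : MvPowerSeries (Fin n) (integers K),
        (∀ d, coeff d r ≠ 0 → ∀ i ∈ s, d i = 0) ∧
        (∀ z ∈ torsionOn hϖ hf s fun i => toDisc (ζ i), evalAt z r = evalAt z φ) ∧
        (r = 0 → φ ∈ hyperplaneIdeal F s ζ) ∧
        (φ ∈ hyperplaneIdeal F s ζ →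
          ∀ z ∈ torsionOn hϖ hf s fun i => toDisc (ζ i), evalAt z φ = 0) := by
  obtain ⟨K, hK, hFK, τ, hτ, heq⟩ := exists_coordinates (F := F) s ζ hζ
  refine ⟨K, hK, hEF.trans hFK, fun φ => ?_⟩
  have hτ1 : ∀ i ∈ s, ‖(τ i : PadicAlgCl p)‖ < 1 := fun i hi => hτ i hi ▸ (hζ i hi).1
  rw [torsionOn_congr fun i hi => congrArg toDisc (hτ i hi).symm, heq, Ideal.mem_comap]
  have hmap := fun z => evalAt_map _ (algebraMap_inclusion hFK) z φ
  obtain ⟨r, hr, hr'⟩ := exists_remainder s hτ1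
    (MvPowerSeries.map (Subring.inclusion (integers_mono hFK)) φ)
  refine ⟨r, hr', fun z hz => ?_, fun h0 => ?_, fun h z hz => ?_⟩
  · have h1 := evalAt_eq_zero_of_mem_span hτ1 hr hz
    rw [map_sub, sub_eq_zero, hmap] at h1
    exact h1.symm
  · rwa [h0, sub_zero] at hr
  · rw [← hmap]
    exact evalAt_eq_zero_of_mem_span hτ1 h hz

variable (hEF : E ≤ F)

include hEF in
/-- The ideal of an intersection of hyperplanes consists of the power series vanishing at its
torsion points. -/
lemma mem_hyperplaneIdeal_iff {n : ℕ} {s : Finset (Fin n)} {ζ : Fin n → PadicAlgCl p}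
    (hζ : ∀ i ∈ s, ζ i ∈ torsionPoints hϖ hf) {φ : MvPowerSeries (Fin n) (integers F)} :
    φ ∈ hyperplaneIdeal F s ζ ↔
      ∀ z ∈ torsionOn hϖ hf s fun i => toDisc (ζ i), evalAt z φ = 0 := by
  obtain ⟨K, hK, hEK, hred⟩ := exists_reduction hEF hζ
  obtain ⟨r, hr, hr1, hr2, hr3⟩ := hred φ
  refine ⟨hr3, fun h => hr2 ?_⟩
  refine (or_self_iff).mp (eq_zero_of_forall_torsionOn hEK
    (fun i hi => isTorsion_toDisc (hζ i hi)) hr hr fun z hz => ?_)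
  rw [hr1 z hz, h z hz, mul_zero]

include hEF in
lemma hyperplaneIdeal_isPrime {n : ℕ} {s : Finset (Fin n)} {ζ : Fin n → PadicAlgCl p}
    (hζ : ∀ i ∈ s, ζ i ∈ torsionPoints hϖ hf) : (hyperplaneIdeal F s ζ).IsPrime := by
  have hmem := fun φ => mem_hyperplaneIdeal_iff hEF hζ (φ := φ)
  constructor
  · rw [Ne, Ideal.eq_top_iff_one, hmem]
    intro h
    have h1 := h _ (piecewise_mem_torsionOn (z := fun _ => 0) (fun i hi => isTorsion_toDisc (hζ i hi))
      fun _ => isTorsion_zero)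
    rw [map_one] at h1
    exact one_ne_zero h1
  · intro φ ψ hφψ
    obtain ⟨K, hK, hEK, hred⟩ := exists_reduction hEF hζ
    obtain ⟨r, hr, hr1, hr2, -⟩ := hred φ
    obtain ⟨t, ht, ht1, ht2, -⟩ := hred ψ
    refine (eq_zero_of_forall_torsionOn hEK (fun i hi => isTorsion_toDisc (hζ i hi)) hr ht
      fun z hz => ?_).imp hr2 ht2
    rw [hr1 z hz, ht1 z hz, ← map_mul]
    exact (hmem _).mp hφψ z hz

end Hyperplane

/-! ### The torsion zeros of an ideal, by induction on the number of variables. -/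

section Structure

variable {p : ℕ} [Fact p.Prime] {E : IntermediateField ℚ_[p] (PadicAlgCl p)}
  {ϖ : integers E} {f : PowerSeries (integers E)} (hϖ : IsUniformizer ϖ)
  (hf : IsLubinTateSeries ϖ f)

/-- The action of matrices on the points of the polydisc. -/
def linMap {n : ℕ} (g : Matrix (Fin n) (Fin n) (integers E)) (z : Fin n → Disc p) :
    Fin n → Disc p :=
  fun i => lin hϖ hf (g.row i) z

lemma linMap_mul {n : ℕ} (g h : Matrix (Fin n) (Fin n) (integers E)) (z : Fin n → Disc p) :
    linMap hϖ hf (g * h) z = linMap hϖ hf g (linMap hϖ hf h z) := by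
  funext i
  exact (lin_lin hϖ hf (g.row i) h.row z).symm

lemma linMap_one {n : ℕ} (z : Fin n → Disc p) :
    linMap hϖ hf (1 : Matrix (Fin n) (Fin n) (integers E)) z = z := by
  funext i
  have h1 : (1 : Matrix (Fin n) (Fin n) (integers E)).row i = Pi.single i 1 := by
    funext j
    rw [Matrix.row_apply, Matrix.one_apply, Pi.single_apply]
    simp only [eq_comm]
  rw [linMap, h1, lin_single]

lemma lin_linMap {n : ℕ} (b : Fin n → integers E) (g : Matrix (Fin n) (Fin n) (integers E))
    (z : Fin n → Disc p) : lin hϖ hf b (linMap hϖ hf g z) = lin hϖ hf (Matrix.vecMul b g) z := by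
  unfold linMap
  rw [lin_lin]
  rfl

lemma evalAt_linMap {K : IntermediateField ℚ_[p] (PadicAlgCl p)} (hEK : E ≤ K) {n : ℕ}
    (g : Matrix (Fin n) (Fin n) (integers E)) (z : Fin n → Disc p)
    (φ : MvPowerSeries (Fin n) (integers K)) :
    evalAt z (linearSubst hϖ hf (Subring.inclusion (integers_mono hEK)) g φ) =
      evalAt (linMap hϖ hf g z) φ :=
  evalAt_linearSubst hϖ hf _ (algebraMap_inclusion hEK) g z φ

/-- Lets a change of the last n variables act on a slice with fixed first coordinate. -/
lemma linMap_consMatrix {n : ℕ} (g : Matrix (Fin n) (Fin n) (integers E)) (x : Disc p)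
    (z : Fin n → Disc p) :
    linMap hϖ hf (consMatrix g) (Fin.cons x z : Fin (n + 1) → Disc p) =
      Fin.cons x (linMap hϖ hf g z) := by
  funext i
  refine Fin.cases ?_ (fun i => ?_) i
  · have h1 : (consMatrix g).row 0 = Pi.single 0 1 := by
      funext j
      refine Fin.cases ?_ (fun j => ?_) j <;> simp [Matrix.row_apply]
    rw [linMap, h1, lin_single]
    rfl
  · rw [Fin.cons_succ]
    have h1 : (consMatrix g).row i.succ = fun j => ∑ k, g.row i k *
        (Pi.single (M := fun _ => integers E) k.succ (1 : integers E)) j := by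
      funext j
      refine Fin.cases ?_ (fun j => ?_) j
      · simp [Matrix.row_apply]
      · simp [Matrix.row_apply, Pi.single_apply]
    rw [linMap, h1, ← lin_lin hϖ hf (g.row i) (fun k => Pi.single k.succ 1)]
    simp only [lin_single, Fin.cons_succ]
    rfl

variable {hϖ hf}

lemma isTorsion_linMap {n : ℕ} (g : Matrix (Fin n) (Fin n) (integers E)) {z : Fin n → Disc p}
    (hz : ∀ i, IsTorsion hϖ hf (z i)) (i : Fin n) : IsTorsion hϖ hf (linMap hϖ hf g z i) :=
  IsTorsion.lin hz _

lemma exists_linMap_eq {n : ℕ} (U : (Matrix (Fin n) (Fin n) (integers E))ˣ) {z : Fin n → Disc p}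
    (hz : ∀ i, IsTorsion hϖ hf (z i)) :
    ∃ y, (∀ i, IsTorsion hϖ hf (y i)) ∧ linMap hϖ hf U.val y = z := by
  have h1 := isTorsion_linMap (U⁻¹).val hz
  have h2 := linMap_mul hϖ hf U.val (U⁻¹).val z
  rw [Units.mul_inv, linMap_one] at h2
  exact ⟨_, h1, h2.symm⟩

/-- Specialization of the first variable. -/
lemma exists_evalAt_cons {K : IntermediateField ℚ_[p] (PadicAlgCl p)} [FiniteDimensional ℚ_[p] K]
    {n : ℕ} {τ : integers K} (hτ : ‖(τ : PadicAlgCl p)‖ < 1)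
    (φ : MvPowerSeries (Fin (n + 1)) (integers K)) :
    ∃ ψ : MvPowerSeries (Fin n) (integers K), ∀ z : Fin n → Disc p,
      evalAt z ψ = evalAt (Fin.cons (toDisc (τ : PadicAlgCl p)) z : Fin (n + 1) → Disc p) φ := by
  -- The remainder is free of X_0 and has the values of φ on the slice.
  obtain ⟨g, r, hgr, hr⟩ := exists_division 0 hτ φ
  have hr1 : r = rename Fin.succ (PowerSeries.coeff 0 (finSuccEquiv (integers K) n r)) := by
    apply (finSuccEquiv (integers K) n).injective
    rw [rename_succ_eq]
    ext k x
    rw [PowerSeries.coeff_C]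
    split_ifs with hk
    · rw [hk]
    · rw [coeff_coeff_finSuccEquiv, map_zero]
      by_contra h0
      have h1 := (hr _ (fun h => h0 (by rw [h]))).1
      rw [Finsupp.cons_zero] at h1
      exact hk h1
  refine ⟨PowerSeries.coeff 0 (finSuccEquiv (integers K) n r), fun z => ?_⟩
  rw [hgr, map_add, map_mul, map_sub, evalAt_X, evalAt_C, Fin.cons_zero, toDisc_val hτ, sub_self,
    zero_mul, zero_add]
  conv_rhs => rw [hr1, evalAt_rename]
  rfl

variable (hϖ hf)

lemma lin_single_eq_scale {σ : Type*} [Finite σ] [DecidableEq σ] (i : σ) (c : integers E)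
    (z : σ → Disc p) : lin hϖ hf (Pi.single i c) z = scale hϖ hf c (z i) := by
  rw [← lin_single hϖ hf i z, scale_lin, ← Pi.single_smul, smul_eq_mul, mul_one]

/-- The torsion points satisfying `P` form a finite union of images under changes of variables of
intersections of hyperplanes. -/
def IsSpecialLocus {n : ℕ} (P : (Fin n → Disc p) → Prop) : Prop :=
  ∃ J : Set (Matrix (Fin n) (Fin n) (integers E) × Finset (Fin n) × (Fin n → Disc p)),
    J.Finite ∧ (∀ j ∈ J, j.1 ∈ changeMatrices (integers E) n ∧ ∀ i, IsTorsion hϖ hf (j.2.2 i)) ∧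
    ∀ z : Fin n → Disc p, (∀ i, IsTorsion hϖ hf (z i)) →
      (P z ↔ ∃ j ∈ J, z ∈ linMap hϖ hf j.1 '' torsionOn hϖ hf j.2.1 j.2.2)

variable {hϖ hf}

lemma cons_mem_torsionOn_iff {n : ℕ} {s : Finset (Fin n)} {τ z : Fin n → Disc p} {x y : Disc p}
    (hx : IsTorsion hϖ hf x) :
    (Fin.cons y z : Fin (n + 1) → Disc p) ∈
        torsionOn hϖ hf (insert 0 (s.map (Fin.succEmb n))) (Fin.cons x τ) ↔
      y = x ∧ z ∈ torsionOn hϖ hf s τ := by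
  constructor
  · rintro ⟨h1, h2⟩
    refine ⟨h2 0 (by simp), fun i => h1 i.succ, fun i hi => ?_⟩
    have := h2 i.succ (by simp [hi])
    rwa [Fin.cons_succ, Fin.cons_succ] at this
  · rintro ⟨rfl, h1, h2⟩
    refine ⟨fun i => ?_, fun i hi => ?_⟩
    · refine Fin.cases ?_ (fun i => ?_) i
      · exact hx
      · exact h1 i
    · rcases Finset.mem_insert.mp hi with rfl | hi
      · rfl
      · obtain ⟨j, hj, rfl⟩ := Finset.mem_map.mp hi
        exact h2 j hj

variable [FiniteDimensional ℚ_[p] E]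

/-- The inductive step: after a change of variables the linear equation fixes the first coordinate,
and the slice is a locus in n variables. Its equations have coefficients in a larger field
containing that coordinate, which is why `ih` is stated for all K. -/
lemma isSpecialLocus_of_lin_eq {K : IntermediateField ℚ_[p] (PadicAlgCl p)}
    [FiniteDimensional ℚ_[p] K] (hEK : E ≤ K) {n : ℕ}
    (ih : ∀ {K : IntermediateField ℚ_[p] (PadicAlgCl p)} [FiniteDimensional ℚ_[p] K],
      E ≤ K → ∀ I : Set (MvPowerSeries (Fin n) (integers K)),
      IsSpecialLocus hϖ hf fun z => ∀ φ ∈ I, evalAt z φ = 0)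
    (I : Set (MvPowerSeries (Fin (n + 1)) (integers K))) {b : Fin (n + 1) → integers E}
    {i : Fin (n + 1)} (hi : IsUnit (b i)) {τ : Disc p} (hτ : IsTorsion hϖ hf τ) :
    IsSpecialLocus hϖ hf fun z => lin hϖ hf b z = τ ∧ ∀ φ ∈ I, evalAt z φ = 0 := by
  classical
  obtain ⟨g, hg, hgb⟩ := exists_changeMatrices_vecMul hi
  obtain ⟨U, rfl⟩ := isUnit_of_mem_changeMatrices hg
  obtain ⟨u, hu⟩ := hi
  have hlin : ∀ y : Fin (n + 1) → Disc p,
      lin hϖ hf b (linMap hϖ hf U.val y) = τ ↔ y 0 = scale hϖ hf ↑u⁻¹ τ := by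
    intro y
    rw [lin_linMap, hgb, ← hu, lin_single_eq_scale]
    constructor
    · rintro rfl
      rw [scale_scale, Units.inv_mul, scale_one]
    · intro h
      rw [h, scale_scale, Units.mul_inv, scale_one]
  set τ' := scale hϖ hf ↑u⁻¹ τ with hτ'
  have hτ'tors : IsTorsion hϖ hf τ' := IsTorsion.lin (fun _ => hτ) _
  obtain ⟨ζ, hζ, hζτ⟩ := hτ'tors.exists_toDisc_eq
  have hfin : FiniteDimensional ℚ_[p] (IntermediateField.adjoin ℚ_[p] {ζ}) :=
    IntermediateField.finiteDimensional_adjoin fun x _ =>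
      (Algebra.IsAlgebraic.isAlgebraic x).isIntegral
  obtain ⟨K', hK', hKK', hζK'⟩ : ∃ K' : IntermediateField ℚ_[p] (PadicAlgCl p),
      FiniteDimensional ℚ_[p] K' ∧ K ≤ K' ∧ ζ ∈ K' :=
    ⟨K ⊔ IntermediateField.adjoin ℚ_[p] {ζ}, IntermediateField.finiteDimensional_sup _ _,
      le_sup_left, (le_sup_right : _ ≤ K ⊔ IntermediateField.adjoin ℚ_[p] {ζ})
        (IntermediateField.subset_adjoin _ _ rfl)⟩
  have hψ : ∀ φ : MvPowerSeries (Fin (n + 1)) (integers K),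
      ∃ ψ : MvPowerSeries (Fin n) (integers K'), ∀ z : Fin n → Disc p,
        evalAt z ψ = evalAt (linMap hϖ hf U.val (Fin.cons τ' z)) φ := by
    intro φ
    obtain ⟨ψ, hψ⟩ := exists_evalAt_cons (K := K') (τ := ⟨ζ, hζK', hζ.1.le⟩) hζ.1
      (MvPowerSeries.map (Subring.inclusion (integers_mono hKK'))
        (linearSubst hϖ hf (Subring.inclusion (integers_mono hEK)) U.val φ))
    refine ⟨ψ, fun z => ?_⟩
    rw [hψ, evalAt_map _ (algebraMap_inclusion hKK'), evalAt_linMap hϖ hf hEK]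
    change evalAt (linMap hϖ hf U.val (Fin.cons (toDisc ζ) z)) φ = _
    rw [hζτ]
  choose ψ hψ using hψ
  obtain ⟨J, hJfin, hJ, hJz⟩ := ih (hEK.trans hKK') (ψ '' I)
  -- Each piece of the slice gains the condition on coordinate 0; its matrix gains a block 1 and is
  -- followed by U.
  refine ⟨(fun j => (U.val * consMatrix j.1, insert 0 (j.2.1.map (Fin.succEmb n)),
    Fin.cons τ' j.2.2)) '' J, hJfin.image _, ?_, fun z hz => ?_⟩
  · rintro _ ⟨j, hj, rfl⟩
    refine ⟨mul_mem hg (consMatrix_mem (hJ j hj).1), fun i => ?_⟩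
    refine Fin.cases ?_ (fun i => ?_) i
    · exact hτ'tors
    · exact (hJ j hj).2 i
  · constructor
    · rintro ⟨hbz, hIz⟩
      obtain ⟨y, hy, rfl⟩ := exists_linMap_eq U hz
      have hy0 := (hlin y).mp hbz
      have hcons : y = Fin.cons τ' (Fin.tail y) := by rw [← hy0, Fin.cons_self_tail]
      have h1 : ∀ φ ∈ ψ '' I, evalAt (Fin.tail y) φ = 0 := by
        rintro _ ⟨φ, hφ, rfl⟩
        rw [hψ, ← hcons]
        exact hIz φ hφ
      obtain ⟨j, hj, w, hw, hwy⟩ := (hJz (Fin.tail y) fun i => hy i.succ).mp h1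
      refine ⟨_, ⟨j, hj, rfl⟩, Fin.cons τ' w, (cons_mem_torsionOn_iff hτ'tors).mpr ⟨rfl, hw⟩, ?_⟩
      rw [linMap_mul, linMap_consMatrix, hwy, ← hcons]
    · rintro ⟨_, ⟨j, hj, rfl⟩, w, hw, rfl⟩
      obtain ⟨x, w, rfl⟩ : ∃ x w', w = Fin.cons x w' := ⟨w 0, Fin.tail w, (Fin.cons_self_tail w).symm⟩
      obtain ⟨rfl, hw'⟩ := (cons_mem_torsionOn_iff hτ'tors).mp hw
      rw [linMap_mul, linMap_consMatrix]
      refine ⟨(hlin _).mpr rfl, fun φ hφ => ?_⟩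
      rw [← hψ]
      exact (hJz _ (isTorsion_linMap _ hw'.1)).mpr ⟨j, hj, w, hw', rfl⟩ _ ⟨φ, hφ, rfl⟩

variable (hϖ hf)

/-- The torsion points which are common zeros of a set of power series form a finite union of
images under changes of variables of intersections of hyperplanes. -/
theorem isSpecialLocus_zeros {K : IntermediateField ℚ_[p] (PadicAlgCl p)}
    [FiniteDimensional ℚ_[p] K] (hEK : E ≤ K) {n : ℕ}
    (I : Set (MvPowerSeries (Fin n) (integers K))) :
    IsSpecialLocus hϖ hf fun z => ∀ φ ∈ I, evalAt z φ = 0 := by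
  classical
  induction n generalizing K with
  | zero =>
    by_cases h : ∀ φ ∈ I, evalAt (fun i => i.elim0 : Fin 0 → Disc p) φ = 0
    · refine ⟨{(1, ∅, fun _ => 0)}, Set.finite_singleton _, ?_, fun z hz => ?_⟩
      · rintro _ rfl
        exact ⟨one_mem _, fun _ => isTorsion_zero⟩
      · exact iff_of_true (fun φ hφ => Subsingleton.elim _ z ▸ h φ hφ)
          ⟨_, rfl, z, ⟨hz, by simp⟩, linMap_one hϖ hf z⟩
    · refine ⟨∅, Set.finite_empty, by simp, fun z hz => iff_of_false (fun h1 => h ?_) (by simp)⟩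
      intro φ hφ
      rw [Subsingleton.elim (fun i => i.elim0 : Fin 0 → Disc p) z]
      exact h1 φ hφ
  | succ n ih =>
    by_cases hI : ∀ φ ∈ I, φ = 0
    · refine ⟨{(1, ∅, fun _ => 0)}, Set.finite_singleton _, ?_, fun z hz => ?_⟩
      · rintro _ rfl
        exact ⟨one_mem _, fun _ => isTorsion_zero⟩
      · refine iff_of_true (fun φ hφ => by rw [hI φ hφ, map_zero])
          ⟨_, rfl, z, ⟨hz, by simp⟩, linMap_one hϖ hf z⟩
    push Not at hI
    obtain ⟨φ, hφI, hφ⟩ := hI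
    -- A single non-zero member of I already confines the torsion zeros to finitely many translates,
    -- each of which is sliced.
    obtain ⟨W, hWfin, hW, hzero⟩ := exists_finite_forall_lin_eq hϖ hf hEK hφ
    have h : ∀ w ∈ W, IsSpecialLocus hϖ hf
        fun z => lin hϖ hf w.1 z = w.2 ∧ ∀ φ ∈ I, evalAt z φ = 0 := fun w hw => by
      obtain ⟨⟨i, hi⟩, hτ⟩ := hW w hw
      exact isSpecialLocus_of_lin_eq hEK ih I hi hτ
    choose! J hJfin hJ hJz using h
    refine ⟨⋃ w ∈ W, J w, hWfin.biUnion hJfin, ?_, fun z hz => ⟨fun h => ?_, ?_⟩⟩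
    · intro j hj
      obtain ⟨w, hw, hj⟩ := Set.mem_iUnion₂.mp hj
      exact hJ w hw j hj
    · obtain ⟨w, hw, hlin⟩ := hzero z hz (h φ hφI)
      obtain ⟨j, hj, hzj⟩ := (hJz w hw z hz).mp ⟨hlin, h⟩
      exact ⟨j, Set.mem_iUnion₂.mpr ⟨w, hw, hj⟩, hzj⟩
    · rintro ⟨j, hj, hzj⟩
      obtain ⟨w, hw, hj⟩ := Set.mem_iUnion₂.mp hj
      exact ((hJz w hw z hz).mpr ⟨j, hj, hzj⟩).2

end Structure

/-! ### Components of a closure dominated by finitely many primes. -/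

section Spectrum

/-- If `T` is a finite set of primes such that every prime in `S` contains one in `T` and every
element of all the primes in `S` is in all the primes in `T`, then the irreducible components of the
closure of `S` have generic points in `T`. -/
lemma exists_vanishingIdeal_eq {A : Type*} [CommRing A] {S T : Set (PrimeSpectrum A)}
    (hT : T.Finite) (h1 : ∀ P ∈ S, ∃ Q ∈ T, Q ≤ P)
    (h2 : ∀ Q ∈ T, ∀ a, (∀ P ∈ S, a ∈ P.asIdeal) → a ∈ Q.asIdeal) {Z : Set (PrimeSpectrum A)}
    (hZ : Maximal (fun W => IsIrreducible W ∧ W ⊆ closure S) Z) :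
    ∃ Q ∈ T, PrimeSpectrum.vanishingIdeal Z = Q.asIdeal := by
  classical
  -- S is covered by the closures of the points of T, so the irreducible Z lies in one of them. That
  -- closure is irreducible and inside the closure of S, so maximality gives equality.
  have hS : closure S ⊆ ⋃₀ ↑(hT.toFinset.image fun Q => closure {Q}) := by
    refine closure_minimal (fun P hP => ?_) ?_
    · obtain ⟨Q, hQ, hQP⟩ := h1 P hP
      exact ⟨closure {Q}, by simpa using ⟨Q, hQ, rfl⟩,
        (PrimeSpectrum.le_iff_mem_closure _ _).mp hQP⟩
    · rw [Set.sUnion_eq_biUnion]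
      refine (Finset.finite_toSet _).isClosed_biUnion fun W hW => ?_
      obtain ⟨Q, -, rfl⟩ := Finset.mem_image.mp hW
      exact isClosed_closure
  obtain ⟨W, hW, hZW⟩ := isIrreducible_iff_sUnion_isClosed.mp hZ.prop.1 _ (fun W hW => by
    obtain ⟨Q, -, rfl⟩ := Finset.mem_image.mp hW
    exact isClosed_closure) (hZ.prop.2.trans hS)
  obtain ⟨Q, hQ, rfl⟩ := Finset.mem_image.mp hW
  rw [Set.Finite.mem_toFinset] at hQ
  have hQS : Q ∈ closure S := by
    rw [← PrimeSpectrum.zeroLocus_vanishingIdeal_eq_closure, PrimeSpectrum.mem_zeroLocus]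
    exact fun a ha => h2 Q hQ a ((PrimeSpectrum.mem_vanishingIdeal _ _).mp ha)
  have hle := hZ.le_of_ge ⟨isIrreducible_singleton.closure,
    closure_minimal (Set.singleton_subset_iff.mpr hQS) isClosed_closure⟩ hZW
  refine ⟨Q, hQ, ?_⟩
  rw [Set.Subset.antisymm hZW hle, PrimeSpectrum.vanishingIdeal_closure,
    PrimeSpectrum.vanishingIdeal_singleton]

lemma exists_comap_mk_eq {R : Type*} [CommRing R] {I Q : Ideal R} [hQ : Q.IsPrime] (h : I ≤ Q) :
    ∃ P : PrimeSpectrum (R ⧸ I), P.asIdeal.comap (Ideal.Quotient.mk I) = Q := by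
  have h1 : (⟨Q, hQ⟩ : PrimeSpectrum R) ∈ Set.range (PrimeSpectrum.comap (Ideal.Quotient.mk I)) := by
    rw [range_comap_of_surjective _ _ Ideal.Quotient.mk_surjective,
      PrimeSpectrum.mem_zeroLocus, Ideal.mk_ker]
    exact h
  obtain ⟨P, hP⟩ := h1
  exact ⟨P, congrArg PrimeSpectrum.asIdeal hP⟩

end Spectrum

/-! ### Proof of the theorem. -/

section Special

variable {p : ℕ} [Fact p.Prime] {E F : IntermediateField ℚ_[p] (PadicAlgCl p)}
  [FiniteDimensional ℚ_[p] E] [FiniteDimensional ℚ_[p] F] (hEF : E ≤ F)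
  {ϖ : integers E} {f : PowerSeries (integers E)} (hϖ : IsUniformizer ϖ)
  (hf : IsLubinTateSeries ϖ f)

variable {hϖ hf} in
include hEF in
lemma mem_hyperplaneIdeal_univ_iff {n : ℕ} {ζ : Fin n → PadicAlgCl p}
    (hζ : ∀ i, ζ i ∈ torsionPoints hϖ hf) {φ : MvPowerSeries (Fin n) (integers F)} :
    φ ∈ hyperplaneIdeal F Finset.univ ζ ↔ evalAt (fun i => toDisc (ζ i)) φ = 0 := by
  rw [mem_hyperplaneIdeal_iff hEF fun i _ => hζ i]
  constructor
  · exact fun h => h _ ⟨fun i => isTorsion_toDisc (hζ i), fun _ _ => rfl⟩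
  · rintro h z ⟨-, hz⟩
    rwa [funext fun i => hz i (Finset.mem_univ i)]

variable {hϖ hf} in
lemma mem_comap_hyperplaneIdeal_iff {n : ℕ} (g : Matrix (Fin n) (Fin n) (integers E))
    {s : Finset (Fin n)} {ζ : Fin n → PadicAlgCl p} (hζ : ∀ i ∈ s, ζ i ∈ torsionPoints hϖ hf)
    (φ : MvPowerSeries (Fin n) (integers F)) :
    φ ∈ (hyperplaneIdeal F s ζ).comap
        (linearSubst hϖ hf (Subring.inclusion (integers_mono hEF)) g).toRingHom ↔
      ∀ w ∈ torsionOn hϖ hf s fun i => toDisc (ζ i), evalAt (linMap hϖ hf g w) φ = 0 := by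
  rw [Ideal.mem_comap, mem_hyperplaneIdeal_iff hEF hζ]
  refine forall₂_congr fun w _ => ?_
  rw [← evalAt_linMap hϖ hf hEF]
  rfl

/-- The candidate generic points are the ideals `Q j` of series vanishing on one piece of the
torsion locus of I. They are prime, as pullbacks of hyperplane ideals, and finite in number. -/
theorem isSpecial_of_maximal {n : ℕ} (I : Ideal (MvPowerSeries (Fin n) (integers F)))
    {Z : Set (PrimeSpectrum (MvPowerSeries (Fin n) (integers F) ⧸ I))}
    (hZ : Maximal (fun T => IsIrreducible T ∧ T ⊆ closure (specialPoints hϖ hf I)) Z) :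
    IsSpecial hEF hϖ hf ((PrimeSpectrum.vanishingIdeal Z).comap (Ideal.Quotient.mk I)) := by
  classical
  have hsurj : Function.Surjective (Ideal.Quotient.mk I) := Ideal.Quotient.mk_surjective
  obtain ⟨J, hJfin, hJ, hJz⟩ := isSpecialLocus_zeros hϖ hf hEF
    (I : Set (MvPowerSeries (Fin n) (integers F)))
  have hex : ∀ z : Fin n → Disc p, (∀ i, IsTorsion hϖ hf (z i)) →
      ∃ ζ : Fin n → PadicAlgCl p, (∀ i, ζ i ∈ torsionPoints hϖ hf) ∧
        (fun i => toDisc (ζ i)) = z := by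
    intro z hz
    choose ζ hζ hζz using fun i => (hz i).exists_toDisc_eq
    exact ⟨ζ, hζ, funext hζz⟩
  choose! ζ hζ hζτ using fun j hj => hex _ (hJ j hj).2
  let Q : Matrix (Fin n) (Fin n) (integers E) × Finset (Fin n) × (Fin n → Disc p) →
      Ideal (MvPowerSeries (Fin n) (integers F)) := fun j =>
    (hyperplaneIdeal F j.2.1 (ζ j)).comap
      (linearSubst hϖ hf (Subring.inclusion (integers_mono hEF)) j.1).toRingHom
  have hQ : ∀ j ∈ J, ∀ φ, φ ∈ Q j ↔
      ∀ w ∈ torsionOn hϖ hf j.2.1 j.2.2, evalAt (linMap hϖ hf j.1 w) φ = 0 := by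
    intro j hj φ
    rw [← hζτ j hj]
    exact mem_comap_hyperplaneIdeal_iff hEF j.1 (fun i _ => hζ j hj i) φ
  have hcomap : Function.Injective fun P : PrimeSpectrum (MvPowerSeries (Fin n) (integers F) ⧸ I) =>
      P.asIdeal.comap (Ideal.Quotient.mk I) := fun P P' h =>
    PrimeSpectrum.ext (Ideal.comap_injective_of_surjective _ hsurj h)
  have hgen : ∃ P ∈ (fun P : PrimeSpectrum (MvPowerSeries (Fin n) (integers F) ⧸ I) =>
      P.asIdeal.comap (Ideal.Quotient.mk I)) ⁻¹' (Q '' J), PrimeSpectrum.vanishingIdeal Z = P.asIdeal := by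
    refine exists_vanishingIdeal_eq ((hJfin.image Q).preimage hcomap.injOn) ?_ ?_ hZ
    -- A special point is a torsion zero of I, so it lies on some piece j and its prime contains `Q
    -- j`.
    · rintro P ⟨ζ', hζ', hP⟩
      obtain ⟨j, hj, w, hw, hwz⟩ := (hJz _ fun i => isTorsion_toDisc (hζ' i)).mp fun φ hφ => by
        rw [← mem_hyperplaneIdeal_univ_iff hEF hζ', ← hP, Ideal.mem_comap,
          Ideal.Quotient.eq_zero_iff_mem.mpr hφ]
        exact zero_mem _
      have hle : Q j ≤ P.asIdeal.comap (Ideal.Quotient.mk I) := by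
        intro φ hφ
        rw [hP, mem_hyperplaneIdeal_univ_iff hEF hζ', ← hwz]
        exact (hQ j hj φ).mp hφ w hw
      have hIQ : I ≤ Q j := fun φ hφ => (hQ j hj φ).mpr fun w hw =>
        (hJz _ (isTorsion_linMap _ hw.1)).mpr ⟨j, hj, w, hw, rfl⟩ φ hφ
      have hprime : (Q j).IsPrime := by
        have := hyperplaneIdeal_isPrime (F := F) hEF (s := j.2.1) fun i _ => hζ j hj i
        exact Ideal.comap_isPrime _ _
      obtain ⟨P', hP'⟩ := exists_comap_mk_eq hIQ
      refine ⟨P', ⟨j, hj, hP'.symm⟩, ?_⟩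
      rw [← PrimeSpectrum.asIdeal_le_asIdeal, ← Ideal.comap_le_comap_iff_of_surjective _ hsurj, hP']
      exact hle
    -- Every torsion point of a piece is a zero of I, hence gives a special point, at which the
    -- series vanishes by assumption.
    · rintro P ⟨j, hj, hjP⟩ a ha
      obtain ⟨φ, rfl⟩ := hsurj a
      change φ ∈ P.asIdeal.comap (Ideal.Quotient.mk I)
      have hjP' : P.asIdeal.comap (Ideal.Quotient.mk I) = Q j := hjP.symm
      rw [hjP']
      refine (hQ j hj φ).mpr fun w hw => ?_
      have hz := isTorsion_linMap (hϖ := hϖ) (hf := hf) j.1 hw.1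
      obtain ⟨ζ', hζ', hζz⟩ := hex _ hz
      have hprime := hyperplaneIdeal_isPrime (F := F) hEF (s := Finset.univ) fun i _ => hζ' i
      obtain ⟨P', hP'⟩ := exists_comap_mk_eq (I := I) (Q := hyperplaneIdeal F Finset.univ ζ')
        fun φ hφ => by
          rw [mem_hyperplaneIdeal_univ_iff hEF hζ', hζz]
          exact (hJz _ hz).mpr ⟨j, hj, w, hw, rfl⟩ φ hφ
      have h1 : φ ∈ P'.asIdeal.comap (Ideal.Quotient.mk I) := ha P' ⟨ζ', hζ', hP'⟩
      rwa [hP', mem_hyperplaneIdeal_univ_iff hEF hζ', hζz] at h1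
  obtain ⟨P, ⟨j, hj, hjP⟩, hZP⟩ := hgen
  have hjP' : P.asIdeal.comap (Ideal.Quotient.mk I) = Q j := hjP.symm
  rw [hZP, hjP']
  -- The change of variables is surjective, so the image of the pullback `Q j` is the hyperplane
  -- ideal itself, and the union has one member.
  refine ⟨_, isChangeOfVariables_linearSubst hϖ hf (Subring.inclusion (integers_mono hEF))
    (hJ j hj).1, {(j.2.1, ζ j)}, ?_, ?_⟩
  · intro h hh i _
    rw [Finset.mem_singleton.mp hh]
    exact hζ j hj i
  · rw [Finset.iInf_singleton]
    exact Ideal.map_comap_of_surjective _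
      (linearSubst_surjective hϖ hf _ (isUnit_of_mem_changeMatrices (hJ j hj).1)) _

end Special

end LubinTate
end

theorem theorem3p5 (p : ℕ) [Fact p.Prime]
    -- finite extensions `E ⊆ F` of `ℚ_p` inside the algebraic closure of `ℚ_p`
    (E F : IntermediateField ℚ_[p] (PadicAlgCl p)) [FiniteDimensional ℚ_[p] F] (hEF : E ≤ F)
    -- a uniformizer of `E` and a Lubin-Tate series for it
    (ϖ : LubinTate.integers E) (hϖ : LubinTate.IsUniformizer ϖ)
    (f : PowerSeries (LubinTate.integers E)) (hf : LubinTate.IsLubinTateSeries ϖ f)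
    (n : ℕ) (I : Ideal (MvPowerSeries (Fin n) (LubinTate.integers F)))
    -- an irreducible component of the Zariski closure of the special points of `Spec A`
    (Z : Set (PrimeSpectrum (MvPowerSeries (Fin n) (LubinTate.integers F) ⧸ I)))
    (hZ : Maximal
      (fun T => IsIrreducible T ∧ T ⊆ closure (LubinTate.specialPoints hϖ hf I)) Z) :
    LubinTate.IsSpecial hEF hϖ hf
      ((PrimeSpectrum.vanishingIdeal Z).comap (Ideal.Quotient.mk I)) := by
  have : FiniteDimensional ℚ_[p] E := FiniteDimensional.of_injective
    (IntermediateField.inclusion hEF).toLinearMap (IntermediateField.inclusion hEF).injective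
  exact LubinTate.isSpecial_of_maximal hEF hϖ hf I hZ
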